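/- **Setting.** Fix a denumerable set of channel names $c,d$. Processes are $$P,Q ::= u!\vec v.P \mid u?\vec x.P \mid \mathsf{nil} \mid \mathsf{if}\ u=v\ \mathsf{then}\ P\ \mathsf{else}\ Q \mid \mathsf{rec}\,w.P \mid w \mid P\,|\,Q \mid \mathsf{alloc}\ x.P \mid \mathsf{free}\ u.P ,$$ where $u,v$ are channel names or channel variables, $w$ is a process variable, and $\vec x$ in $u?\vec x.P$, $w$ in $\mathsf{rec}\,w.P$, $x$ in $\mathsf{alloc}\ x.P$ are bound (terms are taken up to $\alpha$-equivalence). A *system* $M\triangleright P$ is a closed process $P$ with a set $M$ of allocated channels whose complement is infinite. *Types.* Attributes are $a::=\omega$ (unrestricted) $\mid 1$ (affine) $\mid \bullet i$ (unique after $i\in\mathbb N$ uses); channel types are the closed contractive expressions $U::=[U_1,\dots,U_k]^a\mid \mu X.U\mid X$; types are $T::=U\mid\mathsf{proc}$. $\sim$ is the least congruence on channel types with $\mu X.U\sim U\{\mu X.U/X\}$. Splitting: $[\vec U]^\omega=[\vec U]^\omega\circ[\vec U]^\omega$, $\mathsf{proc}=\mathsf{proc}\circ\mathsf{proc}$, $[\vec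 U]^{\bullet i}=[\vec U]^1\circ[\vec U]^{\bullet(i+1)}$. An environment $\Gamma$ is a finite multiset of assumptions $u:T$; "," is multiset union and $\mathrm{dom}(\Gamma)$ is the set of identifiers with an assumption in $\Gamma$. $\prec$ is the least reflexive transitive relation on environments with: $\Gamma,u{:}T\prec\Gamma,u{:}T_1,u{:}T_2$ and conversely, if $T=T_1\circ T_2$; $\Gamma,u{:}U_1\prec\Gamma,u{:}U_2$ if $U_1\sim U_2$; $\Gamma,u{:}T\prec\Gamma$; $\Gamma,u{:}[\vec U]^a\prec\Gamma,u{:}[\vec U]^{b}$ for $(a,b)\in\{(\bullet i,\bullet(i+1)),(\bullet i,\omega),(\omega,1)\}$; $\Gamma,u{:}[\vec U]^{\bullet0}\prec\Gamma,u{:}[\vec U']^{\bullet0}$. $\Gamma$ is *consistent* if $\Gamma'\prec\Gamma$ for some $\Gamma'$ with at most one assumption per identifier. Write $u{:}[\vec U]^{a-1}$ for: no assumption if $a=1$; $u{:}[\vec U]^\omega$ if $a=\omega$; $u{:}[\vec U]^{\bullet i}$ if $a=\bullet(i+1)$; undefined if $a=\bullet0$. *Typing* $\Gamma\vdash P$ is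 the least relation such that (bound variables being fresh): - $\Gamma,u{:}[\vec U]^a,\vec v{:}\vec U\vdash u!\vec v.P$ if $\Gamma,u{:}[\vec U]^{a-1}\vdash P$; - $\Gamma,u{:}[\vec U]^a\vdash u?\vec x.P$ if $\Gamma,u{:}[\vec U]^{a-1},\vec x{:}\vec U\vdash P$; - $\Gamma_1,\Gamma_2\vdash P|Q$ if $\Gamma_1\vdash P$ and $\Gamma_2\vdash Q$; - $\Gamma\vdash\mathsf{if}\ u=v\ \mathsf{then}\ P\ \mathsf{else}\ Q$ if $u,v\in\mathrm{dom}(\Gamma)$, $\Gamma\vdash P$ and $\Gamma\vdash Q$; - $\Gamma\vdash\mathsf{rec}\,w.P$ if $\Gamma,w{:}\mathsf{proc}\vdash P$ and all types in $\Gamma$ are $\mathsf{proc}$ or of the form $[\vec U]^\omega$; - $w{:}\mathsf{proc}\vdash w$; $\ \emptyset\vdash\mathsf{nil}$; - $\Gamma,u{:}[\vec U]^{\bullet0}\vdash\mathsf{free}\ u.P$ if $\Gamma\vdash P$; - $\Gamma\vdash\mathsf{alloc}\ x.P$ if $\Gamma,x{:}[\vec U]^{\bullet0}\vdash P$ for some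 $\vec U$; - $\Gamma\vdash P$ if $\Gamma\prec\Gamma'$ and $\Gamma'\vdash P$. $\Gamma\triangleleft M\triangleright P$ is a *configuration* if $\mathrm{dom}(\Gamma)\subseteq M$ and there is $\Sigma$ with $\Gamma,\Sigma$ consistent, $\Sigma\vdash P$, $\mathrm{dom}(\Sigma)\subseteq M$ and $\Sigma$ consistent. *Transitions.* Pre-transitions $\Gamma\triangleleft M\triangleright P\xrightarrow{\mu}_k\Gamma'\triangleleft M'\triangleright P'$, with cost $k\in\mathbb Z$, are generated by: - $\Gamma,c{:}[\vec U]^a\triangleleft M\triangleright c!\vec d.P\xrightarrow{c!\vec d}_0\Gamma,c{:}[\vec U]^{a-1},\vec d{:}\vec U\triangleleft M\triangleright P$; - $\Gamma,c{:}[\vec U]^a,\vec d{:}\vec U\triangleleft M\triangleright c?\vec x.P\xrightarrow{c?\vec d}_0\Gamma,c{:}[\vec U]^{a-1}\triangleleft M\triangleright P\{\vec d/\vec x\}$; - if $\Gamma_1\triangleleft M\triangleright P\xrightarrow{c!\vec d}_0\Gamma_1'\triangleleft M\triangleright P'$ and $\Gamma_2\triangleleft M\triangleright Q\xrightarrow{c?\vec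 d}_0\Gamma_2'\triangleleft M\triangleright Q'$ for some $\Gamma_1,\Gamma_1',\Gamma_2,\Gamma_2'$, then $\Gamma\triangleleft M\triangleright P|Q\xrightarrow{\tau}_0\Gamma\triangleleft M\triangleright P'|Q'$ for every $\Gamma$; and symmetrically; - if $\Gamma\triangleleft M\triangleright P\xrightarrow{\mu}_k\Gamma'\triangleleft M'\triangleright P'$ then $\Gamma\triangleleft M\triangleright P|Q\xrightarrow{\mu}_k\Gamma'\triangleleft M'\triangleright P'|Q$; and symmetrically; - $\tau$-steps that leave $\Gamma$ unchanged: $M\triangleright\mathsf{rec}\,w.P\to_0M\triangleright P\{\mathsf{rec}\,w.P/w\}$; $M\triangleright\mathsf{if}\ c=c\ \mathsf{then}\ P\ \mathsf{else}\ Q\to_0M\triangleright P$ if $c\in M$; $M\triangleright\mathsf{if}\ c=d\ \mathsf{then}\ P\ \mathsf{else}\ Q\to_0M\triangleright Q$ if $c\ne d$ are both in $M$; $M\triangleright\mathsf{alloc}\ x.P\to_{+1}M\cup\{c\}\triangleright P\{c/x\}$ if $c\notin M$; $M\triangleright\mathsf{free}\ c.P\to_{-1}M\setminus\{c\}\triangleright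 P$ if $c\in M$; - observer steps: $\Gamma\triangleleft M\triangleright P\xrightarrow{\mathsf{env}}_0\Gamma'\triangleleft M\triangleright P$ if $\Gamma\prec\Gamma'$; $\Gamma\triangleleft M\triangleright P\xrightarrow{\mathsf{alloc}}_{+1}\Gamma,c{:}[\vec U]^{\bullet0}\triangleleft M\cup\{c\}\triangleright P$ if $c\notin M$; $\Gamma,c{:}[\vec U]^{\bullet0}\triangleleft M\triangleright P\xrightarrow{\mathsf{free}\,c}_{-1}\Gamma\triangleleft M\setminus\{c\}\triangleright P$ if $c\in M$. There is a *transition* $\Gamma\triangleleft M\triangleright P\xrightarrow{\mu}_k\Gamma'\triangleleft M'\triangleright P'$ if there is a pre-transition with the same data from $\Gamma\triangleleft(M\triangleright P)\sigma$ for some bijection $\sigma$ of the channel names that fixes $\mathrm{dom}(\Gamma)$ pointwise. Weak transitions $\stackrel{\mu}{\Rightarrow}_k$ pad a $\mu$-transition with finitely many $\tau$-transitions before and after it, $k$ being the sum of all costs; $\stackrel{\hat\mu}{\Rightarrow}_k$ is $\stackrel{\mu}{\Rightarrow}_k$ if $\mu\neq\tau$, and a possibly empty sequence of $\tau$-transitions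 with total cost $k$ if $\mu=\tau$. *Bisimilarity.* Consider families $\mathcal R$ of relations $\Gamma\vDash S\,\mathcal R^n\,S'$ between systems, indexed by an environment $\Gamma$ and a credit $n\in\mathbb N$, which relate $S,S'$ at $\Gamma$ only if $\Gamma\triangleleft S$ and $\Gamma\triangleleft S'$ are configurations. $\mathcal R$ is an *amortised typed bisimulation* if $\Gamma\vDash S\,\mathcal R^n\,T$ implies: - if $\Gamma\triangleleft S\xrightarrow{\mu}_k\Gamma'\triangleleft S'$, then there are $l$ and $T'$ with $\Gamma\triangleleft T\stackrel{\hat\mu}{\Rightarrow}_l\Gamma'\triangleleft T'$, $n+l-k\ge0$ and $\Gamma'\vDash S'\,\mathcal R^{n+l-k}\,T'$; - if $\Gamma\triangleleft T\xrightarrow{\mu}_l\Gamma'\triangleleft T'$, then there are $k$ and $S'$ with $\Gamma\triangleleft S\stackrel{\hat\mu}{\Rightarrow}_k\Gamma'\triangleleft S'$, $n+l-k\ge0$ and $\Gamma'\vDash S'\,\mathcal R^{n+l-k}\,T'$. $\Gamma\vDash S\sqsubseteq^n_{\mathrm{bis}}T$ means that $\Gamma\vDash S\,\mathcal R^n\,T$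 for some amortised typed bisimulation $\mathcal R$. **Theorem (Contextuality).** Let $\Gamma,\Delta$ be type environments, $n\in\mathbb N$, $M\triangleright P$ and $N\triangleright Q$ systems, and $R$ a closed process. If $\Gamma,\Delta\vDash(M\triangleright P)\sqsubseteq^n_{\mathrm{bis}}(N\triangleright Q)$ and $\Delta\vdash R$, then $$\Gamma\vDash(M\triangleright P|R)\sqsubseteq^n_{\mathrm{bis}}(N\triangleright Q|R)\quad\text{and}\quad\Gamma\vDash(M\triangleright R|P)\sqsubseteq^n_{\mathrm{bis}}(N\triangleright R|Q).$$ -/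

import Mathlib

namespace Picr

/-! ### Syntax

Terms are written with well-scoped de Bruijn variables, so alpha-equivalent terms are equal.
Variables bound by input and allocation (standing for channels) and variables bound by recursion
(standing for processes) are two sorts. -/

/-- Channel names. -/
abbrev Chan : Type := ℕ

/-- Channel identifiers: a channel name, or one of `n` variables in scope. -/
inductive Val (n : ℕ) : Type
  | chan (c : Chan) : Val n
  | var (i : Fin n) : Val n

/-- Processes with `n` free channel variables and `m` free process variables.
`inp u k P` is the polyadic input binding `k` variables in `P`. -/
inductive Proc : ℕ → ℕ → Type
  | out {n m : ℕ} (u : Val n) (k : ℕ) (v : Fin k → Val n) (P : Proc n m) : Proc n m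
  | inp {n m : ℕ} (u : Val n) (k : ℕ) (P : Proc (n + k) m) : Proc n m
  | nil {n m : ℕ} : Proc n m
  | cond {n m : ℕ} (u v : Val n) (P Q : Proc n m) : Proc n m
  | fix {n m : ℕ} (P : Proc n (m + 1)) : Proc n m
  | pvar {n m : ℕ} (w : Fin m) : Proc n m
  | par {n m : ℕ} (P Q : Proc n m) : Proc n m
  | alloc {n m : ℕ} (P : Proc (n + 1) m) : Proc n m
  | free {n m : ℕ} (u : Val n) (P : Proc n m) : Proc n m

/-- Weakening of an identifier by `k` new variables (placed after the old ones). -/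
def Val.weaken {n : ℕ} (k : ℕ) : Val n → Val (n + k)
  | .chan c => .chan c
  | .var i => .var (Fin.castAdd k i)

/-- The identifiers of the `k` newly bound variables. -/
def Val.fresh (n : ℕ) {k : ℕ} (j : Fin k) : Val (n + k) := .var (Fin.natAdd n j)

/-- A map of identifiers, extended under a binder of `k` variables. -/
def Val.lift {n n' : ℕ} (k : ℕ) (f : Val n → Val n') : Val (n + k) → Val (n' + k)
  | .chan c => (f (.chan c)).weaken k
  | .var i => Fin.addCases (fun i => (f (.var i)).weaken k) (fun j => Val.fresh n' j) i

/-- The map of identifiers that replaces the last `k` variables by `d`. -/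
def Val.inst {n k : ℕ} (d : Fin k → Val n) : Val (n + k) → Val n
  | .chan c => .chan c
  | .var i => Fin.addCases (fun i => .var i) d i

/-- The action of a map of channel names on identifiers. -/
def Val.mapChan {n : ℕ} (s : Chan → Chan) : Val n → Val n
  | .chan c => .chan (s c)
  | .var i => .var i

/-- Application of a map `f` on channel identifiers and a map `g` on process variables. -/
def Proc.rename : {n m n' m' : ℕ} → (Val n → Val n') → (Fin m → Fin m') →
    Proc n m → Proc n' m'
  | _, _, _, _, f, g, .out u k v P => .out (f u) k (fun i => f (v i)) (P.rename f g)
  | _, _, _, _, f, g, .inp u k P => .inp (f u) k (P.rename (Val.lift k f) g)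
  | _, _, _, _, _, _, .nil => .nil
  | _, _, _, _, f, g, .cond u v P Q => .cond (f u) (f v) (P.rename f g) (Q.rename f g)
  | _, _, _, _, f, g, .fix P => .fix (P.rename f (Fin.cases 0 (fun w => (g w).succ)))
  | _, _, _, _, _, g, .pvar w => .pvar (g w)
  | _, _, _, _, f, g, .par P Q => .par (P.rename f g) (Q.rename f g)
  | _, _, _, _, f, g, .alloc P => .alloc (P.rename (Val.lift 1 f) g)
  | _, _, _, _, f, g, .free u P => .free (f u) (P.rename f g)

/-- Simultaneous capture-avoiding substitution of processes for process variables. -/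
def Proc.psubst : {n m m' : ℕ} → (Fin m → Proc n m') → Proc n m → Proc n m'
  | _, _, _, s, .out u k v P => .out u k v (P.psubst s)
  | _, _, _, s, .inp u k P =>
      .inp u k (P.psubst (fun w => (s w).rename (Val.weaken k) id))
  | _, _, _, _, .nil => .nil
  | _, _, _, s, .cond u v P Q => .cond u v (P.psubst s) (Q.psubst s)
  | _, _, _, s, .fix P =>
      .fix (P.psubst (Fin.cases (.pvar 0) (fun w => (s w).rename id Fin.succ)))
  | _, _, _, s, .pvar w => s w
  | _, _, _, s, .par P Q => .par (P.psubst s) (Q.psubst s)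
  | _, _, _, s, .alloc P => .alloc (P.psubst (fun w => (s w).rename (Val.weaken 1) id))
  | _, _, _, s, .free u P => .free u (P.psubst s)

/-- Instantiation of the last `k` channel variables: `P{d/x}`. -/
def Proc.inst {n m k : ℕ} (P : Proc (n + k) m) (d : Fin k → Val n) : Proc n m :=
  P.rename (Val.inst d) id

/-- Unfolding of recursion: `P{rec w.P/w}`. -/
def Proc.unfold {n m : ℕ} (P : Proc n (m + 1)) : Proc n m :=
  P.psubst (Fin.cases (.fix P) (fun w => .pvar w))

/-- Application of a map of channel names to a process. -/
def Proc.mapChan {n m : ℕ} (s : Chan → Chan) (P : Proc n m) : Proc n m :=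
  P.rename (Val.mapChan s) id

/-! ### Types -/

/-- Type attributes: unrestricted, affine, unique after `i` steps. -/
inductive Attr : Type
  | un : Attr
  | aff : Attr
  | uniq (i : ℕ) : Attr

/-- Channel type expressions with `n` free type variables. -/
inductive PreTy : ℕ → Type
  | chan {n : ℕ} (k : ℕ) (Us : Fin k → PreTy n) (a : Attr) : PreTy n
  | mu {n : ℕ} (U : PreTy (n + 1)) : PreTy n
  | var {n : ℕ} (x : Fin n) : PreTy n

/-- Renaming of type variables. -/
def PreTy.rename : {n n' : ℕ} → (Fin n → Fin n') → PreTy n → PreTy n'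
  | _, _, f, .chan k Us a => .chan k (fun i => (Us i).rename f) a
  | _, _, f, .mu U => .mu (U.rename (Fin.cases 0 (fun x => (f x).succ)))
  | _, _, f, .var x => .var (f x)

/-- Simultaneous substitution for type variables. -/
def PreTy.subst : {n n' : ℕ} → (Fin n → PreTy n') → PreTy n → PreTy n'
  | _, _, s, .chan k Us a => .chan k (fun i => (Us i).subst s) a
  | _, _, s, .mu U => .mu (U.subst (Fin.cases (.var 0) (fun x => (s x).rename Fin.succ)))
  | _, _, s, .var x => s x

/-- The type variable `x` occurs in the expression outside of all channel constructors. -/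
def PreTy.Unguarded : {n : ℕ} → Fin n → PreTy n → Prop
  | _, _, .chan _ _ _ => False
  | _, x, .mu U => U.Unguarded x.succ
  | _, x, .var y => x = y

/-- Every recursion variable occurs only inside channel constructors below its binder. -/
def PreTy.Contractive : {n : ℕ} → PreTy n → Prop
  | _, .chan _ Us _ => ∀ i, (Us i).Contractive
  | _, .mu U => ¬ U.Unguarded 0 ∧ U.Contractive
  | _, .var _ => True

/-- Equi-recursive type equality: the least congruence containing all unfoldings. -/
inductive TyEq : {n : ℕ} → PreTy n → PreTy n → Prop
  | refl {n : ℕ} (U : PreTy n) : TyEq U U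
  | symm {n : ℕ} {U V : PreTy n} : TyEq U V → TyEq V U
  | trans {n : ℕ} {U V W : PreTy n} : TyEq U V → TyEq V W → TyEq U W
  | unfold {n : ℕ} (U : PreTy (n + 1)) :
      TyEq (.mu U) (U.subst (Fin.cases (.mu U) (fun x => .var x)))
  | chan {n k : ℕ} {Us Vs : Fin k → PreTy n} (a : Attr) :
      (∀ i, TyEq (Us i) (Vs i)) → TyEq (.chan k Us a) (.chan k Vs a)
  | mu {n : ℕ} {U V : PreTy (n + 1)} : TyEq U V → TyEq (.mu U) (.mu V)

/-- Closed contractive channel types. -/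
def ChTy : Type := {U : PreTy 0 // U.Contractive}

/-- Types: channel types and the type of processes. -/
inductive Ty : Type
  | chan (U : ChTy) : Ty
  | proc : Ty

/-- The channel type `[U₁,…,U_k]^a`. -/
def Ty.ch {k : ℕ} (Us : Fin k → ChTy) (a : Attr) : Ty :=
  .chan ⟨.chan k (fun i => (Us i).1) a, fun i => (Us i).2⟩

/-- Type splitting `T = T₁ ∘ T₂`. -/
inductive Split : Ty → Ty → Ty → Prop
  | unr {k : ℕ} (Us : Fin k → ChTy) : Split (.ch Us .un) (.ch Us .un) (.ch Us .un)
  | proc : Split .proc .proc .proc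
  | unq {k : ℕ} (Us : Fin k → ChTy) (i : ℕ) :
      Split (.ch Us (.uniq i)) (.ch Us .aff) (.ch Us (.uniq (i + 1)))

/-- Subtyping on attributes. -/
inductive SubAttr : Attr → Attr → Prop
  | indx (i : ℕ) : SubAttr (.uniq i) (.uniq (i + 1))
  | unq (i : ℕ) : SubAttr (.uniq i) .un
  | aff : SubAttr .un .aff

/-! ### Type environments -/

/-- Identifiers that may be typed: channel identifiers (`inl`) and process variables (`inr`). -/
abbrev Ident (n m : ℕ) : Type := Val n ⊕ Fin m

/-- Type environments: multisets of assumptions. -/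
abbrev Env (n m : ℕ) : Type := Multiset (Ident n m × Ty)

/-- Action of a map of identifiers on an environment. -/
def Env.map {n m n' m' : ℕ} (f : Ident n m → Ident n' m') (Γ : Env n m) : Env n' m' :=
  Multiset.map (fun p => (f p.1, p.2)) Γ

/-- Weakening by `k` channel variables. -/
def Env.weaken {n m : ℕ} (k : ℕ) (Γ : Env n m) : Env (n + k) m :=
  Γ.map (Sum.map (Val.weaken k) id)

/-- Weakening by one process variable. -/
def Env.weakenProc {n m : ℕ} (Γ : Env n m) : Env n (m + 1) :=
  Γ.map (Sum.map id Fin.succ)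

/-- The assumptions `d₁ : U₁, …, d_k : U_k`. -/
def Env.list {n m k : ℕ} (d : Fin k → Val n) (Us : Fin k → ChTy) : Env n m :=
  (Finset.univ : Finset (Fin k)).val.map (fun i => (Sum.inl (d i), Ty.chan (Us i)))

/-- The identifier `u` has an assumption in the environment. -/
def Env.Has {n m : ℕ} (Γ : Env n m) (u : Ident n m) : Prop := ∃ T, (u, T) ∈ Γ

/-- The environment has only unrestricted assumptions
(the type of processes splits into copies of itself, as unrestricted channel types do). -/
def Env.Unrestricted {n m : ℕ} (Γ : Env n m) : Prop :=
  ∀ p ∈ Γ, p.2 = .proc ∨ ∃ (k : ℕ) (Us : Fin k → ChTy), p.2 = .ch Us .un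

/-- The structural rules for environments. -/
inductive EnvStr {n m : ℕ} : Env n m → Env n m → Prop
  | refl (Γ) : EnvStr Γ Γ
  | trans {Γ₁ Γ₂ Γ₃} : EnvStr Γ₁ Γ₂ → EnvStr Γ₂ Γ₃ → EnvStr Γ₁ Γ₃
  | con (Γ u) {T T₁ T₂} : Split T T₁ T₂ →
      EnvStr ((u, T) ::ₘ Γ) ((u, T₁) ::ₘ (u, T₂) ::ₘ Γ)
  | join (Γ u) {T T₁ T₂} : Split T T₁ T₂ →
      EnvStr ((u, T₁) ::ₘ (u, T₂) ::ₘ Γ) ((u, T) ::ₘ Γ)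
  | eq (Γ u) {U₁ U₂ : ChTy} : TyEq U₁.1 U₂.1 →
      EnvStr ((u, .chan U₁) ::ₘ Γ) ((u, .chan U₂) ::ₘ Γ)
  | weak (Γ u T) : EnvStr ((u, T) ::ₘ Γ) Γ
  | sub (Γ u) {k : ℕ} (Us : Fin k → ChTy) {a₁ a₂} : SubAttr a₁ a₂ →
      EnvStr ((u, .ch Us a₁) ::ₘ Γ) ((u, .ch Us a₂) ::ₘ Γ)
  | rev (Γ u) {k k' : ℕ} (Us : Fin k → ChTy) (Us' : Fin k' → ChTy) :
      EnvStr ((u, .ch Us (.uniq 0)) ::ₘ Γ) ((u, .ch Us' (.uniq 0)) ::ₘ Γ)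

/-- Consistency: derivable from a partial map by the structural rules. -/
def Env.Consistent {n m : ℕ} (Γ : Env n m) : Prop :=
  ∃ Γ' : Env n m, (Multiset.map Prod.fst Γ').Nodup ∧ EnvStr Γ' Γ

/-- `Decr u Us a D`: the assumptions `u : [Us]^(a-1)` left after one use of `u : [Us]^a` are `D`;
undefined if `u` is unique now. -/
inductive Decr {n m k : ℕ} (u : Val n) (Us : Fin k → ChTy) : Attr → Env n m → Prop
  | aff : Decr u Us .aff 0
  | un : Decr u Us .un {(Sum.inl u, .ch Us .un)}
  | uniq (i : ℕ) : Decr u Us (.uniq (i + 1)) {(Sum.inl u, .ch Us (.uniq i))}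

/-- Typing of processes. -/
inductive Typed : {n m : ℕ} → Env n m → Proc n m → Prop
  | out {n m k : ℕ} {Γ D : Env n m} {u : Val n} {v : Fin k → Val n} {Us : Fin k → ChTy}
      {a : Attr} {P : Proc n m} :
      Decr u Us a D → Typed (Γ + D) P →
      Typed ((Sum.inl u, .ch Us a) ::ₘ (Γ + Env.list v Us)) (.out u k v P)
  | inp {n m k : ℕ} {Γ D : Env n m} {u : Val n} {Us : Fin k → ChTy} {a : Attr}
      {P : Proc (n + k) m} :
      Decr u Us a D → Typed ((Γ + D).weaken k + Env.list (Val.fresh n) Us) P →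
      Typed ((Sum.inl u, .ch Us a) ::ₘ Γ) (.inp u k P)
  | par {n m : ℕ} {Γ₁ Γ₂ : Env n m} {P Q : Proc n m} :
      Typed Γ₁ P → Typed Γ₂ Q → Typed (Γ₁ + Γ₂) (.par P Q)
  | cond {n m : ℕ} {Γ : Env n m} {u v : Val n} {P Q : Proc n m} :
      Γ.Has (Sum.inl u) → Γ.Has (Sum.inl v) → Typed Γ P → Typed Γ Q →
      Typed Γ (.cond u v P Q)
  | fix {n m : ℕ} {Γ : Env n m} {P : Proc n (m + 1)} :
      Γ.Unrestricted → Typed ((Sum.inr 0, .proc) ::ₘ Γ.weakenProc) P → Typed Γ (.fix P)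
  | pvar {n m : ℕ} (w : Fin m) : Typed ({(Sum.inr w, .proc)} : Env n m) (.pvar w)
  | free {n m k : ℕ} {Γ : Env n m} {u : Val n} (Us : Fin k → ChTy) {P : Proc n m} :
      Typed Γ P → Typed ((Sum.inl u, .ch Us (.uniq 0)) ::ₘ Γ) (.free u P)
  | alloc {n m k : ℕ} {Γ : Env n m} (Us : Fin k → ChTy) {P : Proc (n + 1) m} :
      Typed ((Sum.inl (Val.fresh n (0 : Fin 1)), .ch Us (.uniq 0)) ::ₘ Γ.weaken 1) P →
      Typed Γ (.alloc P)
  | nil {n m : ℕ} : Typed (0 : Env n m) .nil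
  | str {n m : ℕ} {Γ Γ' : Env n m} {P : Proc n m} : EnvStr Γ Γ' → Typed Γ' P → Typed Γ P

/-! ### Systems and configurations -/

/-- Systems: a set of allocated channels and a closed process. -/
structure Sys : Type where
  res : Set Chan
  proc : Proc 0 0

/-- The channels in the domain of a closed environment. -/
def Env.dom (Γ : Env 0 0) : Set Chan := {c | Γ.Has (Sum.inl (.chan c))}

/-- Typing of systems. -/
def SysTyped (Γ : Env 0 0) (S : Sys) : Prop :=
  Typed Γ S.proc ∧ Γ.dom ⊆ S.res ∧ Γ.Consistent

/-- Configurations; resource environments leave infinitely many channels deallocated. -/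
def IsConfig (Γ : Env 0 0) (S : Sys) : Prop :=
  S.resᶜ.Infinite ∧ Γ.dom ⊆ S.res ∧ ∃ Δ : Env 0 0, (Γ + Δ).Consistent ∧ SysTyped Δ S

/-- Renaming of a system. -/
def Sys.rename (s : Equiv.Perm Chan) (S : Sys) : Sys := ⟨s '' S.res, S.proc.mapChan s⟩

/-! ### Costed labelled transition system -/

/-- Transition labels. -/
inductive Label : Type
  | out (c : Chan) (k : ℕ) (d : Fin k → Chan) : Label
  | inp (c : Chan) (k : ℕ) (d : Fin k → Chan) : Label
  | tau : Label
  | env : Label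
  | alloc : Label
  | free (c : Chan) : Label

/-- Pre-transitions `Γ ◁ M ▷ P --μ,k--> Γ' ◁ M' ▷ P'`. -/
inductive PreStep : Env 0 0 → Sys → Label → ℤ → Env 0 0 → Sys → Prop
  | out {Γ D : Env 0 0} {M : Set Chan} {c : Chan} {k : ℕ} {d : Fin k → Chan}
      {Us : Fin k → ChTy} {a : Attr} {P : Proc 0 0} :
      Decr (.chan c) Us a D →
      PreStep ((Sum.inl (.chan c), .ch Us a) ::ₘ Γ)
        ⟨M, .out (.chan c) k (fun i => .chan (d i)) P⟩ (.out c k d) 0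
        (Γ + D + Env.list (fun i => .chan (d i)) Us) ⟨M, P⟩
  | inp {Γ D : Env 0 0} {M : Set Chan} {c : Chan} {k : ℕ} {d : Fin k → Chan}
      {Us : Fin k → ChTy} {a : Attr} {P : Proc (0 + k) 0} :
      Decr (.chan c) Us a D →
      PreStep ((Sum.inl (.chan c), .ch Us a) ::ₘ (Γ + Env.list (fun i => .chan (d i)) Us))
        ⟨M, .inp (.chan c) k P⟩ (.inp c k d) 0
        (Γ + D) ⟨M, P.inst (fun i => .chan (d i))⟩
  | comL {Γ Γ₁ Γ₁' Γ₂ Γ₂' : Env 0 0} {M : Set Chan} {c : Chan} {k : ℕ} {d : Fin k → Chan}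
      {P P' Q Q' : Proc 0 0} :
      PreStep Γ₁ ⟨M, P⟩ (.out c k d) 0 Γ₁' ⟨M, P'⟩ →
      PreStep Γ₂ ⟨M, Q⟩ (.inp c k d) 0 Γ₂' ⟨M, Q'⟩ →
      PreStep Γ ⟨M, .par P Q⟩ .tau 0 Γ ⟨M, .par P' Q'⟩
  | comR {Γ Γ₁ Γ₁' Γ₂ Γ₂' : Env 0 0} {M : Set Chan} {c : Chan} {k : ℕ} {d : Fin k → Chan}
      {P P' Q Q' : Proc 0 0} :
      PreStep Γ₁ ⟨M, P⟩ (.inp c k d) 0 Γ₁' ⟨M, P'⟩ →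
      PreStep Γ₂ ⟨M, Q⟩ (.out c k d) 0 Γ₂' ⟨M, Q'⟩ →
      PreStep Γ ⟨M, .par P Q⟩ .tau 0 Γ ⟨M, .par P' Q'⟩
  | parL {Γ Γ' : Env 0 0} {M M' : Set Chan} {μ : Label} {k : ℤ} {P P' Q : Proc 0 0} :
      PreStep Γ ⟨M, P⟩ μ k Γ' ⟨M', P'⟩ →
      PreStep Γ ⟨M, .par P Q⟩ μ k Γ' ⟨M', .par P' Q⟩
  | parR {Γ Γ' : Env 0 0} {M M' : Set Chan} {μ : Label} {k : ℤ} {P Q Q' : Proc 0 0} :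
      PreStep Γ ⟨M, Q⟩ μ k Γ' ⟨M', Q'⟩ →
      PreStep Γ ⟨M, .par P Q⟩ μ k Γ' ⟨M', .par P Q'⟩
  | str {Γ Γ' : Env 0 0} {S : Sys} : EnvStr Γ Γ' → PreStep Γ S .env 0 Γ' S
  | unfold {Γ : Env 0 0} {M : Set Chan} {P : Proc 0 1} :
      PreStep Γ ⟨M, .fix P⟩ .tau 0 Γ ⟨M, P.unfold⟩
  | condThen {Γ : Env 0 0} {M : Set Chan} {c : Chan} {P Q : Proc 0 0} : c ∈ M →
      PreStep Γ ⟨M, .cond (.chan c) (.chan c) P Q⟩ .tau 0 Γ ⟨M, P⟩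
  | condElse {Γ : Env 0 0} {M : Set Chan} {c d : Chan} {P Q : Proc 0 0} :
      c ∈ M → d ∈ M → c ≠ d →
      PreStep Γ ⟨M, .cond (.chan c) (.chan d) P Q⟩ .tau 0 Γ ⟨M, Q⟩
  | alloc {Γ : Env 0 0} {M : Set Chan} {c : Chan} {P : Proc (0 + 1) 0} : c ∉ M →
      PreStep Γ ⟨M, .alloc P⟩ .tau 1 Γ ⟨insert c M, P.inst (fun _ => .chan c)⟩
  | allocE {Γ : Env 0 0} {M : Set Chan} {c : Chan} {k : ℕ} (Us : Fin k → ChTy)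
      {P : Proc 0 0} : c ∉ M →
      PreStep Γ ⟨M, P⟩ .alloc 1
        ((Sum.inl (.chan c), .ch Us (.uniq 0)) ::ₘ Γ) ⟨insert c M, P⟩
  | free {Γ : Env 0 0} {M : Set Chan} {c : Chan} {P : Proc 0 0} : c ∈ M →
      PreStep Γ ⟨M, .free (.chan c) P⟩ .tau (-1) Γ ⟨M \ {c}, P⟩
  | freeE {Γ : Env 0 0} {M : Set Chan} {c : Chan} {k : ℕ} (Us : Fin k → ChTy)
      {P : Proc 0 0} : c ∈ M →
      PreStep ((Sum.inl (.chan c), .ch Us (.uniq 0)) ::ₘ Γ) ⟨M, P⟩ (.free c) (-1)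
        Γ ⟨M \ {c}, P⟩

/-- Transitions: pre-transitions after a bijective renaming that fixes the channels known to
the observer. -/
def Step (Γ : Env 0 0) (S : Sys) (μ : Label) (k : ℤ) (Γ' : Env 0 0) (S' : Sys) : Prop :=
  ∃ s : Equiv.Perm Chan, (∀ c ∈ Γ.dom, s c = c) ∧ PreStep Γ (S.rename s) μ k Γ' S'

/-- Weak cost-accumulating transitions. -/
inductive Weak : Env 0 0 → Sys → Label → ℤ → Env 0 0 → Sys → Prop
  | tra {Γ S μ k Γ' S'} : Step Γ S μ k Γ' S' → Weak Γ S μ k Γ' S'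
  | left {Γ S l Γ' S' μ k Γ'' S''} : Step Γ S .tau l Γ' S' → Weak Γ' S' μ k Γ'' S'' →
      Weak Γ S μ (l + k) Γ'' S''
  | right {Γ S μ l Γ' S' k Γ'' S''} : Weak Γ S μ l Γ' S' → Step Γ' S' .tau k Γ'' S'' →
      Weak Γ S μ (l + k) Γ'' S''

/-- The weak transitions used to match a strong `μ`: for `tau` the empty sequence of transitions,
of cost `0`, is allowed as well. -/
def WeakHat (Γ : Env 0 0) (S : Sys) (μ : Label) (k : ℤ) (Γ' : Env 0 0) (S' : Sys) : Prop :=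
  Weak Γ S μ k Γ' S' ∨ (μ = .tau ∧ k = 0 ∧ Γ' = Γ ∧ S' = S)

/-! ### Amortised typed bisimilarity -/

/-- Amortised typed bisimulations, as families indexed by the observer and the credit. -/
def IsBisimulation (𝓡 : Env 0 0 → ℕ → Sys → Sys → Prop) : Prop :=
  ∀ Γ n S T, 𝓡 Γ n S T →
    IsConfig Γ S ∧ IsConfig Γ T ∧
    (∀ μ k Γ' S', Step Γ S μ k Γ' S' →
      ∃ (l : ℤ) (T' : Sys) (n' : ℕ), WeakHat Γ T μ l Γ' T' ∧
        (n' : ℤ) = n + l - k ∧ 𝓡 Γ' n' S' T') ∧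
    (∀ μ l Γ' T', Step Γ T μ l Γ' T' →
      ∃ (k : ℤ) (S' : Sys) (n' : ℕ), WeakHat Γ S μ k Γ' S' ∧
        (n' : ℤ) = n + l - k ∧ 𝓡 Γ' n' S' T')

/-- `Bisim Γ n S T`: `S` is amortised-bisimilar to, and at credit `n` as efficient as, `T`
for observers typed by `Γ`. -/
def Bisim (Γ : Env 0 0) (n : ℕ) (S T : Sys) : Prop :=
  ∃ 𝓡, IsBisimulation 𝓡 ∧ 𝓡 Γ n S T

end Picr

namespace Picr

/-! ### Renaming and substitution -/

/-! The process `R`, typed by `Δ`, is regarded as a part of the observer: an observer `Γ, Δ` of `S`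
can imitate whatever `R` does to `S`, while the smaller observer `Γ` sees only `S | R`. The
candidate relation therefore puts `S₀ | R` next to `T₀ | R` at `Γ` whenever `S₀` and `T₀` are
related at `Γ, Δ'` for some `Δ'` with `Δ' ⊢ R`, and the work is to follow `Δ'` along each
transition.

A move of `S₀` alone is also a move seen by `Γ, Δ'`; the answer of `T₀` is transferred back to `Γ`,
since silent moves do not depend on the observer and visible moves use only the assumptions named in
`Γ` (`PreStep.of_add_right`). A visible action of `R` exchanges assumptions between `Γ` and `Δ'`;
the exchange is an instance of the structural preorder, so it is played as an `env` move. A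
communication between `S₀` and `R` is played as a visible action of `S₀` that uses the permission of
`R`, and the action by which `T₀` answers communicates with `R` again. An allocation or deallocation
by `R` is played as one by the observer, at the same cost. The other silent steps of `R` are
repeated beside `T₀`. This needs subject reduction in a form that replays the step with other
resources (`Typed.tau_step`).

The exchanges rest on `Env.Consistent.use_two`: in a consistent environment two assumptions for one
channel have equal object types and can both be used once. This follows from the invariant
`Coherent` of the structural rules: a type unique after `i` uses coexists with at most `i` affine
ones, and never with an unrestricted one. Its comparison of object types needs inversion of
equi-recursive equality (`TyEq.chan_inv`), obtained by computing head forms.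

Two technical points shape the argument. Transitions may first rename channels unknown to `Γ`, among
them channels of `R`; so the candidate `Beside` is closed under such renamings on each side, and
bisimilarity is shown to be equivariant (`Bisim.rename`). And the two halves of a bisimulation are
the same game with opposite signs of the credit; so one argument about `IsSim`, with integer
credits, covers both. Credits stay nonnegative because they are those of the given bisimilarity. -/

@[simp] theorem Val.lift_weaken {n n' k : ℕ} (f : Val n → Val n') (x : Val n) :
    Val.lift k f (Val.weaken k x) = Val.weaken k (f x) := by
  cases x <;> simp [Val.lift, Val.weaken]

@[simp] theorem Val.lift_fresh {n n' k : ℕ} (f : Val n → Val n') (j : Fin k) :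
    Val.lift k f (Val.fresh n j) = Val.fresh n' j := by
  simp [Val.lift, Val.fresh]

theorem Val.weaken_or_fresh {n k : ℕ} (x : Val (n + k)) :
    (∃ y, x = Val.weaken k y) ∨ ∃ j, x = Val.fresh n j := by
  cases x with
  | chan c => exact .inl ⟨.chan c, rfl⟩
  | var i =>
    refine Fin.addCases (fun i => ?_) (fun j => ?_) i
    · exact .inl ⟨.var i, rfl⟩
    · exact .inr ⟨j, rfl⟩

theorem Val.lift_comp {n n' n'' k : ℕ} (f' : Val n' → Val n'') (f : Val n → Val n') :
    Val.lift k f' ∘ Val.lift k f = Val.lift k (f' ∘ f) := by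
  funext x
  obtain ⟨y, rfl⟩ | ⟨j, rfl⟩ := x.weaken_or_fresh <;> simp

theorem Val.lift_id {n k : ℕ} : Val.lift k (id : Val n → Val n) = id := by
  funext x
  obtain ⟨y, rfl⟩ | ⟨j, rfl⟩ := x.weaken_or_fresh <;> simp

theorem Val.lift_mapChan {n k : ℕ} (s : Chan → Chan) :
    Val.lift k (Val.mapChan (n := n) s) = Val.mapChan s := by
  funext x
  obtain ⟨y, rfl⟩ | ⟨j, rfl⟩ := x.weaken_or_fresh
  · cases y <;> simp [Val.mapChan, Val.weaken, Val.lift]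
  · simp [Val.mapChan, Val.fresh, Val.lift]

@[simp] theorem Val.inst_weaken {n k : ℕ} (d : Fin k → Val n) (x : Val n) :
    Val.inst d (Val.weaken k x) = x := by
  cases x <;> simp [Val.inst, Val.weaken]

@[simp] theorem Val.inst_fresh {n k : ℕ} (d : Fin k → Val n) (j : Fin k) :
    Val.inst d (Val.fresh n j) = d j := by
  simp [Val.inst, Val.fresh]

theorem Val.mapChan_inst {n k : ℕ} (s : Chan → Chan) (d : Fin k → Val n) :
    Val.mapChan s ∘ Val.inst d = Val.inst (fun i => Val.mapChan s (d i)) ∘ Val.mapChan s := by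
  funext x
  obtain ⟨y, rfl⟩ | ⟨j, rfl⟩ := x.weaken_or_fresh
  · cases y <;> simp [Val.mapChan, Val.weaken, Val.inst]
  · simp [Val.mapChan, Val.fresh, Val.inst]

theorem Val.mapChan_mapChan {n : ℕ} (s t : Chan → Chan) (x : Val n) :
    Val.mapChan s (Val.mapChan t x) = Val.mapChan (s ∘ t) x := by
  cases x <;> rfl

theorem Val.mapChan_id {n : ℕ} : Val.mapChan (n := n) id = id := by
  funext x; cases x <;> rfl

theorem Val.mapChan_injective {n : ℕ} {s : Chan → Chan} (hs : Function.Injective s) :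
    Function.Injective (Val.mapChan (n := n) s) := by
  intro x y h
  cases x <;> cases y <;> simp_all [Val.mapChan, hs.eq_iff]

/-- A map of process variables, extended under a recursion binder. -/
def liftFin {m m' : ℕ} (g : Fin m → Fin m') : Fin (m + 1) → Fin (m' + 1) :=
  Fin.cases 0 (fun w => (g w).succ)

@[simp] theorem liftFin_zero {m m' : ℕ} (g : Fin m → Fin m') : liftFin g 0 = 0 := rfl

@[simp] theorem liftFin_succ {m m' : ℕ} (g : Fin m → Fin m') (w : Fin m) :
    liftFin g w.succ = (g w).succ := rfl

theorem liftFin_comp {m m' m'' : ℕ} (g' : Fin m' → Fin m'') (g : Fin m → Fin m') :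
    liftFin g' ∘ liftFin g = liftFin (g' ∘ g) := by
  funext w; refine Fin.cases ?_ (fun w => ?_) w <;> simp

theorem liftFin_id {m : ℕ} : liftFin (id : Fin m → Fin m) = id := by
  funext w; refine Fin.cases ?_ (fun w => ?_) w <;> simp

theorem Proc.rename_fix {n m n' m' : ℕ} (f : Val n → Val n') (g : Fin m → Fin m')
    (P : Proc n (m + 1)) : (Proc.fix P).rename f g = .fix (P.rename f (liftFin g)) := rfl

theorem Proc.rename_rename {n m n' m' n'' m'' : ℕ} (f : Val n → Val n') (g : Fin m → Fin m')
    (f' : Val n' → Val n'') (g' : Fin m' → Fin m'') (P : Proc n m) :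
    (P.rename f g).rename f' g' = P.rename (f' ∘ f) (g' ∘ g) := by
  induction P generalizing n' m' n'' m'' with
  | fix P ih => simp only [Proc.rename_fix, ih, liftFin_comp]
  | inp u k P ih => simp [Proc.rename, ih, Val.lift_comp]
  | alloc P ih => simp [Proc.rename, ih, Val.lift_comp]
  | _ => simp_all [Proc.rename]

theorem Proc.rename_id {n m : ℕ} (P : Proc n m) : P.rename id id = P := by
  induction P with
  | fix P ih => rw [Proc.rename_fix, liftFin_id, ih]
  | inp u k P ih => simp [Proc.rename, ih, Val.lift_id]
  | alloc P ih => simp [Proc.rename, ih, Val.lift_id]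
  | _ => simp_all [Proc.rename]

/-- A substitution for process variables, extended under a recursion binder. -/
def liftSubst {n m m' : ℕ} (σ : Fin m → Proc n m') : Fin (m + 1) → Proc n (m' + 1) :=
  Fin.cases (.pvar 0) (fun w => (σ w).rename id Fin.succ)

theorem Proc.psubst_fix {n m m' : ℕ} (σ : Fin m → Proc n m') (P : Proc n (m + 1)) :
    (Proc.fix P).psubst σ = .fix (P.psubst (liftSubst σ)) := rfl

/-- The compatibility of the two substitutions is required only pointwise and with independent maps
on both sorts of variables; in this form it is stable under every binder, so the induction goes
through. -/
theorem Proc.psubst_rename {n m m₁ n' m' m₁' : ℕ} (f : Val n → Val n') (g : Fin m → Fin m')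
    (g₁ : Fin m₁ → Fin m₁') (σ : Fin m₁ → Proc n m) (σ' : Fin m₁' → Proc n' m')
    (P : Proc n m₁) (h : ∀ w, (σ w).rename f g = σ' (g₁ w)) :
    (P.psubst σ).rename f g = (P.rename f g₁).psubst σ' := by
  induction P generalizing m n' m' m₁' with
  | fix P ih =>
    simp only [Proc.psubst_fix, Proc.rename_fix, Proc.fix.injEq]
    apply ih
    refine Fin.cases rfl (fun w => ?_)
    simp only [liftSubst, Fin.cases_succ, liftFin_succ, ← h, Proc.rename_rename]
    rfl
  | inp u k P ih =>
    simp only [Proc.psubst, Proc.rename, Proc.inp.injEq, heq_eq_eq, true_and]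
    apply ih
    intro w
    rw [← h, Proc.rename_rename, Proc.rename_rename]
    congr 1
    funext x; simp
  | alloc P ih =>
    simp only [Proc.psubst, Proc.rename, Proc.alloc.injEq]
    apply ih
    intro w
    rw [← h, Proc.rename_rename, Proc.rename_rename]
    congr 1
    funext x; simp
  | out u k v P ih =>
    simp only [Proc.psubst, Proc.rename, Proc.out.injEq, heq_eq_eq, true_and]
    exact ih _ _ _ _ _ h
  | free u P ih =>
    simp only [Proc.psubst, Proc.rename, Proc.free.injEq, true_and]
    exact ih _ _ _ _ _ h
  | nil => rfl
  | pvar w => exact h w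
  | par P Q ihP ihQ =>
    simp only [Proc.psubst, Proc.rename, Proc.par.injEq]
    exact ⟨ihP _ _ _ _ _ h, ihQ _ _ _ _ _ h⟩
  | cond u v P Q ihP ihQ =>
    simp only [Proc.psubst, Proc.rename, Proc.cond.injEq, true_and]
    exact ⟨ihP _ _ _ _ _ h, ihQ _ _ _ _ _ h⟩

theorem Proc.mapChan_unfold {n m : ℕ} (s : Chan → Chan) (P : Proc n (m + 1)) :
    P.unfold.mapChan s = (P.mapChan s).unfold := by
  refine Proc.psubst_rename _ _ _ _ _ _ (Fin.cases ?_ fun w => rfl)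
  change (Proc.fix P).rename _ _ = Proc.fix (P.mapChan s)
  rw [Proc.rename_fix, liftFin_id]; rfl

theorem Proc.mapChan_inst {n m k : ℕ} (s : Chan → Chan) (P : Proc (n + k) m)
    (d : Fin k → Val n) :
    (P.inst d).mapChan s = (P.mapChan s).inst (fun i => Val.mapChan s (d i)) := by
  simp only [Proc.inst, Proc.mapChan, Proc.rename_rename, Val.mapChan_inst]

theorem Proc.mapChan_mapChan {n m : ℕ} (s t : Chan → Chan) (P : Proc n m) :
    (P.mapChan t).mapChan s = P.mapChan (s ∘ t) := by
  simp only [Proc.mapChan, Proc.rename_rename]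
  congr 1
  funext x; simp [Val.mapChan_mapChan]

theorem Proc.mapChan_id {n m : ℕ} (P : Proc n m) : P.mapChan id = P := by
  rw [Proc.mapChan, Val.mapChan_id, Proc.rename_id]

/-! ### Environments -/

theorem EnvStr.add_right {n m : ℕ} {Γ Γ' : Env n m} (h : EnvStr Γ Γ') (Δ : Env n m) :
    EnvStr (Γ + Δ) (Γ' + Δ) := by
  induction h with
  | refl => exact .refl _
  | trans _ _ ih₁ ih₂ => exact ih₁.trans ih₂
  | con Γ u h => simpa only [Multiset.cons_add] using EnvStr.con _ u h
  | join Γ u h => simpa only [Multiset.cons_add] using EnvStr.join _ u h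
  | eq Γ u h => simpa only [Multiset.cons_add] using EnvStr.eq _ u h
  | weak Γ u T => simpa only [Multiset.cons_add] using EnvStr.weak _ u T
  | sub Γ u Us h => simpa only [Multiset.cons_add] using EnvStr.sub _ u Us h
  | rev Γ u Us Us' => simpa only [Multiset.cons_add] using EnvStr.rev _ u Us Us'

theorem EnvStr.add_left {n m : ℕ} {Γ Γ' : Env n m} (Δ : Env n m) (h : EnvStr Γ Γ') :
    EnvStr (Δ + Γ) (Δ + Γ') := by
  simpa only [add_comm Δ] using h.add_right Δ

theorem EnvStr.add {n m : ℕ} {Γ Γ' Δ Δ' : Env n m} (h : EnvStr Γ Γ') (h' : EnvStr Δ Δ') :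
    EnvStr (Γ + Δ) (Γ' + Δ') :=
  (h.add_right _).trans (h'.add_left _)

theorem EnvStr.cons {n m : ℕ} {Γ Γ' : Env n m} (p : Ident n m × Ty) (h : EnvStr Γ Γ') :
    EnvStr (p ::ₘ Γ) (p ::ₘ Γ') := by
  simpa only [Multiset.singleton_add] using h.add_left {p}

theorem EnvStr.to_zero {n m : ℕ} (Γ : Env n m) : EnvStr Γ 0 := by
  induction Γ using Multiset.induction with
  | empty => exact .refl _
  | cons p Γ ih => exact (EnvStr.weak _ _ _).trans ih

theorem EnvStr.of_le {n m : ℕ} {Γ Γ' : Env n m} (h : Γ' ≤ Γ) : EnvStr Γ Γ' := by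
  obtain ⟨Δ, rfl⟩ := Multiset.le_iff_exists_add.1 h
  simpa only [add_zero] using (EnvStr.to_zero Δ).add_left Γ'

/-- No structural rule introduces an identifier. -/
theorem EnvStr.mem_fst {n m : ℕ} {Γ Γ' : Env n m} (h : EnvStr Γ Γ') {u : Ident n m}
    (hu : Γ'.Has u) : Γ.Has u := by
  induction h with
  | refl => exact hu
  | trans _ _ ih₁ ih₂ => exact ih₁ (ih₂ hu)
  | _ =>
    simp only [Env.Has, Multiset.mem_cons, Prod.mk.injEq] at hu ⊢
    grind

theorem Env.Consistent.mono {n m : ℕ} {Γ Γ' : Env n m} (h : Γ.Consistent) (h' : EnvStr Γ Γ') :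
    Γ'.Consistent := by
  obtain ⟨Γ₀, h₀, h₁⟩ := h
  exact ⟨Γ₀, h₀, h₁.trans h'⟩

/-! ### Renaming of environments. -/

theorem Env.map_id {n m : ℕ} (Γ : Env n m) : Γ.map id = Γ := by
  simp [Env.map]

theorem Env.map_cons {n m n' m' : ℕ} (f : Ident n m → Ident n' m') (u : Ident n m) (T : Ty)
    (Γ : Env n m) : Env.map f ((u, T) ::ₘ Γ) = (f u, T) ::ₘ Env.map f Γ := by
  simp [Env.map]

theorem Env.map_add {n m n' m' : ℕ} (f : Ident n m → Ident n' m') (Γ Δ : Env n m) :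
    Env.map f (Γ + Δ) = Env.map f Γ + Env.map f Δ := by
  simp [Env.map]

theorem Env.map_map {n m n' m' n'' m'' : ℕ} (f : Ident n m → Ident n' m')
    (f' : Ident n' m' → Ident n'' m'') (Γ : Env n m) :
    Env.map f' (Env.map f Γ) = Env.map (f' ∘ f) Γ := by
  simp [Env.map, Multiset.map_map]

theorem Env.map_congr {n m n' m' : ℕ} {f f' : Ident n m → Ident n' m'} {Γ : Env n m}
    (h : ∀ u, Γ.Has u → f u = f' u) : Env.map f Γ = Env.map f' Γ := by
  refine Multiset.map_congr rfl fun p hp => ?_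
  rw [h p.1 ⟨p.2, hp⟩]

theorem Env.has_map {n m n' m' : ℕ} (f : Ident n m → Ident n' m') (Γ : Env n m)
    (u : Ident n' m') : (Env.map f Γ).Has u ↔ ∃ v, Γ.Has v ∧ f v = u := by
  simp only [Env.Has, Env.map, Multiset.mem_map, Prod.mk.injEq, Prod.exists]
  grind

theorem Env.has_add {n m : ℕ} (Γ Δ : Env n m) (u : Ident n m) :
    (Γ + Δ).Has u ↔ Γ.Has u ∨ Δ.Has u := by
  simp only [Env.Has, Multiset.mem_add]
  grind

theorem Env.has_cons {n m : ℕ} (Γ : Env n m) (u v : Ident n m) (T : Ty) :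
    Env.Has ((u, T) ::ₘ Γ) v ↔ v = u ∨ Γ.Has v := by
  simp only [Env.Has, Multiset.mem_cons, Prod.mk.injEq]
  grind

theorem Env.has_list {n m k : ℕ} (d : Fin k → Val n) (Us : Fin k → ChTy) (u : Ident n m) :
    (Env.list d Us : Env n m).Has u ↔ ∃ i, u = .inl (d i) := by
  simp only [Env.Has, Env.list, Multiset.mem_map, Prod.mk.injEq]
  constructor
  · rintro ⟨T, i, -, h, -⟩; exact ⟨i, h.symm⟩
  · rintro ⟨i, h⟩; exact ⟨_, i, Finset.mem_univ i, h.symm, rfl⟩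

theorem Env.map_list {n m n' m' k : ℕ} (f : Val n → Val n') (g : Fin m → Fin m')
    (d : Fin k → Val n) (Us : Fin k → ChTy) :
    Env.map (Sum.map f g) (Env.list d Us : Env n m) = Env.list (fun i => f (d i)) Us := by
  simp only [Env.map, Env.list, Multiset.map_map]
  rfl

theorem Env.map_weaken {n m n' m' : ℕ} (k : ℕ) (f : Val n → Val n') (g : Fin m → Fin m')
    (Γ : Env n m) :
    Env.map (Sum.map (Val.lift k f) g) (Γ.weaken k) = (Γ.map (Sum.map f g)).weaken k := by
  rw [Env.weaken, Env.weaken, Env.map_map, Env.map_map]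
  congr 1
  funext u; cases u <;> simp

theorem Env.map_weakenProc {n m n' m' : ℕ} (f : Val n → Val n') (g : Fin m → Fin m')
    (Γ : Env n m) :
    Env.map (Sum.map f (liftFin g)) Γ.weakenProc = (Γ.map (Sum.map f g)).weakenProc := by
  rw [Env.weakenProc, Env.weakenProc, Env.map_map, Env.map_map]
  congr 1
  funext u; cases u <;> simp

theorem EnvStr.map {n m n' m' : ℕ} (f : Ident n m → Ident n' m') {Γ Γ' : Env n m}
    (h : EnvStr Γ Γ') : EnvStr (Γ.map f) (Γ'.map f) := by
  induction h with
  | refl => exact .refl _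
  | trans _ _ ih₁ ih₂ => exact ih₁.trans ih₂
  | con Γ u h => simpa only [Env.map_cons] using EnvStr.con _ _ h
  | join Γ u h => simpa only [Env.map_cons] using EnvStr.join _ _ h
  | eq Γ u h => simpa only [Env.map_cons] using EnvStr.eq _ _ h
  | weak Γ u T => simpa only [Env.map_cons] using EnvStr.weak _ _ T
  | sub Γ u Us h => simpa only [Env.map_cons] using EnvStr.sub _ _ Us h
  | rev Γ u Us Us' => simpa only [Env.map_cons] using EnvStr.rev _ _ Us Us'

theorem Env.Consistent.map {n m n' m' : ℕ} {f : Ident n m → Ident n' m'}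
    (hf : Function.Injective f) {Γ : Env n m} (h : Γ.Consistent) : (Γ.map f).Consistent := by
  obtain ⟨Γ₀, h₀, h₁⟩ := h
  refine ⟨Γ₀.map f, ?_, h₁.map f⟩
  have : Multiset.map Prod.fst (Γ₀.map f) = (Multiset.map Prod.fst Γ₀).map f := by
    simp [Env.map]
  rw [this]
  exact h₀.map hf

theorem Decr.map {n m n' m' k : ℕ} (f : Val n → Val n') (g : Fin m → Fin m') {u : Val n}
    {Us : Fin k → ChTy} {a : Attr} {D : Env n m} (h : Decr u Us a D) :
    Decr (f u) Us a (D.map (Sum.map f g)) := by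
  cases h <;> constructor

/-- A strong form of `EnvStr.eq` for lists of assumptions. -/
theorem EnvStr.list_congr {n m k : ℕ} (d : Fin k → Val n) {Us Vs : Fin k → ChTy}
    (h : ∀ i, TyEq (Us i).1 (Vs i).1) :
    EnvStr (Env.list d Us : Env n m) (Env.list d Vs) := by
  unfold Env.list
  induction (Finset.univ : Finset (Fin k)).val using Multiset.induction with
  | empty => exact .refl _
  | cons i s ih =>
    simp only [Multiset.map_cons]
    exact (ih.cons _).trans (EnvStr.eq _ _ (h i))

/-! ### Typing: renaming, inversion -/

/-- The maps need not be injective: environments are multisets and no typing rule asks for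
consistency, so identified names just accumulate assumptions. Substitution of received channels is
thus a special case. -/
theorem Typed.rename {n m n' m' : ℕ} {Γ : Env n m} {P : Proc n m} (h : Typed Γ P)
    (f : Val n → Val n') (g : Fin m → Fin m') :
    Typed (Γ.map (Sum.map f g)) (P.rename f g) := by
  induction h generalizing n' m' with
  | out hD _ ih =>
    rw [Env.map_cons, Env.map_add, Env.map_list]
    refine Typed.out (hD.map f g) ?_
    rw [← Env.map_add]
    exact ih f g
  | inp hD _ ih =>
    rw [Env.map_cons]
    refine Typed.inp (hD.map f g) ?_
    have := ih (Val.lift _ f) g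
    rwa [Env.map_add, Env.map_weaken, Env.map_list, Env.map_add, funext (Val.lift_fresh f)] at this
  | par _ _ ih₁ ih₂ =>
    rw [Env.map_add]
    exact (ih₁ f g).par (ih₂ f g)
  | cond hu hv _ _ ih₁ ih₂ =>
    exact .cond ((Env.has_map _ _ _).2 ⟨_, hu, rfl⟩) ((Env.has_map _ _ _).2 ⟨_, hv, rfl⟩)
      (ih₁ f g) (ih₂ f g)
  | fix hΓ _ ih =>
    rw [Proc.rename_fix]
    refine .fix ?_ ?_
    · intro p hp
      obtain ⟨q, hq, rfl⟩ := Multiset.mem_map.1 hp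
      exact hΓ q hq
    · have := ih f (liftFin g)
      rwa [Env.map_cons, Env.map_weakenProc] at this
  | pvar w => exact .pvar (g w)
  | free Us _ ih =>
    rw [Env.map_cons]
    exact .free Us (ih f g)
  | alloc Us _ ih =>
    refine .alloc Us ?_
    have := ih (Val.lift 1 f) g
    rwa [Env.map_cons, Env.map_weaken, Sum.map_inl, Val.lift_fresh] at this
  | nil => exact .nil
  | str h _ ih => exact .str (h.map _) (ih f g)

/-- The premises of the syntax-directed typing rule of a process, up to structural rules. -/
def TypedInv : {n m : ℕ} → Env n m → Proc n m → Prop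
  | n, m, Δ, .out u k v P => ∃ (Γ D : Env n m) (Us : Fin k → ChTy) (a : Attr),
      EnvStr Δ ((Sum.inl u, .ch Us a) ::ₘ (Γ + Env.list v Us)) ∧ Decr u Us a D ∧
      Typed (Γ + D) P
  | n, m, Δ, .inp u k P => ∃ (Γ D : Env n m) (Us : Fin k → ChTy) (a : Attr),
      EnvStr Δ ((Sum.inl u, .ch Us a) ::ₘ Γ) ∧ Decr u Us a D ∧
      Typed ((Γ + D).weaken k + Env.list (Val.fresh n) Us) P
  | _, _, _, .nil => True
  | _, _, Δ, .cond u v P Q => Δ.Has (.inl u) ∧ Δ.Has (.inl v) ∧ Typed Δ P ∧ Typed Δ Q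
  | n, m, Δ, .fix P => ∃ Γ : Env n m, EnvStr Δ Γ ∧ Γ.Unrestricted ∧
      Typed ((Sum.inr 0, .proc) ::ₘ Γ.weakenProc) P
  | _, _, _, .pvar _ => True
  | n, m, Δ, .par P Q => ∃ Γ₁ Γ₂ : Env n m, EnvStr Δ (Γ₁ + Γ₂) ∧ Typed Γ₁ P ∧ Typed Γ₂ Q
  | n, m, Δ, .alloc P => ∃ (Γ : Env n m) (k : ℕ) (Us : Fin k → ChTy), EnvStr Δ Γ ∧
      Typed ((Sum.inl (Val.fresh n (0 : Fin 1)), .ch Us (.uniq 0)) ::ₘ Γ.weaken 1) P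
  | n, m, Δ, .free u P => ∃ (Γ : Env n m) (k : ℕ) (Us : Fin k → ChTy),
      EnvStr Δ ((Sum.inl u, .ch Us (.uniq 0)) ::ₘ Γ) ∧ Typed Γ P

/-- Structural steps compose, so all of them can be gathered before the syntax-directed rule. For
conditionals they are pushed into the premises, which are typed in the whole environment. -/
theorem Typed.inv {n m : ℕ} {Δ : Env n m} {P : Proc n m} (h : Typed Δ P) : TypedInv Δ P := by
  induction h with
  | out hD h _ => exact ⟨_, _, _, _, .refl _, hD, h⟩
  | inp hD h _ => exact ⟨_, _, _, _, .refl _, hD, h⟩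
  | par h₁ h₂ => exact ⟨_, _, .refl _, h₁, h₂⟩
  | cond hu hv h₁ h₂ => exact ⟨hu, hv, h₁, h₂⟩
  | fix hΓ h => exact ⟨_, .refl _, hΓ, h⟩
  | pvar w => trivial
  | free Us h => exact ⟨_, _, _, .refl _, h⟩
  | alloc Us h => exact ⟨_, _, _, .refl _, h⟩
  | nil => trivial
  | @str n m Γ Γ' P hs h ih =>
    cases P with
    | out u k v P =>
      obtain ⟨Γ, D, Us, a, h₁, h₂⟩ := ih
      exact ⟨Γ, D, Us, a, hs.trans h₁, h₂⟩
    | inp u k P =>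
      obtain ⟨Γ, D, Us, a, h₁, h₂⟩ := ih
      exact ⟨Γ, D, Us, a, hs.trans h₁, h₂⟩
    | nil => trivial
    | cond u v P Q =>
      obtain ⟨h₁, h₂, h₃, h₄⟩ := ih
      exact ⟨hs.mem_fst h₁, hs.mem_fst h₂, h₃.str hs, h₄.str hs⟩
    | fix P =>
      obtain ⟨Γ, h₁, h₂⟩ := ih
      exact ⟨Γ, hs.trans h₁, h₂⟩
    | pvar w => trivial
    | par P Q =>
      obtain ⟨Γ₁, Γ₂, h₁, h₂⟩ := ih
      exact ⟨Γ₁, Γ₂, hs.trans h₁, h₂⟩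
    | alloc P =>
      obtain ⟨Γ, k, Us, h₁, h₂⟩ := ih
      exact ⟨Γ, k, Us, hs.trans h₁, h₂⟩
    | free u P =>
      obtain ⟨Γ, k, Us, h₁, h₂⟩ := ih
      exact ⟨Γ, k, Us, hs.trans h₁, h₂⟩

/-- Only the identifiers in the domain of its environment occur free in a typed process. -/
theorem Typed.rename_eq_self {n m : ℕ} {Γ : Env n m} {P : Proc n m} (h : Typed Γ P)
    {f : Val n → Val n} (hf : ∀ u, Γ.Has (.inl u) → f u = u) : P.rename f id = P := by
  induction h with
  | out hD _ ih =>
    simp only [Env.has_cons, Env.has_add, Env.has_list] at hf ih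
    simp only [Proc.rename, Proc.out.injEq, heq_eq_eq, true_and]
    refine ⟨hf _ (.inl rfl), funext fun i => hf _ (.inr (.inr ⟨i, rfl⟩)), ih fun u hu => ?_⟩
    rcases hu with hu | hu
    · exact hf _ (.inr (.inl hu))
    · refine hf _ (.inl ?_)
      cases hD <;> simp_all [Env.Has]
  | @inp n m k Γ D u Us a P hD _ ih =>
    simp only [Env.has_cons] at hf
    simp only [Proc.rename, Proc.inp.injEq, heq_eq_eq, true_and]
    refine ⟨hf _ (.inl rfl), ih fun v hv => ?_⟩
    simp only [Env.has_add, Env.has_list, Env.weaken, Env.has_map] at hv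
    rcases hv with ⟨v' | w, hv, h⟩ | ⟨i, hi⟩
    · simp only [Sum.map_inl, Sum.inl.injEq] at h
      subst h
      rw [Val.lift_weaken, hf]
      rcases hv with hv | hv
      · exact .inr hv
      · refine .inl ?_
        cases hD <;> simp_all [Env.Has]
    · simp at h
    · rw [Sum.inl.inj hi, Val.lift_fresh]
  | par _ _ ih₁ ih₂ =>
    simp only [Env.has_add] at hf
    simp only [Proc.rename, Proc.par.injEq]
    exact ⟨ih₁ fun u hu => hf _ (.inl hu), ih₂ fun u hu => hf _ (.inr hu)⟩
  | cond hu hv _ _ ih₁ ih₂ =>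
    simp only [Proc.rename, Proc.cond.injEq]
    exact ⟨hf _ hu, hf _ hv, ih₁ hf, ih₂ hf⟩
  | fix _ _ ih =>
    rw [Proc.rename_fix, liftFin_id, ih]
    intro u hu
    simp only [Env.has_cons, Env.weakenProc, Env.has_map] at hu
    rcases hu with hu | ⟨v' | w, hv, h⟩
    · simp at hu
    · simp only [Sum.map_inl, Sum.inl.injEq, id] at h
      exact hf _ (h ▸ hv)
    · simp at h
  | pvar w => rfl
  | free Us _ ih =>
    simp only [Env.has_cons] at hf
    simp only [Proc.rename, Proc.free.injEq]
    exact ⟨hf _ (.inl rfl), ih fun u hu => hf _ (.inr hu)⟩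
  | alloc Us _ ih =>
    simp only [Proc.rename, Proc.alloc.injEq]
    refine ih fun v hv => ?_
    simp only [Env.has_cons, Env.weaken, Env.has_map] at hv
    rcases hv with hv | ⟨v' | w, hv, h⟩
    · rw [Sum.inl.inj hv, Val.lift_fresh]
    · simp only [Sum.map_inl, Sum.inl.injEq] at h
      rw [← h, Val.lift_weaken, hf _ hv]
    · simp at h
  | nil => rfl
  | str hs _ ih => exact ih fun u hu => hf u (hs.mem_fst hu)

/-! ### Typing: substitution for process variables -/

/-- Every assumption splits into two copies of itself; this is what makes it possible to substitute
a recursive process for several occurrences of its variable. -/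
theorem Env.Unrestricted.dup {n m : ℕ} {Γ : Env n m} (h : Γ.Unrestricted) :
    EnvStr Γ (Γ + Γ) := by
  induction Γ using Multiset.induction with
  | empty => exact .refl _
  | cons p Γ ih =>
    have hp : Split p.2 p.2 p.2 := by
      rcases h p (by simp) with h | ⟨k, Us, h⟩ <;> rw [h] <;> constructor
    have h' := ih fun q hq => h q (by simp [hq])
    have : (p ::ₘ Γ) + (p ::ₘ Γ) = p ::ₘ p ::ₘ (Γ + Γ) := by
      simp [Multiset.cons_add, Multiset.add_cons]
    rw [this]
    exact (h'.cons p).trans (EnvStr.con _ _ hp)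

/-- The assumptions that replace `p` when the process variable `w` is replaced by a process typed
by `G w`. -/
def substAssumption {n m m' : ℕ} (G : Fin m → Env n m') (p : Ident n m × Ty) : Env n m' :=
  match p with
  | (.inl u, T) => {(.inl u, T)}
  | (.inr w, .proc) => G w
  -- Nothing rules out a process variable with a channel type in a multiset, but such an assumption
  -- types no occurrence of the variable, so it is dropped.
  | (.inr _, .chan _) => 0

/-- The environment after substitution of processes typed by `G` for the process variables. -/
def Env.psubst {n m m' : ℕ} (G : Fin m → Env n m') (Γ : Env n m) : Env n m' :=
  Multiset.bind Γ (substAssumption G)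

theorem Env.psubst_cons {n m m' : ℕ} (G : Fin m → Env n m') (p : Ident n m × Ty)
    (Γ : Env n m) : Env.psubst G (p ::ₘ Γ) = substAssumption G p + Env.psubst G Γ := by
  simp [Env.psubst]

theorem Env.psubst_inl {n m m' : ℕ} (G : Fin m → Env n m') (u : Val n) (T : Ty)
    (Γ : Env n m) : Env.psubst G ((.inl u, T) ::ₘ Γ) = (.inl u, T) ::ₘ Env.psubst G Γ := by
  simp [Env.psubst_cons, substAssumption]

theorem Env.psubst_add {n m m' : ℕ} (G : Fin m → Env n m') (Γ Δ : Env n m) :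
    Env.psubst G (Γ + Δ) = Env.psubst G Γ + Env.psubst G Δ := by
  simp [Env.psubst]

theorem Env.psubst_list {n m m' k : ℕ} (G : Fin m → Env n m') (d : Fin k → Val n)
    (Us : Fin k → ChTy) : Env.psubst G (Env.list d Us) = Env.list d Us := by
  unfold Env.list
  induction (Finset.univ : Finset (Fin k)).val using Multiset.induction with
  | empty => rfl
  | cons i s ih => simp only [Multiset.map_cons, Env.psubst_inl, ih]

theorem Env.has_psubst {n m m' : ℕ} (G : Fin m → Env n m') {Γ : Env n m} {u : Val n}
    (h : Γ.Has (.inl u)) : (Env.psubst G Γ).Has (.inl u) := by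
  obtain ⟨T, hT⟩ := h
  exact ⟨T, Multiset.mem_bind.2 ⟨_, hT, by simp [substAssumption]⟩⟩

theorem Env.Unrestricted.psubst {n m m' : ℕ} {G : Fin m → Env n m'}
    (hG : ∀ w, (G w).Unrestricted) {Γ : Env n m} (h : Γ.Unrestricted) :
    (Env.psubst G Γ).Unrestricted := by
  intro p hp
  obtain ⟨⟨u | w, T⟩, hq, hp⟩ := Multiset.mem_bind.1 hp
  · simp only [substAssumption, Multiset.mem_singleton] at hp
    subst hp
    exact h _ hq
  · cases T with
    | proc => exact hG w p hp
    | chan U => simp [substAssumption] at hp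

theorem Env.psubst_weaken {n m m' : ℕ} (k : ℕ) (G : Fin m → Env n m') (Γ : Env n m) :
    Env.psubst (fun w => (G w).weaken k) (Γ.weaken k) = (Env.psubst G Γ).weaken k := by
  simp only [Env.psubst, Env.weaken, Env.map, Multiset.bind_map, Multiset.map_bind]
  refine Multiset.bind_congr fun p _ => ?_
  obtain ⟨u | w, T | _⟩ := p <;> simp [substAssumption]

/-- A family of environments for process variables, extended under a recursion binder. -/
def liftEnv {n m m' : ℕ} (G : Fin m → Env n m') : Fin (m + 1) → Env n (m' + 1) :=
  Fin.cases {(.inr 0, .proc)} (fun w => (G w).weakenProc)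

theorem Env.psubst_weakenProc {n m m' : ℕ} (G : Fin m → Env n m') (Γ : Env n m) :
    Env.psubst (liftEnv G) Γ.weakenProc = (Env.psubst G Γ).weakenProc := by
  simp only [Env.psubst, Env.weakenProc, Env.map, Multiset.bind_map, Multiset.map_bind]
  refine Multiset.bind_congr fun p _ => ?_
  obtain ⟨u | w, T | _⟩ := p <;> simp [substAssumption]
  rfl

/-- For a process variable only splitting, joining and weakening matter: splitting becomes
duplication of `G w`, where unrestrictedness is needed, and joining becomes weakening. -/
theorem EnvStr.psubst {n m m' : ℕ} {G : Fin m → Env n m'} (hG : ∀ w, (G w).Unrestricted)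
    {Γ Γ' : Env n m} (h : EnvStr Γ Γ') : EnvStr (Env.psubst G Γ) (Env.psubst G Γ') := by
  induction h with
  | refl => exact .refl _
  | trans _ _ ih₁ ih₂ => exact ih₁.trans ih₂
  | con Γ u h =>
    cases u with
    | inl u => simpa only [Env.psubst_inl] using EnvStr.con _ _ h
    | inr w =>
      simp only [Env.psubst_cons, ← add_assoc]
      refine EnvStr.add_right ?_ _
      cases h with
      | proc => exact (hG w).dup
      | _ => exact .refl _
  | join Γ u h =>
    cases u with
    | inl u => simpa only [Env.psubst_inl] using EnvStr.join _ _ h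
    | inr w =>
      simp only [Env.psubst_cons, ← add_assoc]
      refine EnvStr.add_right ?_ _
      cases h with
      | proc => exact EnvStr.of_le (Multiset.le_add_right _ _)
      | _ => exact .refl _
  | eq Γ u h =>
    cases u with
    | inl u => simpa only [Env.psubst_inl] using EnvStr.eq _ _ h
    | inr w =>
      rw [Env.psubst_cons, Env.psubst_cons]
      exact EnvStr.refl _
  | weak Γ u T =>
    rw [Env.psubst_cons]
    exact EnvStr.of_le (Multiset.le_add_left _ _)
  | sub Γ u Us h =>
    cases u with
    | inl u => simpa only [Env.psubst_inl] using EnvStr.sub _ _ Us h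
    | inr w =>
      rw [Env.psubst_cons, Env.psubst_cons]
      exact EnvStr.refl _
  | rev Γ u Us Us' =>
    cases u with
    | inl u => simpa only [Env.psubst_inl] using EnvStr.rev _ _ Us Us'
    | inr w =>
      rw [Env.psubst_cons, Env.psubst_cons]
      exact EnvStr.refl _

theorem Decr.psubst {n m m' k : ℕ} (G : Fin m → Env n m') {u : Val n} {Us : Fin k → ChTy}
    {a : Attr} {D : Env n m} (h : Decr u Us a D) : Decr u Us a (Env.psubst G D) := by
  cases h <;> simp [Env.psubst, substAssumption] <;> constructor

theorem Env.Unrestricted.map {n m n' m' : ℕ} (f : Ident n m → Ident n' m') {Γ : Env n m}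
    (h : Γ.Unrestricted) : (Γ.map f).Unrestricted := by
  intro p hp
  obtain ⟨q, hq, rfl⟩ := Multiset.mem_map.1 hp
  exact h q hq

theorem Typed.psubst {n m m' : ℕ} {Γ : Env n m} {P : Proc n m} (h : Typed Γ P)
    {G : Fin m → Env n m'} (hG : ∀ w, (G w).Unrestricted) {σ : Fin m → Proc n m'}
    (hσ : ∀ w, Typed (G w) (σ w)) : Typed (Env.psubst G Γ) (P.psubst σ) := by
  induction h generalizing m' with
  | out hD _ ih =>
    rw [Env.psubst_inl, Env.psubst_add, Env.psubst_list]
    refine Typed.out (hD.psubst G) ?_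
    rw [← Env.psubst_add]
    exact ih hG hσ
  | inp hD _ ih =>
    rw [Env.psubst_inl]
    refine Typed.inp (hD.psubst G) ?_
    have := ih (G := fun w => (G w).weaken _) (fun w => (hG w).map _)
      (fun w => (hσ w).rename (Val.weaken _) id)
    rwa [Env.psubst_add, Env.psubst_list, Env.psubst_weaken, Env.psubst_add] at this
  | par _ _ ih₁ ih₂ =>
    rw [Env.psubst_add]
    exact (ih₁ hG hσ).par (ih₂ hG hσ)
  | cond hu hv _ _ ih₁ ih₂ =>
    exact .cond (Env.has_psubst G hu) (Env.has_psubst G hv) (ih₁ hG hσ) (ih₂ hG hσ)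
  | @fix n m Γ P hΓ _ ih =>
    rw [Proc.psubst_fix]
    refine .fix (hΓ.psubst hG) ?_
    have h₀ : Env.Unrestricted ({(.inr 0, .proc)} : Env n (m' + 1)) :=
      fun p hp => .inl (by rw [Multiset.mem_singleton.1 hp])
    have := ih (G := liftEnv G) (σ := liftSubst σ)
      (fun w => Fin.cases h₀ (fun w => (hG w).map _) w)
      (fun w => Fin.cases (Typed.pvar 0) (fun w => (hσ w).rename id Fin.succ) w)
    rwa [Env.psubst_cons, Env.psubst_weakenProc] at this
  | pvar w =>
    have : Env.psubst G {(Sum.inr w, Ty.proc)} = G w := by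
      simp [Env.psubst, substAssumption]
    rw [this]
    exact hσ w
  | free Us _ ih =>
    rw [Env.psubst_inl]
    exact .free Us (ih hG hσ)
  | alloc Us _ ih =>
    refine .alloc Us ?_
    have := ih (G := fun w => (G w).weaken 1) (fun w => (hG w).map _)
      (fun w => (hσ w).rename (Val.weaken 1) id)
    rwa [Env.psubst_inl, Env.psubst_weaken] at this
  | nil => exact .nil
  | str h _ ih => exact .str (h.psubst hG) (ih hG hσ)

theorem Typed.unfold {n m : ℕ} {Γ : Env n m} {P : Proc n (m + 1)} (hΓ : Γ.Unrestricted)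
    (h : Typed ((Sum.inr 0, .proc) ::ₘ Γ.weakenProc) P) : Typed Γ P.unfold := by
  have := h.psubst (G := Fin.cases Γ (fun w => {(.inr w, .proc)}))
    (σ := Fin.cases (.fix P) (fun w => .pvar w))
    (Fin.cases hΓ fun w p hp => .inl (Multiset.mem_singleton.1 hp ▸ rfl))
    (Fin.cases (.fix hΓ h) fun w => .pvar w)
  refine Typed.str ?_ this
  rw [Env.psubst_cons]
  -- One copy of `Γ` types the recursive process put in for the variable. The other covers the
  -- substituted environment of the body, since each of its assumptions is sent to itself or
  -- dropped.
  refine hΓ.dup.trans (EnvStr.add_left _ (EnvStr.of_le ?_))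
  rw [Env.psubst, Env.weakenProc, Env.map, Multiset.bind_map]
  have key : ∀ p : Ident n m × Ty, substAssumption (m' := m)
      (Fin.cases Γ (fun w => {(.inr w, .proc)})) (Sum.map id Fin.succ p.1, p.2) ≤ {p} := by
    rintro ⟨u | w, T | _⟩ <;> simp [substAssumption]
  generalize substAssumption (m' := m) (Fin.cases Γ (fun w => {(.inr w, .proc)})) = F at key
  clear this h hΓ
  induction Γ using Multiset.induction with
  | empty => simp
  | cons p Γ ih =>
    rw [Multiset.cons_bind, ← Multiset.singleton_add]
    exact add_le_add (key p) ih

/-! ### Type equality: inversion -/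

theorem PreTy.rename_mu {n n' : ℕ} (f : Fin n → Fin n') (U : PreTy (n + 1)) :
    (PreTy.mu U).rename f = .mu (U.rename (liftFin f)) := rfl

/-- A type substitution, extended under a binder. -/
def PreTy.liftSubst {n n' : ℕ} (s : Fin n → PreTy n') : Fin (n + 1) → PreTy (n' + 1) :=
  Fin.cases (.var 0) (fun x => (s x).rename Fin.succ)

/-- The substitution that replaces the last bound type variable. -/
def PreTy.instSubst {n : ℕ} (V : PreTy n) : Fin (n + 1) → PreTy n :=
  Fin.cases V (fun x => .var x)

theorem PreTy.subst_mu {n n' : ℕ} (s : Fin n → PreTy n') (U : PreTy (n + 1)) :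
    (PreTy.mu U).subst s = .mu (U.subst (PreTy.liftSubst s)) := rfl

theorem PreTy.rename_rename {n n' n'' : ℕ} (f : Fin n → Fin n') (g : Fin n' → Fin n'')
    (U : PreTy n) : (U.rename f).rename g = U.rename (g ∘ f) := by
  induction U generalizing n' n'' with
  | chan k Us a ih => simp [PreTy.rename, ih]
  | mu U ih => simp only [PreTy.rename_mu, ih, liftFin_comp]
  | var x => rfl

theorem PreTy.subst_rename {n n' n'' : ℕ} (s : Fin n → PreTy n') (g : Fin n' → Fin n'')
    (U : PreTy n) : (U.subst s).rename g = U.subst (fun x => (s x).rename g) := by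
  induction U generalizing n' n'' with
  | chan k Us a ih => simp [PreTy.rename, PreTy.subst, ih]
  | mu U ih =>
    simp only [PreTy.rename_mu, PreTy.subst_mu, ih]
    congr 2
    funext x
    refine Fin.cases rfl (fun x => ?_) x
    simp only [PreTy.liftSubst, Fin.cases_succ, PreTy.rename_rename]
    rfl
  | var x => rfl

theorem PreTy.rename_subst {n n' n'' : ℕ} (f : Fin n → Fin n') (s : Fin n' → PreTy n'')
    (U : PreTy n) : (U.rename f).subst s = U.subst (s ∘ f) := by
  induction U generalizing n' n'' with
  | chan k Us a ih => simp [PreTy.rename, PreTy.subst, ih]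
  | mu U ih =>
    simp only [PreTy.rename_mu, PreTy.subst_mu, ih]
    congr 2
    funext x
    exact Fin.cases rfl (fun x => rfl) x
  | var x => rfl

theorem PreTy.subst_subst {n n' n'' : ℕ} (s : Fin n → PreTy n') (t : Fin n' → PreTy n'')
    (U : PreTy n) : (U.subst s).subst t = U.subst (fun x => (s x).subst t) := by
  induction U generalizing n' n'' with
  | chan k Us a ih => simp [PreTy.subst, ih]
  | mu U ih =>
    simp only [PreTy.subst_mu, ih]
    congr 2
    funext x
    refine Fin.cases rfl (fun x => ?_) x
    simp only [PreTy.liftSubst, Fin.cases_succ, PreTy.rename_subst, PreTy.subst_rename]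
    rfl
  | var x => rfl

theorem PreTy.subst_var {n : ℕ} (U : PreTy n) : U.subst PreTy.var = U := by
  induction U with
  | chan k Us a ih => simp [PreTy.subst, ih]
  | mu U ih =>
    rw [PreTy.subst_mu]
    conv_rhs => rw [← ih]
    congr 2
    funext x
    exact Fin.cases rfl (fun x => rfl) x
  | var x => rfl

theorem PreTy.inst_subst {n n' : ℕ} (s : Fin n → PreTy n') (V : PreTy n) (U : PreTy (n + 1)) :
    (U.subst (PreTy.instSubst V)).subst s =
      (U.subst (PreTy.liftSubst s)).subst (PreTy.instSubst (V.subst s)) := by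
  rw [PreTy.subst_subst, PreTy.subst_subst]
  congr 1
  funext x
  refine Fin.cases rfl (fun x => ?_) x
  simp only [PreTy.liftSubst, PreTy.instSubst, Fin.cases_succ, PreTy.rename_subst]
  exact (PreTy.subst_var _).symm

/-! ### Stability of type equality under renaming and substitution. -/

theorem TyEq.rename {n n' : ℕ} {U V : PreTy n} (h : TyEq U V) (f : Fin n → Fin n') :
    TyEq (U.rename f) (V.rename f) := by
  induction h generalizing n' with
  | refl => exact .refl _
  | symm _ ih => exact (ih f).symm
  | trans _ _ ih₁ ih₂ => exact (ih₁ f).trans (ih₂ f)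
  | unfold U =>
    change TyEq _ ((U.subst (PreTy.instSubst (.mu U))).rename f)
    have : (U.subst (PreTy.instSubst (.mu U))).rename f =
        (U.rename (liftFin f)).subst (PreTy.instSubst ((PreTy.mu U).rename f)) := by
      rw [PreTy.subst_rename, PreTy.rename_subst]
      congr 1
      funext x
      exact Fin.cases rfl (fun x => rfl) x
    rw [this]
    exact .unfold _
  | chan a _ ih => exact .chan a fun i => ih i f
  | mu _ ih => exact .mu (ih (liftFin f))

theorem TyEq.subst_congr {n n' : ℕ} (U : PreTy n) {s t : Fin n → PreTy n'}
    (h : ∀ x, TyEq (s x) (t x)) : TyEq (U.subst s) (U.subst t) := by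
  induction U generalizing n' with
  | chan k Us a ih => exact .chan a fun i => ih i h
  | mu U ih =>
    exact .mu (ih (Fin.cases (.refl _) fun x => (h x).rename Fin.succ))
  | var x => exact h x

theorem TyEq.subst {n n' : ℕ} {U V : PreTy n} (h : TyEq U V) (s : Fin n → PreTy n') :
    TyEq (U.subst s) (V.subst s) := by
  induction h generalizing n' with
  | refl => exact .refl _
  | symm _ ih => exact (ih s).symm
  | trans _ _ ih₁ ih₂ => exact (ih₁ s).trans (ih₂ s)
  | unfold U =>
    change TyEq _ ((U.subst (PreTy.instSubst (.mu U))).subst s)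
    rw [PreTy.inst_subst]
    exact .unfold _
  | chan a _ ih => exact .chan a fun i => ih i s
  | mu _ ih => exact .mu (ih (PreTy.liftSubst s))

/-- The result of unfolding a type expression at the head: a channel type, a variable, or nothing
if the unfolding does not terminate. -/
inductive Head (n : ℕ) : Type
  | chan (k : ℕ) (Us : Fin k → PreTy n) (a : Attr) : Head n
  | var (x : Fin n) : Head n
  | none : Head n

/-- The head of `μ X. U`, given the head of `U`. -/
def Head.mu {n : ℕ} (V : PreTy n) : Head (n + 1) → Head n
  | .chan k Us a => .chan k (fun i => (Us i).subst (PreTy.instSubst V)) a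
  | .var x => Fin.cases .none (fun x => .var x) x
  | .none => .none

/-- Unfolding of a type expression at the head. -/
def PreTy.head : {n : ℕ} → PreTy n → Head n
  | _, .chan k Us a => .chan k Us a
  | _, .mu U => U.head.mu (.mu U)
  | _, .var x => .var x

/-- Equality of heads up to type equality of the object types. -/
inductive Head.Eqv {n : ℕ} : Head n → Head n → Prop
  | chan {k : ℕ} {Us Vs : Fin k → PreTy n} (a : Attr) (h : ∀ i, TyEq (Us i) (Vs i)) :
      Head.Eqv (.chan k Us a) (.chan k Vs a)
  | var (x : Fin n) : Head.Eqv (.var x) (.var x)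
  | none : Head.Eqv .none .none

theorem Head.Eqv.refl {n : ℕ} (h : Head n) : h.Eqv h := by
  cases h with
  | chan k Us a => exact .chan a fun i => .refl _
  | var x => exact .var x
  | none => exact .none

theorem Head.Eqv.symm {n : ℕ} {h h' : Head n} (e : h.Eqv h') : h'.Eqv h := by
  cases e with
  | chan a e => exact .chan a fun i => (e i).symm
  | var x => exact .var x
  | none => exact .none

theorem Head.Eqv.trans {n : ℕ} {h h' h'' : Head n} (e : h.Eqv h') (e' : h'.Eqv h'') :
    h.Eqv h'' := by
  cases e with
  | chan a e =>
    cases e' with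
    | chan _ e' => exact .chan a fun i => (e i).trans (e' i)
  | var x => exact e'
  | none => exact e'

/-- The head of `U.subst s`, given the head of `U`. -/
def Head.subst {n n' : ℕ} (s : Fin n → PreTy n') : Head n → Head n'
  | .chan k Us a => .chan k (fun i => (Us i).subst s) a
  | .var x => (s x).head
  | .none => .none

/-- The head of `U.rename f`, given the head of `U`. -/
def Head.rename {n n' : ℕ} (f : Fin n → Fin n') : Head n → Head n'
  | .chan k Us a => .chan k (fun i => (Us i).rename f) a
  | .var x => .var (f x)
  | .none => .none

theorem PreTy.head_rename {n n' : ℕ} (U : PreTy n) (f : Fin n → Fin n') :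
    (U.rename f).head = U.head.rename f := by
  induction U generalizing n' with
  | chan k Us a ih => rfl
  | mu U ih =>
    rw [PreTy.rename_mu, PreTy.head, PreTy.head, ih]
    cases U.head with
    | chan k Us a =>
      simp only [Head.rename, Head.mu, Head.chan.injEq, heq_eq_eq, true_and, and_true]
      funext i
      rw [PreTy.rename_subst, PreTy.subst_rename]
      congr 1
      funext x
      exact Fin.cases rfl (fun x => rfl) x
    | var x => exact Fin.cases rfl (fun x => rfl) x
    | none => rfl
  | var x => rfl

theorem Head.mu_rename_succ {n : ℕ} (V : PreTy n) (h : Head n) :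
    (h.rename Fin.succ).mu V = h := by
  cases h with
  | chan k Us a =>
    simp only [Head.rename, Head.mu, Head.chan.injEq, heq_eq_eq, true_and, and_true]
    funext i
    rw [PreTy.rename_subst]
    exact PreTy.subst_var _
  | var x => rfl
  | none => rfl

theorem PreTy.head_subst {n n' : ℕ} (U : PreTy n) (s : Fin n → PreTy n') :
    (U.subst s).head = U.head.subst s := by
  induction U generalizing n' with
  | chan k Us a ih => rfl
  | mu U ih =>
    rw [PreTy.subst_mu, PreTy.head, PreTy.head, ih]
    cases U.head with
    | chan k Us a =>
      simp only [Head.subst, Head.mu, Head.chan.injEq, heq_eq_eq, true_and, and_true]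
      funext i
      exact (PreTy.inst_subst s (.mu U) (Us i)).symm
    | var x =>
      refine Fin.cases rfl (fun x => ?_) x
      simp only [Head.subst, Head.mu, PreTy.liftSubst, Fin.cases_succ, PreTy.head_rename]
      exact Head.mu_rename_succ _ _
    | none => rfl
  | var x => rfl

/-- The head commutes with substitution, so it is unchanged by unfolding. Because `Head.none` makes
the head total, contractiveness is not required, and derivations through arbitrary open expressions
are covered. -/
theorem TyEq.head {n : ℕ} {U V : PreTy n} (h : TyEq U V) : U.head.Eqv V.head := by
  induction h with
  | refl => exact .refl _
  | symm _ ih => exact ih.symm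
  | trans _ _ ih₁ ih₂ => exact ih₁.trans ih₂
  | unfold U =>
    change Head.Eqv _ (U.subst (PreTy.instSubst (.mu U))).head
    rw [PreTy.head_subst, PreTy.head]
    cases hU : U.head with
    | chan k Us a => exact .refl _
    | var x =>
      induction x using Fin.cases with
      -- The head of the body is the bound variable, so unfolding returns to the same expression and
      -- neither side has a proper head.
      | zero =>
        change Head.Eqv .none (PreTy.mu U).head
        rw [PreTy.head, hU]
        exact .none
      | succ x => exact .refl _
    | none => exact .none
  | chan a h _ => exact .chan a h
  | @mu n U V h ih =>
    simp only [PreTy.head]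
    generalize U.head = hU at ih
    generalize V.head = hV at ih
    cases ih with
    | chan a e =>
      refine .chan a fun i => ((e i).subst _).trans (TyEq.subst_congr _ ?_)
      exact Fin.cases (.mu h) fun x => .refl _
    | var x => exact .refl _
    | none => exact .none

/-- Direct inversion fails, as a derivation may pass through recursive types by transitivity. Heads
survive these detours, and a channel type is its own head. -/
theorem TyEq.chan_inv {n k k' : ℕ} {Us : Fin k → PreTy n} {Vs : Fin k' → PreTy n} {a b : Attr}
    (h : TyEq (.chan k Us a) (.chan k' Vs b)) :
    a = b ∧ ∃ e : k = k', ∀ i, TyEq (Us i) (Vs (Fin.cast e i)) := by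
  have := h.head
  simp only [PreTy.head] at this
  cases this with
  | chan a e => exact ⟨rfl, rfl, e⟩

/-- The bound variable of a contractive `μ` is guarded, so it cannot be the head of the body, and
head unfolding ends. The variable case disappears for closed types. -/
theorem PreTy.Contractive.head {n : ℕ} {U : PreTy n} (h : U.Contractive) :
    (∃ k Us a, U.head = .chan k Us a ∧ TyEq U (.chan k Us a)) ∨
      ∃ x, U.head = .var x ∧ U.Unguarded x := by
  induction U with
  | chan k Us a ih => exact .inl ⟨k, Us, a, rfl, .refl _⟩
  | mu U ih =>
    rcases ih h.2 with ⟨k, Us, a, h₁, h₂⟩ | ⟨x, h₁, h₂⟩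
    · refine .inl ⟨k, _, a, by rw [PreTy.head, h₁]; rfl, ?_⟩
      exact (TyEq.unfold U).trans (h₂.subst _)
    · induction x using Fin.cases with
      | zero => exact absurd h₂ h.1
      | succ x => exact .inr ⟨x, by rw [PreTy.head, h₁]; rfl, h₂⟩
  | var x => exact .inr ⟨x, rfl, rfl⟩

theorem ChTy.exists_chan (U : ChTy) : ∃ k Us a, TyEq U.1 (.chan k Us a) := by
  rcases U.2.head with ⟨k, Us, a, -, h⟩ | ⟨x, -⟩
  · exact ⟨k, Us, a, h⟩
  · exact x.elim0

/-! ### Consistent environments -/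

/-- `T` is the channel type `[V]^a`, up to type equality. -/
def Ty.IsChan {k : ℕ} (V : Fin k → PreTy 0) (a : Attr) (T : Ty) : Prop :=
  ∃ U : ChTy, T = .chan U ∧ TyEq U.1 (.chan k V a)

theorem Ty.isChan_ch {k k' : ℕ} {V : Fin k → PreTy 0} {a b : Attr} {Us : Fin k' → ChTy} :
    (Ty.ch Us b).IsChan V a ↔ b = a ∧ ∃ e : k' = k, ∀ i, TyEq (Us i).1 (V (Fin.cast e i)) := by
  constructor
  · rintro ⟨U, h, h'⟩
    cases h
    exact h'.chan_inv
  · rintro ⟨rfl, rfl, h⟩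
    exact ⟨_, rfl, .chan _ h⟩

/-- The types that a consistent environment may assign to one identifier: types of processes only;
or one type that is unique after `i` uses and at most `i` affine ones; or unrestricted and affine
ones; with equal object types throughout. -/
def Coherent (A : Multiset Ty) : Prop :=
  (∀ T ∈ A, T = .proc) ∨ ∃ (k : ℕ) (V : Fin k → PreTy 0),
    (∀ T ∈ A, T.IsChan V .un ∨ T.IsChan V .aff) ∨
    ∃ i T₀ A₁, A = T₀ ::ₘ A₁ ∧ T₀.IsChan V (.uniq i) ∧ (∀ T ∈ A₁, T.IsChan V .aff) ∧
      Multiset.card A₁ ≤ i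

theorem Coherent.of_card_le_one {A : Multiset Ty} (h : Multiset.card A ≤ 1) : Coherent A := by
  rcases Nat.le_one_iff_eq_zero_or_eq_one.1 h with h | h
  · rw [Multiset.card_eq_zero] at h
    exact .inl (by simp [h])
  · obtain ⟨T, rfl⟩ := Multiset.card_eq_one.1 h
    cases T with
    | proc => exact .inl (by simp)
    | chan U =>
      obtain ⟨k, V, a, hU⟩ := U.exists_chan
      refine .inr ⟨k, V, ?_⟩
      cases a with
      | un => exact .inl (by simpa using .inl ⟨U, rfl, hU⟩)
      | aff => exact .inl (by simpa using .inr ⟨U, rfl, hU⟩)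
      | uniq i => exact .inr ⟨i, _, 0, rfl, ⟨U, rfl, hU⟩, by simp, by simp⟩

theorem Coherent.mono {A B : Multiset Ty} (h : A ≤ B) (hB : Coherent B) : Coherent A := by
  obtain ⟨C, rfl⟩ := Multiset.le_iff_exists_add.1 h
  clear h
  rcases hB with hB | ⟨k, V, hB | ⟨i, T₀, A₁, h, h₁, h₂, h₃⟩⟩
  · exact .inl fun T hT => hB T (by simp [hT])
  · exact .inr ⟨k, V, .inl fun T hT => hB T (by simp [hT])⟩
  · by_cases hT : T₀ ∈ A
    · obtain ⟨A', rfl⟩ := Multiset.exists_cons_of_mem hT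
      rw [Multiset.cons_add, Multiset.cons_inj_right] at h
      subst h
      refine .inr ⟨k, V, .inr ⟨i, T₀, A', rfl, h₁, fun T hT => h₂ T (by simp [hT]), ?_⟩⟩
      simp at h₃; omega
    -- The unique assumption has been discarded; only affine ones remain.
    · refine .inr ⟨k, V, .inl fun T hT' => .inr (h₂ T ?_)⟩
      have : T ∈ T₀ ::ₘ A₁ := h ▸ Multiset.mem_add.2 (.inl hT')
      rcases Multiset.mem_cons.1 this with rfl | h'
      · exact absurd hT' hT
      · exact h'

theorem Ty.ch_ne_proc {k : ℕ} {Us : Fin k → ChTy} {a : Attr} : Ty.ch Us a ≠ .proc := by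
  simp [Ty.ch]

/-- The shape of a coherent multiset of types that contains `[Us]^a`. -/
theorem Coherent.cons_ch {k : ℕ} {Us : Fin k → ChTy} {a : Attr} {A : Multiset Ty} :
    Coherent (.ch Us a ::ₘ A) ↔
      (a = .un ∨ a = .aff) ∧ (∀ T ∈ A, T.IsChan (fun i => (Us i).1) .un ∨
        T.IsChan (fun i => (Us i).1) .aff) ∨
      (∃ i, a = .uniq i ∧ (∀ T ∈ A, T.IsChan (fun i => (Us i).1) .aff) ∧
        Multiset.card A ≤ i) ∨
      a = .aff ∧ ∃ i T₀ A₁, A = T₀ ::ₘ A₁ ∧ T₀.IsChan (fun i => (Us i).1) (.uniq i) ∧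
        (∀ T ∈ A₁, T.IsChan (fun i => (Us i).1) .aff) ∧ Multiset.card A₁ + 1 ≤ i := by
  have self : ∀ b, (Ty.ch Us b).IsChan (fun i => (Us i).1) b := fun b =>
    Ty.isChan_ch.2 ⟨rfl, rfl, fun i => .refl _⟩
  constructor
  · have key : ∀ {V : Fin k → PreTy 0}, (∀ i, TyEq (Us i).1 (V i)) → ∀ {b : Attr} {T : Ty},
        T.IsChan V b → T.IsChan (fun i => (Us i).1) b := by
      rintro V h b T ⟨U, rfl, hU⟩
      exact ⟨U, rfl, hU.trans (.chan _ fun i => (h i).symm)⟩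
    rintro (h | ⟨k', V, h | ⟨i, T₀, A₁, h, h₁, h₂, h₃⟩⟩)
    · exact absurd (h _ (Multiset.mem_cons_self _ _)) Ty.ch_ne_proc
    · refine .inl ?_
      rcases h _ (Multiset.mem_cons_self _ _) with h' | h' <;>
      · obtain ⟨rfl, rfl, h'⟩ := Ty.isChan_ch.1 h'
        exact ⟨by simp, fun T hT => (h T (Multiset.mem_cons_of_mem hT)).imp (key h') (key h')⟩
    · rcases Multiset.cons_eq_cons.1 h with ⟨rfl, rfl⟩ | ⟨-, C, rfl, rfl⟩
      · obtain ⟨rfl, rfl, h'⟩ := Ty.isChan_ch.1 h₁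
        exact .inr (.inl ⟨i, rfl, fun T hT => key h' (h₂ T hT), h₃⟩)
      · obtain ⟨rfl, rfl, h'⟩ := Ty.isChan_ch.1 (h₂ _ (Multiset.mem_cons_self _ _))
        exact .inr (.inr ⟨rfl, i, T₀, C, rfl, key h' h₁,
          fun T hT => key h' (h₂ T (Multiset.mem_cons_of_mem hT)), by simpa using h₃⟩)
  · rintro (⟨rfl | rfl, h⟩ | ⟨i, rfl, h, h'⟩ | ⟨rfl, i, T₀, A₁, rfl, h₁, h₂, h₃⟩)
    · refine .inr ⟨k, fun i => (Us i).1, .inl fun T hT => ?_⟩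
      rcases Multiset.mem_cons.1 hT with rfl | hT
      · exact .inl (self _)
      · exact h T hT
    · refine .inr ⟨k, fun i => (Us i).1, .inl fun T hT => ?_⟩
      rcases Multiset.mem_cons.1 hT with rfl | hT
      · exact .inr (self _)
      · exact h T hT
    · exact .inr ⟨k, _, .inr ⟨i, _, A, rfl, self _, h, h'⟩⟩
    · refine .inr ⟨k, _, .inr ⟨i, T₀, _, Multiset.cons_swap _ _ _, h₁, fun T hT => ?_,
        by simpa using h₃⟩⟩
      rcases Multiset.mem_cons.1 hT with rfl | hT
      · exact self _
      · exact h₂ T hT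

/-- Splitting a unique type creates one affine type and raises the index by one, so the bound on the
number of affine types is kept. -/
theorem Coherent.con {T T₁ T₂ : Ty} (hs : Split T T₁ T₂) {A : Multiset Ty}
    (h : Coherent (T ::ₘ A)) : Coherent (T₁ ::ₘ T₂ ::ₘ A) := by
  have self : ∀ {k} {Us : Fin k → ChTy} b, (Ty.ch Us b).IsChan (fun i => (Us i).1) b :=
    fun b => Ty.isChan_ch.2 ⟨rfl, rfl, fun i => .refl _⟩
  cases hs with
  | unr Us =>
    simp only [Coherent.cons_ch] at h
    rcases h with ⟨-, h⟩ | ⟨i, h, -⟩ | ⟨h, -⟩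
    · refine Coherent.cons_ch.2 (.inl ⟨.inl rfl, fun T hT => ?_⟩)
      rcases Multiset.mem_cons.1 hT with rfl | hT
      · exact .inl (self _)
      · exact h T hT
    · cases h
    · cases h
  | proc =>
    rcases h with h | ⟨k, V, h | ⟨i, T₀, A₁, h, ⟨U, rfl, -⟩, h₂, -⟩⟩
    · exact .inl fun T hT => h T (by simpa using hT)
    · rcases h _ (Multiset.mem_cons_self _ _) with ⟨U, h, -⟩ | ⟨U, h, -⟩ <;> cases h
    · have : Ty.proc ∈ Ty.chan U ::ₘ A₁ := h ▸ Multiset.mem_cons_self _ _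
      obtain ⟨U, h, -⟩ := h₂ Ty.proc (by simpa using this)
      cases h
  | unq Us j =>
    simp only [Coherent.cons_ch] at h
    rcases h with ⟨h | h, -⟩ | ⟨i, h, h', h''⟩ | ⟨h, -⟩
    · cases h
    · cases h
    · cases h
      exact Coherent.cons_ch.2 (.inr (.inr ⟨rfl, j + 1, _, A, rfl, self _, h', by omega⟩))
    · cases h

theorem Coherent.join {T T₁ T₂ : Ty} (hs : Split T T₁ T₂) {A : Multiset Ty}
    (h : Coherent (T₁ ::ₘ T₂ ::ₘ A)) : Coherent (T ::ₘ A) := by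
  cases hs with
  | unr Us => exact h.mono (Multiset.le_cons_self _ _)
  | proc => exact h.mono (Multiset.le_cons_self _ _)
  | unq Us j =>
    have h' := h.mono (Multiset.le_cons_self _ _)
    -- With the unique type in front, the bound counts the affine type that is about to be merged;
    -- without it at most `j` others remain.
    rw [Multiset.cons_swap] at h
    simp only [Coherent.cons_ch] at h
    rcases h with ⟨h | h, -⟩ | ⟨i, h, h', h''⟩ | ⟨h, -⟩
    · cases h
    · cases h
    · cases h
      refine Coherent.cons_ch.2 (.inr (.inl ⟨j, rfl,
        fun T hT => h' T (Multiset.mem_cons_of_mem hT), by simpa using h''⟩))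
    · cases h

/-- Apart from the type of processes, coherence sees a type only through `Ty.IsChan`, that is, up to
type equality. -/
theorem Coherent.of_isChan {T T' : Ty} {A : Multiset Ty} (h : Coherent (T ::ₘ A))
    (hp : T ≠ .proc)
    (hT : ∀ {k} {V : Fin k → PreTy 0} {a}, T.IsChan V a → T'.IsChan V a) :
    Coherent (T' ::ₘ A) := by
  rcases h with h | ⟨k, V, h | ⟨i, T₀, A₁, h, h₁, h₂, h₃⟩⟩
  · exact absurd (h _ (Multiset.mem_cons_self _ _)) hp
  · refine .inr ⟨k, V, .inl fun T₁ hT₁ => ?_⟩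
    rcases Multiset.mem_cons.1 hT₁ with rfl | hT₁
    · exact (h _ (Multiset.mem_cons_self _ _)).imp hT hT
    · exact h _ (Multiset.mem_cons_of_mem hT₁)
  · rcases Multiset.cons_eq_cons.1 h with ⟨rfl, rfl⟩ | ⟨-, C, rfl, rfl⟩
    · exact .inr ⟨k, V, .inr ⟨i, _, A, rfl, hT h₁, h₂, h₃⟩⟩
    · refine .inr ⟨k, V, .inr ⟨i, T₀, _, Multiset.cons_swap _ _ _, h₁, fun T₁ hT₁ => ?_,
        by simpa using h₃⟩⟩
      rcases Multiset.mem_cons.1 hT₁ with rfl | hT₁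
      · exact hT (h₂ _ (Multiset.mem_cons_self _ _))
      · exact h₂ _ (Multiset.mem_cons_of_mem hT₁)

theorem Coherent.sub {k : ℕ} {Us : Fin k → ChTy} {a b : Attr} (hs : SubAttr a b)
    {A : Multiset Ty} (h : Coherent (.ch Us a ::ₘ A)) : Coherent (.ch Us b ::ₘ A) := by
  rw [Coherent.cons_ch] at h ⊢
  cases hs with
  | indx i =>
    rcases h with ⟨h | h, -⟩ | ⟨i, h, h', h''⟩ | ⟨h, -⟩
    · cases h
    · cases h
    · cases h
      exact .inr (.inl ⟨_, rfl, h', by omega⟩)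
    · cases h
  | unq i =>
    rcases h with ⟨h | h, -⟩ | ⟨i, h, h', h''⟩ | ⟨h, -⟩
    · cases h
    · cases h
    · exact .inl ⟨.inl rfl, fun T hT => .inr (h' T hT)⟩
    · cases h
  | aff =>
    rcases h with ⟨-, h⟩ | ⟨i, h, -⟩ | ⟨h, -⟩
    · exact .inl ⟨.inr rfl, h⟩
    · cases h
    · cases h

/-- At index `0` the bound leaves no other assumption for the channel, so changing the object types
cannot create a conflict. -/
theorem Coherent.rev {k k' : ℕ} {Us : Fin k → ChTy} {Us' : Fin k' → ChTy}
    {A : Multiset Ty} (h : Coherent (.ch Us (.uniq 0) ::ₘ A)) :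
    Coherent (.ch Us' (.uniq 0) ::ₘ A) := by
  rw [Coherent.cons_ch] at h
  rcases h with ⟨h | h, -⟩ | ⟨i, h, -, h''⟩ | ⟨h, -⟩
  · cases h
  · cases h
  · cases h
    rw [Multiset.card_eq_zero.1 (Nat.le_zero.1 h'')]
    exact .of_card_le_one (by simp)
  · cases h

open Classical in
/-- The types assigned to an identifier. -/
noncomputable def Env.typesOf {n m : ℕ} (Γ : Env n m) (u : Ident n m) : Multiset Ty :=
  (Multiset.filter (fun p => p.1 = u) Γ).map Prod.snd

theorem Env.typesOf_cons_self {n m : ℕ} (Γ : Env n m) (u : Ident n m) (T : Ty) :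
    Env.typesOf ((u, T) ::ₘ Γ) u = T ::ₘ Γ.typesOf u := by
  simp [Env.typesOf]

theorem Env.typesOf_cons_of_ne {n m : ℕ} (Γ : Env n m) {u v : Ident n m} (T : Ty)
    (h : v ≠ u) : Env.typesOf ((v, T) ::ₘ Γ) u = Γ.typesOf u := by
  simp [Env.typesOf, h]

/-- Each rule acts on a single identifier, so the invariant is checked for that identifier and is
untouched elsewhere. -/
theorem EnvStr.coherent {n m : ℕ} {Γ Γ' : Env n m} (h : EnvStr Γ Γ') {u : Ident n m}
    (hΓ : Coherent (Γ.typesOf u)) : Coherent (Γ'.typesOf u) := by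
  induction h with
  | refl => exact hΓ
  | trans _ _ ih₁ ih₂ => exact ih₂ (ih₁ hΓ)
  | con Γ v h =>
    by_cases e : v = u
    · subst e
      simp only [Env.typesOf_cons_self] at hΓ ⊢
      exact hΓ.con h
    · simpa only [Env.typesOf_cons_of_ne _ _ e] using hΓ
  | join Γ v h =>
    by_cases e : v = u
    · subst e
      simp only [Env.typesOf_cons_self] at hΓ ⊢
      exact hΓ.join h
    · simpa only [Env.typesOf_cons_of_ne _ _ e] using hΓ
  | eq Γ v h =>
    by_cases e : v = u
    · subst e
      simp only [Env.typesOf_cons_self] at hΓ ⊢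
      refine hΓ.of_isChan (by simp) ?_
      rintro k V a ⟨U, hU, h'⟩
      cases hU
      exact ⟨_, rfl, h.symm.trans h'⟩
    · simpa only [Env.typesOf_cons_of_ne _ _ e] using hΓ
  | weak Γ v T =>
    by_cases e : v = u
    · subst e
      simp only [Env.typesOf_cons_self] at hΓ
      exact hΓ.mono (Multiset.le_cons_self _ _)
    · simpa only [Env.typesOf_cons_of_ne _ _ e] using hΓ
  | sub Γ v Us h =>
    by_cases e : v = u
    · subst e
      simp only [Env.typesOf_cons_self] at hΓ ⊢
      exact hΓ.sub h
    · simpa only [Env.typesOf_cons_of_ne _ _ e] using hΓ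
  | rev Γ v Us Us' =>
    by_cases e : v = u
    · subst e
      simp only [Env.typesOf_cons_self] at hΓ ⊢
      exact hΓ.rev
    · simpa only [Env.typesOf_cons_of_ne _ _ e] using hΓ

theorem Env.Consistent.coherent {n m : ℕ} {Γ : Env n m} (h : Γ.Consistent) (u : Ident n m) :
    Coherent (Γ.typesOf u) := by
  classical
  obtain ⟨Γ₀, h₀, h₁⟩ := h
  refine h₁.coherent (.of_card_le_one ?_)
  rw [Env.typesOf, Multiset.card_map, ← Multiset.countP_eq_card_filter]
  have := Multiset.nodup_iff_count_le_one.1 h₀ u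
  rw [Multiset.count_map] at this
  rw [Multiset.countP_eq_card_filter]
  simpa [eq_comm] using this

/-- Two assumptions for one channel in a consistent environment have equal object types, and each
of them can be used once. -/
theorem Env.Consistent.use_two {n m k : ℕ} {Γ D D' : Env n m} {u : Val n}
    {Us Us' : Fin k → ChTy} {a a' : Attr}
    (h : Env.Consistent ((.inl u, .ch Us a) ::ₘ (.inl u, .ch Us' a') ::ₘ Γ))
    (hD : Decr u Us a D) (hD' : Decr u Us' a' D') :
    (∀ i, TyEq (Us i).1 (Us' i).1) ∧
      EnvStr ((.inl u, .ch Us a) ::ₘ (.inl u, .ch Us' a') ::ₘ Γ) (D + D' + Γ) := by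
  have hc := h.coherent (.inl u)
  simp only [Env.typesOf_cons_self] at hc
  -- The other assumptions for `u` are irrelevant. The remaining pair is analysed in both orders,
  -- since each of the two may be the unique one.
  have hc' : Coherent (.ch Us a ::ₘ .ch Us' a' ::ₘ 0) := hc.mono (by simp)
  have hc'' := hc'
  rw [Multiset.cons_swap, Coherent.cons_ch] at hc'
  rw [Coherent.cons_ch] at hc''
  have hU : ∀ i, TyEq (Us i).1 (Us' i).1 := by
    have aux : ∀ {b}, (Ty.ch Us' a').IsChan (fun i => (Us i).1) b →
        ∀ i, TyEq (Us i).1 (Us' i).1 := fun h i => by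
      obtain ⟨_, e, h'⟩ := Ty.isChan_ch.1 h
      exact (h' i).symm
    rcases hc'' with ⟨-, h⟩ | ⟨i, -, h, -⟩ | ⟨-, i, T₀, A₁, h₁, h₂, -⟩
    · rcases h _ (Multiset.mem_cons_self _ _) with h | h <;> exact aux h
    · exact aux (h _ (Multiset.mem_cons_self _ _))
    · obtain ⟨rfl, -⟩ | ⟨-, C, h, -⟩ := Multiset.cons_eq_cons.1 h₁
      · exact aux h₂
      · simp at h
  refine ⟨hU, ?_⟩
  have hTy : ∀ b, EnvStr ((Sum.inl u, Ty.ch Us b) ::ₘ Γ) ((Sum.inl u, Ty.ch Us' b) ::ₘ Γ) :=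
    fun b => EnvStr.eq _ _ (.chan b hU)
  have hTy' : ∀ b Γ, EnvStr (((Sum.inl u, Ty.ch Us' b) : Ident n m × Ty) ::ₘ Γ)
      ((Sum.inl u, Ty.ch Us b) ::ₘ Γ) :=
    fun b Γ => EnvStr.eq _ _ (.chan b fun i => (hU i).symm)
  cases hD with
  | aff =>
    cases hD' with
    | aff => simpa using (EnvStr.weak _ _ _).trans (EnvStr.weak _ _ _)
    | un => simpa using EnvStr.weak _ _ _
    | uniq i =>
      -- An affine permission and a permission unique after `i + 1` uses join to one unique after
      -- `i` uses, exactly what is left when both have been used.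
      have h₁ := (hTy' (.uniq (i + 1)) Γ).cons (Sum.inl u, Ty.ch Us .aff)
      have h₂ := (h₁.trans (EnvStr.join Γ _ (Split.unq Us i))).trans (hTy (.uniq i))
      simpa using h₂
  | un =>
    cases hD' with
    | aff =>
      rw [Multiset.cons_swap]
      simpa using EnvStr.weak _ _ _
    | un => simpa using EnvStr.refl _
    | uniq i => simp [Ty.isChan_ch] at hc'
  | uniq i =>
    cases hD' with
    | aff =>
      rw [Multiset.cons_swap]
      have h₁ := (hTy' .aff ((Sum.inl u, Ty.ch Us (.uniq (i + 1))) ::ₘ Γ))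
      have h₂ := h₁.trans (EnvStr.join Γ _ (Split.unq Us i))
      simpa using h₂
    | un => simp [Ty.isChan_ch] at hc'
    | uniq j => simp [Ty.isChan_ch] at hc'

/-! ### Renaming of channels -/

theorem Sys.rename_rename (s t : Equiv.Perm Chan) (S : Sys) :
    (S.rename s).rename t = S.rename (t * s) := by
  simp [Sys.rename, Proc.mapChan_mapChan, Set.image_image]

theorem Sys.rename_one (S : Sys) : S.rename 1 = S := by
  cases S
  simp only [Sys.rename, Equiv.Perm.coe_one, Set.image_id, Proc.mapChan_id]

theorem Sys.rename_inv (s : Equiv.Perm Chan) (S : Sys) : (S.rename s).rename s⁻¹ = S := by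
  rw [Sys.rename_rename, inv_mul_cancel, Sys.rename_one]

theorem Sys.rename_inv' (s : Equiv.Perm Chan) (S : Sys) : (S.rename s⁻¹).rename s = S := by
  rw [Sys.rename_rename, mul_inv_cancel, Sys.rename_one]

/-- The action of a map of channel names on closed environments. -/
def Env.mapChan (s : Chan → Chan) (Γ : Env 0 0) : Env 0 0 :=
  Γ.map (Sum.map (Val.mapChan s) id)

theorem Env.mapChan_cons (s : Chan → Chan) (c : Chan) (T : Ty) (Γ : Env 0 0) :
    Env.mapChan s ((.inl (.chan c), T) ::ₘ Γ) = (.inl (.chan (s c)), T) ::ₘ Γ.mapChan s :=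
  Env.map_cons _ _ _ _

theorem Env.mapChan_add (s : Chan → Chan) (Γ Δ : Env 0 0) :
    (Γ + Δ).mapChan s = Γ.mapChan s + Δ.mapChan s :=
  Env.map_add _ _ _

theorem Env.mapChan_list (s : Chan → Chan) {k : ℕ} (d : Fin k → Chan) (Us : Fin k → ChTy) :
    Env.mapChan s (Env.list (fun i => .chan (d i)) Us) =
      Env.list (fun i => .chan (s (d i))) Us :=
  Env.map_list _ _ _ _

theorem Env.mapChan_mapChan (s t : Chan → Chan) (Γ : Env 0 0) :
    (Γ.mapChan t).mapChan s = Γ.mapChan (s ∘ t) := by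
  rw [Env.mapChan, Env.mapChan, Env.map_map]
  refine Env.map_congr fun u _ => ?_
  cases u <;> simp [Val.mapChan_mapChan]

theorem Env.mapChan_id (Γ : Env 0 0) : Γ.mapChan id = Γ := by
  rw [Env.mapChan, Val.mapChan_id, Sum.map_id_id, Env.map_id]

theorem Env.mapChan_inv (s : Equiv.Perm Chan) (Γ : Env 0 0) :
    (Γ.mapChan s).mapChan ⇑s⁻¹ = Γ := by
  rw [Env.mapChan_mapChan, ← Equiv.Perm.coe_mul, inv_mul_cancel, Equiv.Perm.coe_one,
    Env.mapChan_id]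

theorem Env.mapChan_inv' (s : Equiv.Perm Chan) (Γ : Env 0 0) :
    (Γ.mapChan ⇑s⁻¹).mapChan s = Γ := by
  rw [Env.mapChan_mapChan, ← Equiv.Perm.coe_mul, mul_inv_cancel, Equiv.Perm.coe_one,
    Env.mapChan_id]

theorem Env.mapChan_eq_self {s : Chan → Chan} {Γ : Env 0 0} (h : ∀ c ∈ Γ.dom, s c = c) :
    Γ.mapChan s = Γ := by
  refine Eq.trans (Env.map_congr fun u hu => ?_) Γ.map_id
  rcases u with (c | i) | w
  · simpa [Val.mapChan] using h c hu
  · exact i.elim0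
  · rfl

theorem Env.dom_mapChan (s : Chan → Chan) (Γ : Env 0 0) : (Γ.mapChan s).dom = s '' Γ.dom := by
  ext c
  simp only [Env.dom, Env.mapChan, Set.mem_ofPred_eq, Env.has_map, Set.mem_image]
  constructor
  · rintro ⟨(e | i) | w, h, h'⟩
    · simp only [Sum.map_inl, Val.mapChan, Sum.inl.injEq, Val.chan.injEq] at h'
      exact ⟨e, h, h'⟩
    · exact i.elim0
    · exact w.elim0
  · rintro ⟨e, h, rfl⟩
    exact ⟨_, h, rfl⟩

theorem Env.dom_add (Γ Δ : Env 0 0) : (Γ + Δ).dom = Γ.dom ∪ Δ.dom := by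
  ext c; exact Env.has_add _ _ _

theorem EnvStr.dom_subset {Γ Γ' : Env 0 0} (h : EnvStr Γ Γ') : Γ'.dom ⊆ Γ.dom :=
  fun _ hc => h.mem_fst hc

/-- The permutation fixes every channel in the domain of the environment. -/
def Fixes (s : Equiv.Perm Chan) (Γ : Env 0 0) : Prop := ∀ c ∈ Γ.dom, s c = c

theorem Fixes.one (Γ : Env 0 0) : Fixes 1 Γ := fun _ _ => rfl

theorem Fixes.mul {s t : Equiv.Perm Chan} {Γ : Env 0 0} (hs : Fixes s Γ) (ht : Fixes t Γ) :
    Fixes (s * t) Γ := fun c hc => by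
  rw [Equiv.Perm.mul_apply, ht c hc, hs c hc]

theorem Fixes.inv {s : Equiv.Perm Chan} {Γ : Env 0 0} (hs : Fixes s Γ) : Fixes s⁻¹ Γ :=
  fun c hc => by rw [Equiv.Perm.inv_eq_iff_eq, hs c hc]

theorem Fixes.mono {s : Equiv.Perm Chan} {Γ Γ' : Env 0 0} (hs : Fixes s Γ)
    (h : Γ'.dom ⊆ Γ.dom) : Fixes s Γ' := fun c hc => hs c (h hc)

theorem Fixes.of_add_left {s : Equiv.Perm Chan} {Γ Δ : Env 0 0} (hs : Fixes s (Γ + Δ)) :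
    Fixes s Γ := hs.mono (by rw [Env.dom_add]; exact Set.subset_union_left)

theorem Fixes.of_add_right {s : Equiv.Perm Chan} {Γ Δ : Env 0 0} (hs : Fixes s (Γ + Δ)) :
    Fixes s Δ := hs.mono (by rw [Env.dom_add]; exact Set.subset_union_right)

theorem Typed.mapChan {Γ : Env 0 0} {P : Proc 0 0} (h : Typed Γ P) (s : Chan → Chan) :
    Typed (Γ.mapChan s) (P.mapChan s) :=
  h.rename _ _

theorem Typed.mapChan_eq_self {Γ : Env 0 0} {P : Proc 0 0} (h : Typed Γ P)
    {s : Equiv.Perm Chan} (hs : Fixes s Γ) : P.mapChan s = P := by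
  refine h.rename_eq_self fun u hu => ?_
  cases u with
  | chan c => simpa [Val.mapChan] using hs c hu
  | var i => rfl

theorem Env.Consistent.mapChan {Γ : Env 0 0} (h : Γ.Consistent) (s : Equiv.Perm Chan) :
    (Γ.mapChan s).Consistent :=
  h.map ((Val.mapChan_injective s.injective).sumMap Function.injective_id)

theorem IsConfig.rename {Γ : Env 0 0} {S : Sys} (h : IsConfig Γ S) (s : Equiv.Perm Chan) :
    IsConfig (Γ.mapChan s) (S.rename s) := by
  obtain ⟨h₁, h₂, Θ, h₃, h₄, h₅, h₆⟩ := h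
  refine ⟨?_, ?_, Θ.mapChan s, ?_, h₄.mapChan s, ?_, h₆.mapChan s⟩
  · change ((s '' S.res)ᶜ).Infinite
    rw [← Set.image_compl_eq s.bijective]
    exact h₁.image s.injective.injOn
  · rw [Env.dom_mapChan]
    exact Set.image_mono h₂
  · rw [← Env.mapChan_add]
    exact h₃.mapChan s
  · rw [Env.dom_mapChan]
    exact Set.image_mono h₅

/-- The action of a map of channel names on labels. -/
def Label.mapChan (s : Chan → Chan) : Label → Label
  | .out c k d => .out (s c) k (fun i => s (d i))
  | .inp c k d => .inp (s c) k (fun i => s (d i))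
  | .tau => .tau
  | .env => .env
  | .alloc => .alloc
  | .free c => .free (s c)

theorem Label.mapChan_inv' (s : Equiv.Perm Chan) (μ : Label) :
    (μ.mapChan ⇑s⁻¹).mapChan s = μ := by
  cases μ <;> simp [Label.mapChan]

theorem Decr.mapChan {k : ℕ} {c : Chan} {Us : Fin k → ChTy} {a : Attr} {D : Env 0 0}
    (h : Decr (.chan c) Us a D) (s : Chan → Chan) :
    Decr (.chan (s c)) Us a (D.mapChan s) :=
  h.map (Val.mapChan s) id

/-- Injectivity is essential: allocation asks for a channel outside the resources, and the negative
branch of a conditional for two different channels. -/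
theorem PreStep.rename {Γ Γ' : Env 0 0} {S S' : Sys} {μ : Label} {k : ℤ}
    (h : PreStep Γ S μ k Γ' S') (s : Equiv.Perm Chan) :
    PreStep (Γ.mapChan s) (S.rename s) (μ.mapChan s) k (Γ'.mapChan s) (S'.rename s) := by
  induction h with
  | out hD =>
    rw [Env.mapChan_cons, Env.mapChan_add, Env.mapChan_add, Env.mapChan_list]
    exact .out (hD.mapChan s)
  | @inp Γ D M c k d Us a P hD =>
    rw [Env.mapChan_cons, Env.mapChan_add, Env.mapChan_add, Env.mapChan_list]
    have := PreStep.inp (Γ := Γ.mapChan s) (M := s '' M) (d := fun i => s (d i))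
      (P := P.mapChan s) (hD.mapChan s)
    simp only [Sys.rename, Proc.mapChan_inst]
    have e : (Proc.inp (Val.chan c) k P).mapChan s = .inp (.chan (s c)) k (P.mapChan s) := by
      simp only [Proc.mapChan, Proc.rename, Val.lift_mapChan]
      rfl
    rw [e]
    exact this
  | comL _ _ ih₁ ih₂ => exact .comL ih₁ ih₂
  | comR _ _ ih₁ ih₂ => exact .comR ih₁ ih₂
  | parL _ ih => exact .parL ih
  | parR _ ih => exact .parR ih
  | str h => exact .str (h.map _)
  | @unfold Γ M P =>
    simp only [Sys.rename, Proc.mapChan_unfold]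
    have e : (Proc.fix P).mapChan s = .fix (P.mapChan s) := by
      rw [Proc.mapChan, Proc.rename_fix, liftFin_id]; rfl
    rw [e]
    exact .unfold
  | condThen h => exact .condThen (Set.mem_image_of_mem s h)
  | condElse h h' hne =>
    exact .condElse (Set.mem_image_of_mem s h) (Set.mem_image_of_mem s h')
      (s.injective.ne hne)
  | @alloc Γ M c P h =>
    simp only [Sys.rename, Proc.mapChan_inst, Set.image_insert_eq]
    have e : (Proc.alloc P).mapChan s = .alloc (P.mapChan s) := by
      simp only [Proc.mapChan, Proc.rename, Val.lift_mapChan]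
    rw [e]
    exact .alloc (by simpa [s.injective.mem_set_image] using h)
  | allocE Us h =>
    rw [Env.mapChan_cons]
    simp only [Sys.rename, Set.image_insert_eq]
    exact .allocE Us (by simpa [s.injective.mem_set_image] using h)
  | free h =>
    simp only [Sys.rename, Set.image_sdiff s.injective, Set.image_singleton]
    exact .free (Set.mem_image_of_mem s h)
  | freeE Us h =>
    rw [Env.mapChan_cons]
    simp only [Sys.rename, Set.image_sdiff s.injective, Set.image_singleton]
    exact .freeE Us (Set.mem_image_of_mem s h)

/-! ### Pre-transitions by label -/

/-- An output does not change the resources, consumes one use of the channel, and does not depend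
on the rest of the environment and on the resources. -/
theorem PreStep.out_inv {Γ Γ' : Env 0 0} {S S' : Sys} {c : Chan} {k : ℕ} {d : Fin k → Chan}
    {l : ℤ} (h : PreStep Γ S (.out c k d) l Γ' S') :
    l = 0 ∧ S'.res = S.res ∧
      (∃ (Γ₀ D : Env 0 0) (Us : Fin k → ChTy) (a : Attr), Decr (.chan c) Us a D ∧
        Γ = (Sum.inl (.chan c), .ch Us a) ::ₘ Γ₀ ∧
        Γ' = Γ₀ + D + Env.list (fun i => .chan (d i)) Us) ∧
      ∀ (N : Set Chan) (Γ₀ D : Env 0 0) (Us : Fin k → ChTy) (a : Attr),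
        Decr (.chan c) Us a D →
        PreStep ((Sum.inl (.chan c), .ch Us a) ::ₘ Γ₀) ⟨N, S.proc⟩ (.out c k d) 0
          (Γ₀ + D + Env.list (fun i => .chan (d i)) Us) ⟨N, S'.proc⟩ := by
  generalize hμ : Label.out c k d = μ at h
  induction h with
  | out hD =>
    cases hμ
    exact ⟨rfl, rfl, ⟨_, _, _, _, hD, rfl, rfl⟩, fun N Γ₀ D Us a h => .out h⟩
  | parL _ ih =>
    obtain ⟨h₁, h₂, h₃, h₄⟩ := ih hμ
    exact ⟨h₁, h₂, h₃, fun N Γ₀ D Us a h => .parL (h₄ N Γ₀ D Us a h)⟩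
  | parR _ ih =>
    obtain ⟨h₁, h₂, h₃, h₄⟩ := ih hμ
    exact ⟨h₁, h₂, h₃, fun N Γ₀ D Us a h => .parR (h₄ N Γ₀ D Us a h)⟩
  | _ => cases hμ

/-- The last clause replays the input with other resources and for any observer able to perform it:
the types on a transition belong to the observer, not to the process. -/
theorem PreStep.inp_inv {Γ Γ' : Env 0 0} {S S' : Sys} {c : Chan} {k : ℕ} {d : Fin k → Chan}
    {l : ℤ} (h : PreStep Γ S (.inp c k d) l Γ' S') :
    l = 0 ∧ S'.res = S.res ∧
      (∃ (Γ₀ D : Env 0 0) (Us : Fin k → ChTy) (a : Attr), Decr (.chan c) Us a D ∧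
        Γ = (Sum.inl (.chan c), .ch Us a) ::ₘ (Γ₀ + Env.list (fun i => .chan (d i)) Us) ∧
        Γ' = Γ₀ + D) ∧
      ∀ (N : Set Chan) (Γ₀ D : Env 0 0) (Us : Fin k → ChTy) (a : Attr),
        Decr (.chan c) Us a D →
        PreStep ((Sum.inl (.chan c), .ch Us a) ::ₘ
          (Γ₀ + Env.list (fun i => .chan (d i)) Us)) ⟨N, S.proc⟩ (.inp c k d) 0
          (Γ₀ + D) ⟨N, S'.proc⟩ := by
  generalize hμ : Label.inp c k d = μ at h
  induction h with
  | inp hD =>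
    cases hμ
    exact ⟨rfl, rfl, ⟨_, _, _, _, hD, rfl, rfl⟩, fun N Γ₀ D Us a h => .inp h⟩
  | parL _ ih =>
    obtain ⟨h₁, h₂, h₃, h₄⟩ := ih hμ
    exact ⟨h₁, h₂, h₃, fun N Γ₀ D Us a h => .parL (h₄ N Γ₀ D Us a h)⟩
  | parR _ ih =>
    obtain ⟨h₁, h₂, h₃, h₄⟩ := ih hμ
    exact ⟨h₁, h₂, h₃, fun N Γ₀ D Us a h => .parR (h₄ N Γ₀ D Us a h)⟩
  | _ => cases hμ

/-- Silent moves ignore the observer; even in a communication the environments of the two partners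
are arbitrary. -/
theorem PreStep.tau_inv {Γ Γ' : Env 0 0} {S S' : Sys} {l : ℤ}
    (h : PreStep Γ S .tau l Γ' S') :
    Γ' = Γ ∧ ∀ Γ₀, PreStep Γ₀ S .tau l Γ₀ S' := by
  generalize hμ : Label.tau = μ at h
  induction h with
  | comL h₁ h₂ => exact ⟨rfl, fun _ => .comL h₁ h₂⟩
  | comR h₁ h₂ => exact ⟨rfl, fun _ => .comR h₁ h₂⟩
  | parL _ ih => exact ⟨(ih hμ).1, fun Γ₀ => .parL ((ih hμ).2 Γ₀)⟩
  | parR _ ih => exact ⟨(ih hμ).1, fun Γ₀ => .parR ((ih hμ).2 Γ₀)⟩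
  | unfold => exact ⟨rfl, fun _ => .unfold⟩
  | condThen h => exact ⟨rfl, fun _ => .condThen h⟩
  | condElse h h' hne => exact ⟨rfl, fun _ => .condElse h h' hne⟩
  | alloc h => exact ⟨rfl, fun _ => .alloc h⟩
  | free h => exact ⟨rfl, fun _ => .free h⟩
  | _ => cases hμ

theorem PreStep.env_inv {Γ Γ' : Env 0 0} {S S' : Sys} {l : ℤ}
    (h : PreStep Γ S .env l Γ' S') : l = 0 ∧ S' = S ∧ EnvStr Γ Γ' := by
  generalize hμ : Label.env = μ at h
  induction h with
  | parL _ ih =>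
    obtain ⟨h₁, h₂, h₃⟩ := ih hμ
    cases h₂
    exact ⟨h₁, rfl, h₃⟩
  | parR _ ih =>
    obtain ⟨h₁, h₂, h₃⟩ := ih hμ
    cases h₂
    exact ⟨h₁, rfl, h₃⟩
  | str h => exact ⟨rfl, rfl, h⟩
  | _ => cases hμ

theorem PreStep.alloc_inv {Γ Γ' : Env 0 0} {S S' : Sys} {l : ℤ}
    (h : PreStep Γ S .alloc l Γ' S') :
    l = 1 ∧ ∃ (c : Chan) (k : ℕ) (Us : Fin k → ChTy), c ∉ S.res ∧
      Γ' = (Sum.inl (.chan c), .ch Us (.uniq 0)) ::ₘ Γ ∧ S' = ⟨insert c S.res, S.proc⟩ := by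
  generalize hμ : Label.alloc = μ at h
  induction h with
  | parL _ ih =>
    obtain ⟨h₁, c, k, Us, h₂, h₃, h₄⟩ := ih hμ
    cases h₄
    exact ⟨h₁, c, k, Us, h₂, h₃, rfl⟩
  | parR _ ih =>
    obtain ⟨h₁, c, k, Us, h₂, h₃, h₄⟩ := ih hμ
    cases h₄
    exact ⟨h₁, c, k, Us, h₂, h₃, rfl⟩
  | allocE Us h => exact ⟨rfl, _, _, Us, h, rfl, rfl⟩
  | _ => cases hμ

theorem PreStep.free_inv {Γ Γ' : Env 0 0} {S S' : Sys} {c : Chan} {l : ℤ}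
    (h : PreStep Γ S (.free c) l Γ' S') :
    l = -1 ∧ c ∈ S.res ∧ S' = ⟨S.res \ {c}, S.proc⟩ ∧
      ∃ (k : ℕ) (Us : Fin k → ChTy), Γ = (Sum.inl (.chan c), .ch Us (.uniq 0)) ::ₘ Γ' := by
  generalize hμ : Label.free c = μ at h
  induction h with
  | parL _ ih =>
    obtain ⟨h₁, h₂, h₃, h₄⟩ := ih hμ
    cases h₃
    exact ⟨h₁, h₂, rfl, h₄⟩
  | parR _ ih =>
    obtain ⟨h₁, h₂, h₃, h₄⟩ := ih hμ
    cases h₃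
    exact ⟨h₁, h₂, rfl, h₄⟩
  | freeE Us h =>
    cases hμ
    exact ⟨rfl, h, rfl, _, Us, rfl⟩
  | _ => cases hμ

/-! ### Subject reduction -/

theorem Typed.inst {n m k : ℕ} {Γ : Env n m} {Us : Fin k → ChTy} {P : Proc (n + k) m}
    (h : Typed (Γ.weaken k + Env.list (Val.fresh n) Us) P) (d : Fin k → Val n) :
    Typed (Γ + Env.list d Us) (P.inst d) := by
  have := h.rename (Val.inst d) id
  rw [Env.map_add, Env.map_list, Env.weaken, Env.map_map] at this
  have e : Env.map (Sum.map (Val.inst d) (id : Fin m → Fin m) ∘ Sum.map (Val.weaken k) id) Γ =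
      Γ := by
    refine Eq.trans (Env.map_congr fun u _ => ?_) Γ.map_id
    cases u <;> simp
  rw [e] at this
  simpa [Proc.inst] using this

theorem Typed.inst_alloc {n m k : ℕ} {Γ : Env n m} {Us : Fin k → ChTy} {P : Proc (n + 1) m}
    (h : Typed ((Sum.inl (Val.fresh n (0 : Fin 1)), .ch Us (.uniq 0)) ::ₘ Γ.weaken 1) P)
    (v : Val n) : Typed ((Sum.inl v, .ch Us (.uniq 0)) ::ₘ Γ) (P.inst (fun _ => v)) := by
  have := h.rename (Val.inst fun _ => v) id
  rw [Env.map_cons, Env.weaken, Env.map_map] at this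
  have e : Env.map (Sum.map (Val.inst fun _ => v) (id : Fin m → Fin m) ∘
      Sum.map (Val.weaken 1) id) Γ = Γ := by
    refine Eq.trans (Env.map_congr fun u _ => ?_) Γ.map_id
    cases u <;> simp
  rw [e] at this
  simpa [Proc.inst] using this

/-- The typing of the sender before the step, in the rearranged environment, is kept as well: the
system beside it may move silently between the rearrangement of `Δ` and the output. -/
theorem Typed.out_step {Γ Γ' Δ : Env 0 0} {S S' : Sys} {c : Chan} {k : ℕ} {d : Fin k → Chan}
    {l : ℤ} (h : PreStep Γ S (.out c k d) l Γ' S') (hΔ : Typed Δ S.proc) :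
    ∃ (Δ₀ D : Env 0 0) (Us : Fin k → ChTy) (a : Attr), Decr (.chan c) Us a D ∧
      EnvStr Δ ((Sum.inl (.chan c), .ch Us a) ::ₘ (Δ₀ + Env.list (fun i => .chan (d i)) Us)) ∧
      Typed ((Sum.inl (.chan c), .ch Us a) ::ₘ
        (Δ₀ + Env.list (fun i => .chan (d i)) Us)) S.proc ∧
      Typed (Δ₀ + D) S'.proc := by
  generalize hμ : Label.out c k d = μ at h
  induction h generalizing Δ with
  | out hD =>
    cases hμ
    obtain ⟨Δ₀, D, Us, a, h₁, h₂, h₃⟩ := hΔ.inv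
    exact ⟨Δ₀, D, Us, a, h₂, h₁, .out h₂ h₃, h₃⟩
  | parL _ ih =>
    obtain ⟨Δ₁, Δ₂, h, hP, hQ⟩ := hΔ.inv
    obtain ⟨Δ₀, D, Us, a, h₁, h₂, h₃, h₄⟩ := ih hP hμ
    have e : (Sum.inl (.chan c), .ch Us a) ::ₘ
        (Δ₀ + Δ₂ + Env.list (fun i => .chan (d i)) Us) =
      ((Sum.inl (.chan c), .ch Us a) ::ₘ (Δ₀ + Env.list (fun i => .chan (d i)) Us)) + Δ₂ := by
      simp only [← Multiset.singleton_add]; abel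
    refine ⟨Δ₀ + Δ₂, D, Us, a, h₁, ?_, ?_, ?_⟩
    · rw [e]; exact h.trans (h₂.add_right _)
    · rw [e]; exact h₃.par hQ
    · rw [add_right_comm]; exact h₄.par hQ
  | parR _ ih =>
    obtain ⟨Δ₁, Δ₂, h, hP, hQ⟩ := hΔ.inv
    obtain ⟨Δ₀, D, Us, a, h₁, h₂, h₃, h₄⟩ := ih hQ hμ
    have e : (Sum.inl (.chan c), .ch Us a) ::ₘ
        (Δ₁ + Δ₀ + Env.list (fun i => .chan (d i)) Us) =
      Δ₁ + ((Sum.inl (.chan c), .ch Us a) ::ₘ (Δ₀ + Env.list (fun i => .chan (d i)) Us)) := by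
      simp only [← Multiset.singleton_add]; abel
    refine ⟨Δ₁ + Δ₀, D, Us, a, h₁, ?_, ?_, ?_⟩
    · rw [e]; exact h.trans (h₂.add_left _)
    · rw [e]; exact hP.par h₃
    · rw [add_assoc]; exact hP.par h₄
  | _ => cases hμ

theorem Typed.inp_step {Γ Γ' Δ : Env 0 0} {S S' : Sys} {c : Chan} {k : ℕ} {d : Fin k → Chan}
    {l : ℤ} (h : PreStep Γ S (.inp c k d) l Γ' S') (hΔ : Typed Δ S.proc) :
    ∃ (Δ₀ D : Env 0 0) (Us : Fin k → ChTy) (a : Attr), Decr (.chan c) Us a D ∧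
      EnvStr Δ ((Sum.inl (.chan c), .ch Us a) ::ₘ Δ₀) ∧
      Typed ((Sum.inl (.chan c), .ch Us a) ::ₘ Δ₀) S.proc ∧
      Typed (Δ₀ + D + Env.list (fun i => .chan (d i)) Us) S'.proc := by
  generalize hμ : Label.inp c k d = μ at h
  induction h generalizing Δ with
  | inp hD =>
    cases hμ
    obtain ⟨Δ₀, D, Us, a, h₁, h₂, h₃⟩ := hΔ.inv
    exact ⟨Δ₀, D, Us, a, h₂, h₁, .inp h₂ h₃, h₃.inst _⟩
  | parL _ ih =>
    obtain ⟨Δ₁, Δ₂, h, hP, hQ⟩ := hΔ.inv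
    obtain ⟨Δ₀, D, Us, a, h₁, h₂, h₃, h₄⟩ := ih hP hμ
    refine ⟨Δ₀ + Δ₂, D, Us, a, h₁, ?_, ?_, ?_⟩
    · rw [← Multiset.cons_add]; exact h.trans (h₂.add_right _)
    · rw [← Multiset.cons_add]; exact h₃.par hQ
    · rw [add_right_comm Δ₀, add_right_comm _ Δ₂]; exact h₄.par hQ
  | parR _ ih =>
    obtain ⟨Δ₁, Δ₂, h, hP, hQ⟩ := hΔ.inv
    obtain ⟨Δ₀, D, Us, a, h₁, h₂, h₃, h₄⟩ := ih hQ hμ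
    refine ⟨Δ₁ + Δ₀, D, Us, a, h₁, ?_, ?_, ?_⟩
    · rw [← Multiset.add_cons]; exact h.trans (h₂.add_left _)
    · rw [← Multiset.add_cons]; exact hP.par h₃
    · rw [add_assoc, add_assoc, ← add_assoc Δ₀]; exact hP.par h₄
  | _ => cases hμ

/-- Assumptions before and after a value is sent on a channel. -/
theorem Env.Consistent.exchange {k : ℕ} {Γ₁ Γ₂ D₁ D₂ : Env 0 0} {c : Chan}
    {d : Fin k → Chan} {Us Us' : Fin k → ChTy} {a a' : Attr}
    (h : Env.Consistent
      (((Sum.inl (.chan c), .ch Us a) ::ₘ (Γ₁ + Env.list (fun i => .chan (d i)) Us)) +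
        ((Sum.inl (.chan c), .ch Us' a') ::ₘ Γ₂)))
    (hD₁ : Decr (.chan c) Us a D₁) (hD₂ : Decr (.chan c) Us' a' D₂) :
    EnvStr
      (((Sum.inl (.chan c), .ch Us a) ::ₘ (Γ₁ + Env.list (fun i => .chan (d i)) Us)) +
        ((Sum.inl (.chan c), .ch Us' a') ::ₘ Γ₂))
      ((Γ₁ + D₁) + (Γ₂ + D₂ + Env.list (fun i => .chan (d i)) Us')) := by
  rw [Multiset.cons_add, Multiset.add_cons] at h ⊢
  obtain ⟨hU, hs⟩ := h.use_two hD₁ hD₂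
  refine hs.trans ?_
  have := (EnvStr.list_congr (m := 0) (fun i => .chan (d i)) hU).add_left
    (Γ₁ + D₁ + (Γ₂ + D₂))
  convert this using 1
  · abel
  · abel

/-- The silent moves of a process typed by `Δ` with resources `M`, as seen by its context. -/
inductive TauMove (Δ : Env 0 0) (P : Proc 0 0) (M : Set Chan) : ℤ → Set Chan → Proc 0 0 → Prop
  | internal {P' : Proc 0 0} : Typed Δ P' →
      (∀ N Γ, Δ.dom ⊆ N → PreStep Γ ⟨N, P⟩ .tau 0 Γ ⟨N, P'⟩) → TauMove Δ P M 0 M P'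
  | alloc {P' : Proc 0 0} {c : Chan} {k : ℕ} (Us : Fin k → ChTy) : c ∉ M →
      Typed ((Sum.inl (.chan c), .ch Us (.uniq 0)) ::ₘ Δ) P' →
      (∀ N Γ, c ∉ N → PreStep Γ ⟨N, P⟩ .tau 1 Γ ⟨insert c N, P'⟩) →
      TauMove Δ P M 1 (insert c M) P'
  | free {P' : Proc 0 0} {c : Chan} {k : ℕ} (Us : Fin k → ChTy) {Δ' : Env 0 0} : c ∈ M →
      EnvStr Δ ((Sum.inl (.chan c), .ch Us (.uniq 0)) ::ₘ Δ') →
      Typed ((Sum.inl (.chan c), .ch Us (.uniq 0)) ::ₘ Δ') P → Typed Δ' P' →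
      (∀ N Γ, c ∈ N → PreStep Γ ⟨N, P⟩ .tau (-1) Γ ⟨N \ {c}, P'⟩) →
      TauMove Δ P M (-1) (M \ {c}) P'

theorem TauMove.parL {Δ Δ₁ Δ₂ : Env 0 0} {P P' Q : Proc 0 0} {M M' : Set Chan} {l : ℤ}
    (h : TauMove Δ₁ P M l M' P') (hΔ : EnvStr Δ (Δ₁ + Δ₂)) (hQ : Typed Δ₂ Q) :
    TauMove Δ (.par P Q) M l M' (.par P' Q) := by
  cases h with
  | internal hP' h =>
    refine .internal (.str hΔ (hP'.par hQ)) fun N Γ hN => .parL (h N Γ ?_)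
    refine Set.Subset.trans ?_ (hΔ.dom_subset.trans hN)
    rw [Env.dom_add]
    exact Set.subset_union_left
  | alloc Us hc hP' h =>
    refine .alloc Us hc (.str (hΔ.cons _) ?_) fun N Γ hN => .parL (h N Γ hN)
    rw [← Multiset.cons_add]
    exact hP'.par hQ
  | free Us hc hs hP hP' h =>
    refine .free Us hc (hΔ.trans ?_) ?_ (hP'.par hQ) fun N Γ hN => .parL (h N Γ hN)
    · rw [← Multiset.cons_add]
      exact hs.add_right _
    · rw [← Multiset.cons_add]
      exact hP.par hQ

theorem TauMove.parR {Δ Δ₁ Δ₂ : Env 0 0} {P P' Q : Proc 0 0} {M M' : Set Chan} {l : ℤ}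
    (h : TauMove Δ₂ P M l M' P') (hΔ : EnvStr Δ (Δ₁ + Δ₂)) (hQ : Typed Δ₁ Q) :
    TauMove Δ (.par Q P) M l M' (.par Q P') := by
  cases h with
  | internal hP' h =>
    refine .internal (.str hΔ (hQ.par hP')) fun N Γ hN => .parR (h N Γ ?_)
    refine Set.Subset.trans ?_ (hΔ.dom_subset.trans hN)
    rw [Env.dom_add]
    exact Set.subset_union_right
  | alloc Us hc hP' h =>
    refine .alloc Us hc (.str (hΔ.cons _) ?_) fun N Γ hN => .parR (h N Γ hN)
    rw [← Multiset.add_cons]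
    exact hQ.par hP'
  | free Us hc hs hP hP' h =>
    refine .free Us hc (hΔ.trans ?_) ?_ (hQ.par hP') fun N Γ hN => .parR (h N Γ hN)
    · rw [← Multiset.add_cons]
      exact hs.add_left _
    · rw [← Multiset.add_cons]
      exact hQ.par hP

/-- Consistency is needed for communication only, where the object types of sender and receiver have
to agree. Recording how the step depends on the resources allows replaying it beside another system.
-/
theorem Typed.tau_step {Γ Γ' Δ : Env 0 0} {S S' : Sys} {l : ℤ}
    (h : PreStep Γ S .tau l Γ' S') (hΔ : Typed Δ S.proc) (hc : Δ.Consistent) :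
    TauMove Δ S.proc S.res l S'.res S'.proc := by
  generalize hμ : Label.tau = μ at h
  induction h generalizing Δ with
  | comL hP hQ =>
    obtain ⟨Δ₁, Δ₂, h, hP', hQ'⟩ := hΔ.inv
    obtain ⟨Γ₁, D₁, Us, a, h₁, h₂, -, h₃⟩ := hP'.out_step hP
    obtain ⟨Γ₂, D₂, Us', a', h₁', h₂', -, h₃'⟩ := hQ'.inp_step hQ
    have hs := h.trans (h₂.add h₂')
    refine .internal (.str (hs.trans ((hc.mono hs).exchange h₁ h₁')) (h₃.par h₃'))
      fun N Γ _ => .comL (hP.out_inv.2.2.2 N Γ₁ D₁ Us a h₁) (hQ.inp_inv.2.2.2 N Γ₂ D₂ Us' a' h₁')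
  | comR hP hQ =>
    obtain ⟨Δ₁, Δ₂, h, hP', hQ'⟩ := hΔ.inv
    obtain ⟨Γ₁, D₁, Us, a, h₁, h₂, -, h₃⟩ := hP'.inp_step hP
    obtain ⟨Γ₂, D₂, Us', a', h₁', h₂', -, h₃'⟩ := hQ'.out_step hQ
    have hs := h.trans (h₂.add h₂')
    -- The exchange is stated with the sender first, so the environments are swapped here and
    -- swapped back afterwards.
    rw [add_comm] at hs
    have hs' := hs.trans ((hc.mono hs).exchange h₁' h₁)
    rw [add_comm] at hs'
    refine .internal (.str hs' (h₃.par h₃'))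
      fun N Γ _ => .comR (hP.inp_inv.2.2.2 N Γ₁ D₁ Us a h₁) (hQ.out_inv.2.2.2 N Γ₂ D₂ Us' a' h₁')
  | parL _ ih =>
    obtain ⟨Δ₁, Δ₂, h, hP, hQ⟩ := hΔ.inv
    exact (ih hP ((hc.mono h).mono (.of_le (Multiset.le_add_right _ _))) hμ).parL h hQ
  | parR _ ih =>
    obtain ⟨Δ₁, Δ₂, h, hP, hQ⟩ := hΔ.inv
    exact (ih hQ ((hc.mono h).mono (.of_le (Multiset.le_add_left _ _))) hμ).parR h hP
  | unfold =>
    obtain ⟨Δ', h, hu, hP⟩ := hΔ.inv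
    exact .internal (.str h (hP.unfold hu)) fun _ _ _ => .unfold
  | condThen _ =>
    obtain ⟨h₁, -, h₂, -⟩ := hΔ.inv
    exact .internal h₂ fun N Γ hN => .condThen (hN h₁)
  | condElse _ _ hne =>
    obtain ⟨h₁, h₂, -, h₃⟩ := hΔ.inv
    exact .internal h₃ fun N Γ hN => .condElse (hN h₁) (hN h₂) hne
  | alloc hc' =>
    obtain ⟨Δ', k, Us, h, hP⟩ := hΔ.inv
    exact .alloc Us hc' (.str (h.cons _) (hP.inst_alloc _)) fun N Γ hN => .alloc hN
  | free hc' =>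
    obtain ⟨Δ', k, Us, h, hP⟩ := hΔ.inv
    exact .free Us hc' h (.free Us hP) hP fun N Γ hN => .free hN
  | _ => cases hμ

/-! ### Weak transitions -/

theorem Step.rename {Γ Γ' : Env 0 0} {S S' : Sys} {μ : Label} {k : ℤ}
    (h : Step Γ S μ k Γ' S') (s : Equiv.Perm Chan) :
    Step (Γ.mapChan s) (S.rename s) (μ.mapChan s) k (Γ'.mapChan s) (S'.rename s) := by
  obtain ⟨t, ht, h⟩ := h
  -- The conjugate of `t` fixes the renamed domain and sends the renamed source where `s` after `t`
  -- sends the original one.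
  refine ⟨s * t * s⁻¹, fun c hc => ?_, ?_⟩
  · rw [Env.dom_mapChan] at hc
    obtain ⟨e, he, rfl⟩ := hc
    simp [ht e he]
  · have := h.rename s
    rw [Sys.rename_rename] at this ⊢
    simpa using this

theorem Weak.rename {Γ Γ' : Env 0 0} {S S' : Sys} {μ : Label} {k : ℤ}
    (h : Weak Γ S μ k Γ' S') (s : Equiv.Perm Chan) :
    Weak (Γ.mapChan s) (S.rename s) (μ.mapChan s) k (Γ'.mapChan s) (S'.rename s) := by
  induction h with
  | tra h => exact .tra (h.rename s)
  | left h _ ih => exact .left (h.rename s) ih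
  | right _ h ih => exact .right ih (h.rename s)

theorem WeakHat.rename {Γ Γ' : Env 0 0} {S S' : Sys} {μ : Label} {k : ℤ}
    (h : WeakHat Γ S μ k Γ' S') (s : Equiv.Perm Chan) :
    WeakHat (Γ.mapChan s) (S.rename s) (μ.mapChan s) k (Γ'.mapChan s) (S'.rename s) := by
  rcases h with h | ⟨rfl, rfl, rfl, rfl⟩
  · exact .inl (h.rename s)
  · exact .inr ⟨rfl, rfl, rfl, rfl⟩

theorem PreStep.step {Γ Γ' : Env 0 0} {S S' : Sys} {μ : Label} {k : ℤ}
    (h : PreStep Γ S μ k Γ' S') : Step Γ S μ k Γ' S' :=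
  ⟨1, Fixes.one Γ, by rwa [Sys.rename_one]⟩

/-- Sequences of silent pre-transitions and of renamings that fix the channels known to the
observer, with their total cost. -/
inductive Run (Γ : Env 0 0) : Sys → ℤ → Sys → Prop
  | refl (S : Sys) : Run Γ S 0 S
  | perm {S S' : Sys} {k : ℤ} {s : Equiv.Perm Chan} : Run Γ S k S' → Fixes s Γ →
      Run Γ S k (S'.rename s)
  | tau {S S' S'' : Sys} {k l : ℤ} : Run Γ S k S' → PreStep Γ S' .tau l Γ S'' →
      Run Γ S (k + l) S''

theorem Run.trans {Γ : Env 0 0} {S S' S'' : Sys} {k l : ℤ} (h : Run Γ S k S')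
    (h' : Run Γ S' l S'') : Run Γ S (k + l) S'' := by
  induction h' with
  | refl => simpa using h
  | perm _ hs ih => exact ih.perm hs
  | tau _ ht ih => rw [← add_assoc]; exact ih.tau ht

theorem Step.run {Γ Γ' : Env 0 0} {S S' : Sys} {k : ℤ} (h : Step Γ S .tau k Γ' S') :
    Γ' = Γ ∧ Run Γ S k S' := by
  obtain ⟨s, hs, h⟩ := h
  obtain ⟨rfl, h'⟩ := h.tau_inv
  exact ⟨rfl, by simpa using ((Run.refl S).perm hs).tau h⟩

/-- Detaching the renamings hidden in transitions isolates the labelled pre-transition, which can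
then be replaced by a different one. -/
theorem Weak.decompose {Γ Γ' : Env 0 0} {S S' : Sys} {μ : Label} {k : ℤ}
    (h : Weak Γ S μ k Γ' S') :
    ∃ (S₁ S₂ : Sys) (k₁ k₂ k₃ : ℤ), Run Γ S k₁ S₁ ∧ PreStep Γ S₁ μ k₂ Γ' S₂ ∧
      Run Γ' S₂ k₃ S' ∧ k = k₁ + k₂ + k₃ := by
  induction h with
  | tra h =>
    obtain ⟨s, hs, h⟩ := h
    exact ⟨_, _, 0, _, 0, (Run.refl _).perm hs, h, .refl _, by ring⟩
  | left h _ ih =>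
    obtain ⟨rfl, h⟩ := h.run
    obtain ⟨S₁, S₂, k₁, k₂, k₃, h₁, h₂, h₃, rfl⟩ := ih
    exact ⟨S₁, S₂, _, k₂, k₃, h.trans h₁, h₂, h₃, by ring⟩
  | right _ h ih =>
    obtain ⟨rfl, h⟩ := h.run
    obtain ⟨S₁, S₂, k₁, k₂, k₃, h₁, h₂, h₃, rfl⟩ := ih
    exact ⟨S₁, S₂, k₁, k₂, _, h₁, h₂, h₃.trans h, by ring⟩

/-- A weak transition contains at least one transition, and the first one begins with a renaming
that can absorb `s`. -/
theorem Weak.of_rename {Γ Γ' : Env 0 0} {S S' : Sys} {μ : Label} {k : ℤ}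
    {s : Equiv.Perm Chan} (hs : Fixes s Γ) (h : Weak Γ (S.rename s) μ k Γ' S') :
    Weak Γ S μ k Γ' S' := by
  have key : ∀ {μ k Γ' S'}, Step Γ (S.rename s) μ k Γ' S' → Step Γ S μ k Γ' S' := by
    rintro μ k Γ' S' ⟨t, ht, h⟩
    exact ⟨t * s, Fixes.mul ht hs, by rwa [← Sys.rename_rename]⟩
  generalize hT : S.rename s = T at h
  induction h with
  | tra h => subst hT; exact .tra (key h)
  | left h h' _ => subst hT; exact .left (key h) h'
  | right _ h ih => exact .right (ih hs key hT) h

theorem Run.weak {Γ Γ' : Env 0 0} {S S₁ S' : Sys} {μ : Label} {k l : ℤ} (h : Run Γ S k S₁)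
    (h' : Weak Γ S₁ μ l Γ' S') : Weak Γ S μ (k + l) Γ' S' := by
  induction h generalizing l with
  | refl => simpa using h'
  | perm _ hs ih => exact ih (h'.of_rename hs)
  | tau _ ht ih => rw [add_assoc]; exact ih (.left ht.step h')

/-- Weak transitions for matching, up to a final renaming that fixes the channels known to the
observer. -/
def Matches (Γ : Env 0 0) (S : Sys) (μ : Label) (k : ℤ) (Γ' : Env 0 0) (S' : Sys) : Prop :=
  ∃ (s : Equiv.Perm Chan) (T : Sys), Fixes s Γ' ∧ WeakHat Γ S μ k Γ' T ∧ S' = T.rename s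

/-- A pending final renaming is absorbed by the next silent transition, or stays pending if the run
makes no further transition. -/
theorem Matches.run {Γ Γ' : Env 0 0} {S S₁ S' : Sys} {μ : Label} {k l : ℤ}
    (h : Matches Γ S μ k Γ' S₁) (h' : Run Γ' S₁ l S') : Matches Γ S μ (k + l) Γ' S' := by
  induction h' with
  | refl => simpa using h
  | perm _ ht ih =>
    obtain ⟨s, T, hs, hT, rfl⟩ := ih
    exact ⟨_, T, ht.mul hs, hT, Sys.rename_rename _ _ _⟩
  | tau _ ht ih =>
    obtain ⟨s, T, hs, hT, rfl⟩ := ih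
    refine ⟨1, _, .one _, .inl ?_, (Sys.rename_one _).symm⟩
    rw [← add_assoc]
    rcases hT with hT | ⟨rfl, h0, rfl, rfl⟩
    · exact .right hT ⟨s, hs, ht⟩
    · rw [h0, zero_add]
      exact .tra ⟨s, hs, ht⟩

theorem Run.matches {Γ : Env 0 0} {S S' : Sys} {k : ℤ} (h : Run Γ S k S') :
    Matches Γ S .tau k Γ S' := by
  have : Matches Γ S .tau 0 Γ S :=
    ⟨1, S, .one _, .inr ⟨rfl, rfl, rfl, rfl⟩, (Sys.rename_one _).symm⟩
  simpa using this.run h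

theorem PreStep.matches {Γ Γ' : Env 0 0} {S S₁ S₂ S' : Sys} {μ : Label} {k₁ k₂ k₃ : ℤ}
    (h₂ : PreStep Γ S₁ μ k₂ Γ' S₂) (h₁ : Run Γ S k₁ S₁) (h₃ : Run Γ' S₂ k₃ S') :
    Matches Γ S μ (k₁ + k₂ + k₃) Γ' S' := by
  have : Matches Γ S μ (k₁ + k₂) Γ' S₂ :=
    ⟨1, S₂, .one _, .inl (h₁.weak (.tra h₂.step)), (Sys.rename_one _).symm⟩
  exact this.run h₃

/-! ### Processes in a parallel context -/

/-- `P` in parallel with `R`, to the right of `P` if `b` holds and to its left otherwise. -/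
def Proc.beside (b : Bool) (P R : Proc 0 0) : Proc 0 0 :=
  if b then .par P R else .par R P

/-- A system in parallel with a process. -/
def Sys.beside (b : Bool) (S : Sys) (R : Proc 0 0) : Sys := ⟨S.res, S.proc.beside b R⟩

theorem Sys.rename_beside (b : Bool) (S : Sys) (R : Proc 0 0) (s : Equiv.Perm Chan) :
    (S.beside b R).rename s = (S.rename s).beside b (R.mapChan s) := by
  cases b <;> rfl

theorem PreStep.besideL {Γ Γ' : Env 0 0} {S S' : Sys} {μ : Label} {k : ℤ} (b : Bool)
    (h : PreStep Γ S μ k Γ' S') (R : Proc 0 0) :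
    PreStep Γ (S.beside b R) μ k Γ' (S'.beside b R) := by
  cases b
  · exact .parR h
  · exact .parL h

theorem PreStep.besideR {Γ Γ' : Env 0 0} {M M' : Set Chan} {R R' : Proc 0 0} {μ : Label}
    {k : ℤ} (b : Bool) (h : PreStep Γ ⟨M, R⟩ μ k Γ' ⟨M', R'⟩) (P : Proc 0 0) :
    PreStep Γ (Sys.beside b ⟨M, P⟩ R) μ k Γ' (Sys.beside b ⟨M', P⟩ R') := by
  cases b
  · exact .parL h
  · exact .parR h

theorem PreStep.beside_out_inp {Γ Γ₁ Γ₁' Γ₂ Γ₂' : Env 0 0} {M : Set Chan} {c : Chan}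
    {k : ℕ} {d : Fin k → Chan} {P P' R R' : Proc 0 0} (b : Bool)
    (h₁ : PreStep Γ₁ ⟨M, P⟩ (.out c k d) 0 Γ₁' ⟨M, P'⟩)
    (h₂ : PreStep Γ₂ ⟨M, R⟩ (.inp c k d) 0 Γ₂' ⟨M, R'⟩) :
    PreStep Γ (Sys.beside b ⟨M, P⟩ R) .tau 0 Γ (Sys.beside b ⟨M, P'⟩ R') := by
  cases b
  · exact .comR h₂ h₁
  · exact .comL h₁ h₂

theorem PreStep.beside_inp_out {Γ Γ₁ Γ₁' Γ₂ Γ₂' : Env 0 0} {M : Set Chan} {c : Chan}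
    {k : ℕ} {d : Fin k → Chan} {P P' R R' : Proc 0 0} (b : Bool)
    (h₁ : PreStep Γ₁ ⟨M, P⟩ (.inp c k d) 0 Γ₁' ⟨M, P'⟩)
    (h₂ : PreStep Γ₂ ⟨M, R⟩ (.out c k d) 0 Γ₂' ⟨M, R'⟩) :
    PreStep Γ (Sys.beside b ⟨M, P⟩ R) .tau 0 Γ (Sys.beside b ⟨M, P'⟩ R') := by
  cases b
  · exact .comL h₂ h₁
  · exact .comR h₁ h₂

/-- Either component moves alone or the two communicate. Moves of the observer are credited to `S`
when they are derived for the whole composition directly. -/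
theorem PreStep.beside_inv {Γ Γ' : Env 0 0} {S S' : Sys} {R : Proc 0 0} {μ : Label} {k : ℤ}
    {b : Bool} (h : PreStep Γ (S.beside b R) μ k Γ' S') :
    (∃ S₁, S' = S₁.beside b R ∧ PreStep Γ S μ k Γ' S₁) ∨
    (∃ M R', S' = Sys.beside b ⟨M, S.proc⟩ R' ∧ PreStep Γ ⟨S.res, R⟩ μ k Γ' ⟨M, R'⟩) ∨
    (μ = .tau ∧ k = 0 ∧ Γ' = Γ ∧
      ∃ (c : Chan) (n : ℕ) (d : Fin n → Chan) (P' R' : Proc 0 0) (Γ₁ Γ₁' Γ₂ Γ₂' : Env 0 0),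
        S' = Sys.beside b ⟨S.res, P'⟩ R' ∧
        (PreStep Γ₁ S (.out c n d) 0 Γ₁' ⟨S.res, P'⟩ ∧
            PreStep Γ₂ ⟨S.res, R⟩ (.inp c n d) 0 Γ₂' ⟨S.res, R'⟩ ∨
          PreStep Γ₁ S (.inp c n d) 0 Γ₁' ⟨S.res, P'⟩ ∧
            PreStep Γ₂ ⟨S.res, R⟩ (.out c n d) 0 Γ₂' ⟨S.res, R'⟩)) := by
  obtain ⟨M, P⟩ := S
  cases b
  · generalize hS : Sys.beside false ⟨M, P⟩ R = T at h
    cases h with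
    | comL h₁ h₂ =>
      cases hS
      exact .inr (.inr ⟨rfl, rfl, rfl, _, _, _, _, _, _, _, _, _, rfl, .inr ⟨h₂, h₁⟩⟩)
    | comR h₁ h₂ =>
      cases hS
      exact .inr (.inr ⟨rfl, rfl, rfl, _, _, _, _, _, _, _, _, _, rfl, .inl ⟨h₂, h₁⟩⟩)
    | parL h => cases hS; exact .inr (.inl ⟨_, _, rfl, h⟩)
    | parR h => cases hS; exact .inl ⟨⟨_, _⟩, rfl, h⟩
    | str h => cases hS; exact .inl ⟨_, rfl, .str h⟩
    | allocE Us h => cases hS; exact .inl ⟨_, rfl, .allocE Us h⟩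
    | freeE Us h => cases hS; exact .inl ⟨_, rfl, .freeE Us h⟩
    | _ => cases hS
  · generalize hS : Sys.beside true ⟨M, P⟩ R = T at h
    cases h with
    | comL h₁ h₂ =>
      cases hS
      exact .inr (.inr ⟨rfl, rfl, rfl, _, _, _, _, _, _, _, _, _, rfl, .inl ⟨h₁, h₂⟩⟩)
    | comR h₁ h₂ =>
      cases hS
      exact .inr (.inr ⟨rfl, rfl, rfl, _, _, _, _, _, _, _, _, _, rfl, .inr ⟨h₁, h₂⟩⟩)
    | parR h => cases hS; exact .inr (.inl ⟨_, _, rfl, h⟩)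
    | parL h => cases hS; exact .inl ⟨⟨_, _⟩, rfl, h⟩
    | str h => cases hS; exact .inl ⟨_, rfl, .str h⟩
    | allocE Us h => cases hS; exact .inl ⟨_, rfl, .allocE Us h⟩
    | freeE Us h => cases hS; exact .inl ⟨_, rfl, .freeE Us h⟩
    | _ => cases hS

/-! ### Transitions, runs and configurations when `Δ` moves between the observer and the context. -/

theorem PreStep.add_right {Γ Γ' : Env 0 0} {S S' : Sys} {μ : Label} {k : ℤ}
    (h : PreStep Γ S μ k Γ' S') (Δ : Env 0 0) : PreStep (Γ + Δ) S μ k (Γ' + Δ) S' := by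
  induction h with
  | out hD =>
    rw [Multiset.cons_add, add_right_comm _ _ Δ, add_right_comm _ _ Δ]
    exact .out hD
  | inp hD =>
    rw [Multiset.cons_add, add_right_comm _ _ Δ, add_right_comm _ _ Δ]
    exact .inp hD
  | comL h₁ h₂ _ _ => exact .comL h₁ h₂
  | comR h₁ h₂ _ _ => exact .comR h₁ h₂
  | parL _ ih => exact .parL ih
  | parR _ ih => exact .parR ih
  | str h => exact .str (h.add_right Δ)
  | unfold => exact .unfold
  | condThen h => exact .condThen h
  | condElse h h' hne => exact .condElse h h' hne
  | alloc h => exact .alloc h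
  | allocE Us h => rw [Multiset.cons_add]; exact .allocE Us h
  | free h => exact .free h
  | freeE Us h => rw [Multiset.cons_add]; exact .freeE Us h

/-- A pre-transition of `T` with an observer that has further assumptions `Δ` can be done without
them if the label and the change of the observer are possible for some system. -/
theorem PreStep.of_add_right {Γ Γ' Δ : Env 0 0} {S S' T T' : Sys} {μ : Label} {k l : ℤ}
    (h : PreStep Γ S μ k Γ' S') (h' : PreStep (Γ + Δ) T μ l (Γ' + Δ) T') :
    PreStep Γ T μ l Γ' T' := by
  cases μ with
  | out c n d =>
    -- The permission for `c` is taken from `h`, because `h'` could have consumed one in `Δ`. The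
    -- output of `T` is then replayed with it.
    obtain ⟨-, -, ⟨Γ₀, D, Us, a, hD, rfl, rfl⟩, -⟩ := h.out_inv
    obtain ⟨rfl, hr, -, h''⟩ := h'.out_inv
    have := h'' T.res Γ₀ D Us a hD
    rw [← hr] at this
    nth_rw 1 [hr] at this
    exact this
  | inp c n d =>
    obtain ⟨-, -, ⟨Γ₀, D, Us, a, hD, rfl, rfl⟩, -⟩ := h.inp_inv
    obtain ⟨rfl, hr, -, h''⟩ := h'.inp_inv
    have := h'' T.res Γ₀ D Us a hD
    rw [← hr] at this
    nth_rw 1 [hr] at this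
    exact this
  | tau =>
    obtain ⟨rfl, -⟩ := h.tau_inv
    exact h'.tau_inv.2 _
  | env =>
    obtain ⟨-, -, hs⟩ := h.env_inv
    obtain ⟨rfl, rfl, -⟩ := h'.env_inv
    exact .str hs
  | alloc =>
    obtain ⟨rfl, c, n, Us, hc, he, rfl⟩ := h'.alloc_inv
    rw [← Multiset.cons_add] at he
    rw [add_right_cancel he]
    exact .allocE Us hc
  | free c =>
    obtain ⟨rfl, hc, rfl, n, Us, he⟩ := h'.free_inv
    rw [← Multiset.cons_add] at he
    rw [add_right_cancel he]
    exact .freeE Us hc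

/-- The renamings in the run fix the channels of `Δ`, and all channels of `R` are among these; hence
`R` is unchanged throughout. -/
theorem Run.beside {Γ Δ : Env 0 0} {S S' : Sys} {k : ℤ} (h : Run (Γ + Δ) S k S')
    {R : Proc 0 0} (hR : Typed Δ R) (b : Bool) :
    Run Γ (S.beside b R) k (S'.beside b R) := by
  induction h with
  | refl => exact .refl _
  | perm _ hs ih =>
    have := ih.perm hs.of_add_left
    rwa [Sys.rename_beside, hR.mapChan_eq_self hs.of_add_right] at this
  | tau _ ht ih => exact ih.tau ((ht.tau_inv.2 Γ).besideL b R)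

/-- The assumptions `Δ` change sides: they leave the observer and join the environment that types
the process, with the same total. -/
theorem IsConfig.beside {Γ Δ : Env 0 0} {S : Sys} (h : IsConfig (Γ + Δ) S) {R : Proc 0 0}
    (hR : Typed Δ R) (b : Bool) : IsConfig Γ (S.beside b R) := by
  obtain ⟨h₁, h₂, Θ, h₃, h₄, h₅, h₆⟩ := h
  rw [Env.dom_add, Set.union_subset_iff] at h₂
  refine ⟨h₁, h₂.1, Θ + Δ, ?_, ?_, ?_, ?_⟩
  · rwa [add_comm Θ, ← add_assoc]
  · cases b
    · rw [add_comm]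
      exact hR.par h₄
    · exact h₄.par hR
  · rw [Env.dom_add]
    exact Set.union_subset h₅ h₂.2
  · refine h₃.mono (.of_le ?_)
    rw [add_assoc, add_comm Δ]
    exact Multiset.le_add_left _ _

theorem IsConfig.consistent {Γ : Env 0 0} {S : Sys} (h : IsConfig Γ S) : Γ.Consistent := by
  obtain ⟨-, -, Θ, h, -⟩ := h
  exact h.mono (.of_le (Multiset.le_add_right _ _))

/-! ### Simulations -/

/-- Families of relations, indexed by an observer and an integer credit and closed under
renaming, such that the transitions of the left system are matched by the right system, the cost of
the match being added to the credit and the cost of the transition being subtracted. -/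
structure IsSim (X : Env 0 0 → ℤ → Sys → Sys → Prop) : Prop where
  config_left {Γ z S T} : X Γ z S T → IsConfig Γ S
  config_right {Γ z S T} : X Γ z S T → IsConfig Γ T
  sim {Γ z S T μ k Γ' S'} : X Γ z S T → Step Γ S μ k Γ' S' →
    ∃ l T', WeakHat Γ T μ l Γ' T' ∧ X Γ' (z + l - k) S' T'
  rename {Γ z S T} (s : Equiv.Perm Chan) : X Γ z S T →
    X (Γ.mapChan s) z (S.rename s) (T.rename s)

/-- A visible label excludes the empty match, so the answer contains a pre-transition with this
label between two silent runs. -/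
theorem IsSim.visible {X : Env 0 0 → ℤ → Sys → Sys → Prop} (hX : IsSim X) {Γ Γ' : Env 0 0}
    {z k : ℤ} {S T S' : Sys} {μ : Label} (h : X Γ z S T) (hμ : μ ≠ .tau)
    (hs : PreStep Γ S μ k Γ' S') :
    ∃ (l₁ l₂ l₃ : ℤ) (T₁ T₂ T₃ : Sys), Run Γ T l₁ T₁ ∧ PreStep Γ T₁ μ l₂ Γ' T₂ ∧
      Run Γ' T₂ l₃ T₃ ∧ X Γ' (z + (l₁ + l₂ + l₃) - k) S' T₃ := by
  obtain ⟨l, T', hT, h'⟩ := hX.sim h hs.step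
  rcases hT with hT | ⟨h₀, -⟩
  · obtain ⟨T₁, T₂, l₁, l₂, l₃, h₁, h₂, h₃, rfl⟩ := hT.decompose
    exact ⟨l₁, l₂, l₃, T₁, T₂, T', h₁, h₂, h₃, h'⟩
  · exact absurd h₀ hμ

/-- The observer may rearrange its assumptions at any time while the answering system only moves
silently. The run is cut at the rearrangement, since its two parts have different observers. -/
theorem IsSim.env {X : Env 0 0 → ℤ → Sys → Sys → Prop} (hX : IsSim X) {Γ Γ' : Env 0 0}
    {z : ℤ} {S T : Sys} (h : X Γ z S T) (hs : EnvStr Γ Γ') :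
    ∃ (l₁ l₂ : ℤ) (T₁ T₂ : Sys), Run Γ T l₁ T₁ ∧ Run Γ' T₁ l₂ T₂ ∧
      X Γ' (z + (l₁ + l₂)) S T₂ := by
  obtain ⟨l₁, l₂, l₃, T₁, T₂, T₃, h₁, h₂, h₃, h₄⟩ :=
    hX.visible h (by simp) (PreStep.str (S := S) hs)
  obtain ⟨rfl, rfl, -⟩ := h₂.env_inv
  exact ⟨l₁, l₃, _, T₃, h₁, h₃, by simpa using h₄⟩

/-- The closure of a family of relations under parallel composition with processes typed by a part
of the observer, and under renaming of the channels unknown to the rest. -/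
def Beside (b : Bool) (X : Env 0 0 → ℤ → Sys → Sys → Prop) (Γ : Env 0 0) (z : ℤ) (S T : Sys) :
    Prop :=
  ∃ (Δ : Env 0 0) (S₀ T₀ : Sys) (R : Proc 0 0) (s t : Equiv.Perm Chan), Fixes s Γ ∧ Fixes t Γ ∧
    X (Γ + Δ) z S₀ T₀ ∧ Typed Δ R ∧ S = (S₀.beside b R).rename s ∧ T = (T₀.beside b R).rename t

theorem Matches.beside {b : Bool} {X : Env 0 0 → ℤ → Sys → Sys → Prop} {Γ Γ' Δ : Env 0 0}
    {S S' T' : Sys} {R : Proc 0 0} {μ : Label} {l z : ℤ}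
    (h : Matches Γ S μ l Γ' (T'.beside b R)) (hX : X (Γ' + Δ) z S' T') (hR : Typed Δ R) :
    ∃ T, WeakHat Γ S μ l Γ' T ∧ Beside b X Γ' z (S'.beside b R) T := by
  obtain ⟨s, T, hs, hT, he⟩ := h
  refine ⟨T, hT, Δ, S', T', R, 1, s⁻¹, .one _, hs.inv, hX, hR, (Sys.rename_one _).symm, ?_⟩
  rw [he, Sys.rename_inv]

section

variable {X : Env 0 0 → ℤ → Sys → Sys → Prop} {b : Bool} {Γ Γ' Δ : Env 0 0} {z k : ℤ}
  {S T S' : Sys} {R : Proc 0 0} {μ : Label}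

theorem IsSim.beside_left (hX : IsSim X) (h : X (Γ + Δ) z S T) (hR : Typed Δ R)
    (hs : PreStep Γ S μ k Γ' S') :
    ∃ l T', WeakHat Γ (T.beside b R) μ l Γ' T' ∧
      Beside b X Γ' (z + l - k) (S'.beside b R) T' := by
  obtain ⟨l, T', hT, h'⟩ := hX.sim h (hs.add_right Δ).step
  refine ⟨l, Matches.beside ?_ h' hR⟩
  rcases hT with hT | ⟨rfl, rfl, he, rfl⟩
  · obtain ⟨T₁, T₂, l₁, l₂, l₃, h₁, h₂, h₃, rfl⟩ := hT.decompose
    exact ((hs.of_add_right h₂).besideL b R).matches (h₁.beside hR b) (h₃.beside hR b)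
  · rw [add_right_cancel he]
    exact (Run.refl _).matches

theorem IsSim.beside_out (hX : IsSim X) (h : X (Γ + Δ) z S T) (hR : Typed Δ R) {c : Chan}
    {n : ℕ} {d : Fin n → Chan} {M : Set Chan} {R' : Proc 0 0}
    (hs : PreStep Γ ⟨S.res, R⟩ (.out c n d) k Γ' ⟨M, R'⟩) :
    ∃ l T', WeakHat Γ (T.beside b R) (.out c n d) l Γ' T' ∧
      Beside b X Γ' (z + l - k) (Sys.beside b ⟨M, S.proc⟩ R') T' := by
  obtain ⟨rfl, rfl, ⟨Γ₀, D, Us, a, hD, rfl, rfl⟩, hr⟩ := hs.out_inv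
  obtain ⟨Δ₀, D', Us', a', hD', hs₁, -, hR'⟩ := hR.out_step hs
  -- `R` is the sender and the visible observer the receiver, so the types of the sent channels pass
  -- from `Δ` to `Γ`; to the joint observer this is a structural step.
  have e := hs₁.add_left ((Sum.inl (.chan c), .ch Us a) ::ₘ Γ₀)
  have hc := (hX.config_left h).consistent.mono e
  rw [add_comm] at hc
  have e' := hc.exchange hD' hD
  rw [add_comm, add_comm (Δ₀ + D')] at e'
  obtain ⟨l₁, l₂, T₁, T₂, h₁, h₂, h₃⟩ := hX.env h (e.trans e')
  refine ⟨l₁ + 0 + l₂, Matches.beside ?_ (by simpa using h₃) hR'⟩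
  exact ((hr T₁.res Γ₀ D Us a hD).besideR b T₁.proc).matches (h₁.beside hR b)
    (h₂.beside hR' b)

theorem IsSim.beside_inp (hX : IsSim X) (h : X (Γ + Δ) z S T) (hR : Typed Δ R) {c : Chan}
    {n : ℕ} {d : Fin n → Chan} {M : Set Chan} {R' : Proc 0 0}
    (hs : PreStep Γ ⟨S.res, R⟩ (.inp c n d) k Γ' ⟨M, R'⟩) :
    ∃ l T', WeakHat Γ (T.beside b R) (.inp c n d) l Γ' T' ∧
      Beside b X Γ' (z + l - k) (Sys.beside b ⟨M, S.proc⟩ R') T' := by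
  obtain ⟨rfl, rfl, ⟨Γ₀, D, Us, a, hD, rfl, rfl⟩, hr⟩ := hs.inp_inv
  obtain ⟨Δ₀, D', Us', a', hD', hs₁, -, hR'⟩ := hR.inp_step hs
  have e := hs₁.add_left
    ((Sum.inl (.chan c), .ch Us a) ::ₘ (Γ₀ + Env.list (fun i => .chan (d i)) Us))
  -- Now the visible observer is the sender, and the types of the sent channels pass from `Γ` to
  -- `Δ`.
  have e' := ((hX.config_left h).consistent.mono e).exchange hD hD'
  obtain ⟨l₁, l₂, T₁, T₂, h₁, h₂, h₃⟩ := hX.env h (e.trans e')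
  refine ⟨l₁ + 0 + l₂, Matches.beside ?_ (by simpa using h₃) hR'⟩
  exact ((hr T₁.res Γ₀ D Us a hD).besideR b T₁.proc).matches (h₁.beside hR b)
    (h₂.beside hR' b)

theorem IsSim.beside_tau (hX : IsSim X) (h : X (Γ + Δ) z S T) (hR : Typed Δ R)
    {M : Set Chan} {R' : Proc 0 0} (hs : PreStep Γ ⟨S.res, R⟩ .tau k Γ' ⟨M, R'⟩) :
    ∃ l T', WeakHat Γ (T.beside b R) .tau l Γ' T' ∧
      Beside b X Γ' (z + l - k) (Sys.beside b ⟨M, S.proc⟩ R') T' := by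
  obtain ⟨rfl, -⟩ := hs.tau_inv
  have hc := (hX.config_left h).consistent.mono (.of_le (Multiset.le_add_left _ _))
  generalize hM : S.res = M₀ at hs
  have hm := Typed.tau_step hs hR hc
  dsimp only at hm
  cases hm with
  | internal hR' hr =>
    subst hM
    -- A conditional in `R` needs its channels allocated. They lie in the domain of `Δ`, hence are
    -- allocated in every configuration of the joint observer.
    have hN : Δ.dom ⊆ T.res := by
      have := (hX.config_right h).2.1
      rw [Env.dom_add, Set.union_subset_iff] at this
      exact this.2
    refine ⟨0 + 0, Matches.beside (T' := T) ?_ (S' := S) (by simpa using h) hR'⟩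
    exact ((Run.refl _).tau ((hr T.res Γ' hN).besideR b T.proc)).matches
  | @alloc _ c n Us hc' hR' hr =>
    subst hM
    -- The allocation by `R` is played as one by the observer, at the same cost.
    have hp := PreStep.allocE (Γ := Γ' + Δ) (P := S.proc) Us hc'
    rw [← Multiset.add_cons] at hp
    obtain ⟨l₁, l₂, l₃, T₁, T₂, T₃, h₁, h₂, h₃, h₄⟩ := hX.visible h (by simp) hp
    -- The observer reached is prescribed and mentions `c`, so the answer allocates the same
    -- channel. In particular `c` is unused in `T₁`, and `R` can allocate it there.
    obtain ⟨rfl, c', n', Us', hc₁, he, rfl⟩ := h₂.alloc_inv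
    rw [Multiset.add_cons, Multiset.cons_inj_left, Prod.mk.injEq, Sum.inl.injEq,
      Val.chan.injEq] at he
    obtain ⟨rfl, -⟩ := he
    refine ⟨_, Matches.beside ?_ h₄ hR'⟩
    exact (((h₁.beside hR b).tau ((hr T₁.res Γ' hc₁).besideR b T₁.proc)).trans
      (h₃.beside hR' b)).matches
  | @free _ c n Us Δ' hc' hs' hR₁ hR' hr =>
    subst hM
    -- A structural move first exposes the uniqueness of `c` within `Δ`; then the observer itself
    -- can free `c`.
    obtain ⟨l₁, l₂, T₁, T₂, h₁, h₂, h₃⟩ := hX.env h (hs'.add_left Γ')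
    have hp := PreStep.freeE (Γ := Γ' + Δ') (P := S.proc) Us hc'
    rw [← Multiset.add_cons] at hp
    obtain ⟨m₁, m₂, m₃, T₃, T₄, T₅, h₄, h₅, h₆, h₇⟩ := hX.visible h₃ (by simp) hp
    obtain ⟨rfl, hc₁, rfl, -⟩ := h₅.free_inv
    have hrun := ((((h₁.beside hR b).trans (h₂.beside hR₁ b)).trans (h₄.beside hR₁ b)).tau
      ((hr T₃.res Γ' hc₁).besideR b T₃.proc)).trans (h₆.beside hR' b)
    refine ⟨_, Matches.beside hrun.matches ?_ hR'⟩
    convert h₇ using 1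
    ring

/-- The joint observer receives from `S` with the input permission of `R`, and learns the values at
the types that `R` needs to continue. The output of the answer is then combined with the input of
`R` into a silent step. -/
theorem IsSim.beside_out_inp (hX : IsSim X) (h : X (Γ + Δ) z S T) (hR : Typed Δ R)
    {c : Chan} {n : ℕ} {d : Fin n → Chan} {P' R' : Proc 0 0} {Γ₁ Γ₁' Γ₂ Γ₂' : Env 0 0}
    (h₁ : PreStep Γ₁ S (.out c n d) 0 Γ₁' ⟨S.res, P'⟩)
    (h₂ : PreStep Γ₂ ⟨S.res, R⟩ (.inp c n d) 0 Γ₂' ⟨S.res, R'⟩) :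
    ∃ l T', WeakHat Γ (T.beside b R) .tau l Γ T' ∧
      Beside b X Γ (z + l - 0) (Sys.beside b ⟨S.res, P'⟩ R') T' := by
  obtain ⟨Δ₀, D, Us, a, hD, hs, hR₁, hR'⟩ := hR.inp_step h₂
  obtain ⟨l₁, l₂, T₁, T₂, r₁, r₂, hX₁⟩ := hX.env h (hs.add_left Γ)
  have hp := h₁.out_inv.2.2.2 S.res (Γ + Δ₀) D Us a hD
  rw [← Multiset.add_cons, add_assoc Γ, add_assoc Γ] at hp
  obtain ⟨m₁, m₂, m₃, T₃, T₄, T₅, r₃, hT, r₄, hX₂⟩ := hX.visible hX₁ (by simp) hp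
  obtain ⟨rfl, hres, -, ho⟩ := hT.out_inv
  -- The environments of the partners do not matter in a communication, so the rest is taken to be
  -- empty; only the resources have to be those of `T₃`.
  have hi := h₂.inp_inv.2.2.2 T₃.res 0 D Us a hD
  have hcom := PreStep.beside_out_inp (Γ := Γ) b (ho T₃.res 0 D Us a hD) hi
  have e : Sys.beside b ⟨T₃.res, T₄.proc⟩ R' = T₄.beside b R' := by
    rw [Sys.beside, Sys.beside, hres]
  rw [e] at hcom
  have hrun := ((((r₁.beside hR b).trans (r₂.beside hR₁ b)).trans (r₃.beside hR₁ b)).tau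
    hcom).trans (r₄.beside hR' b)
  refine ⟨_, Matches.beside hrun.matches ?_ hR'⟩
  convert hX₂ using 1
  ring

/-- The joint observer sends to `S`, paying with the permission and the value assumptions that `R`
gives up. -/
theorem IsSim.beside_inp_out (hX : IsSim X) (h : X (Γ + Δ) z S T) (hR : Typed Δ R)
    {c : Chan} {n : ℕ} {d : Fin n → Chan} {P' R' : Proc 0 0} {Γ₁ Γ₁' Γ₂ Γ₂' : Env 0 0}
    (h₁ : PreStep Γ₁ S (.inp c n d) 0 Γ₁' ⟨S.res, P'⟩)
    (h₂ : PreStep Γ₂ ⟨S.res, R⟩ (.out c n d) 0 Γ₂' ⟨S.res, R'⟩) :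
    ∃ l T', WeakHat Γ (T.beside b R) .tau l Γ T' ∧
      Beside b X Γ (z + l - 0) (Sys.beside b ⟨S.res, P'⟩ R') T' := by
  obtain ⟨Δ₀, D, Us, a, hD, hs, hR₁, hR'⟩ := hR.out_step h₂
  obtain ⟨l₁, l₂, T₁, T₂, r₁, r₂, hX₁⟩ := hX.env h (hs.add_left Γ)
  have hp := h₁.inp_inv.2.2.2 S.res (Γ + Δ₀) D Us a hD
  rw [add_assoc, ← Multiset.add_cons, add_assoc Γ] at hp
  obtain ⟨m₁, m₂, m₃, T₃, T₄, T₅, r₃, hT, r₄, hX₂⟩ := hX.visible hX₁ (by simp) hp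
  obtain ⟨rfl, hres, -, hi⟩ := hT.inp_inv
  have ho := h₂.out_inv.2.2.2 T₃.res 0 D Us a hD
  have hcom := PreStep.beside_inp_out (Γ := Γ) b (hi T₃.res 0 D Us a hD) ho
  have e : Sys.beside b ⟨T₃.res, T₄.proc⟩ R' = T₄.beside b R' := by
    rw [Sys.beside, Sys.beside, hres]
  rw [e] at hcom
  have hrun := ((((r₁.beside hR b).trans (r₂.beside hR₁ b)).trans (r₃.beside hR₁ b)).tau
    hcom).trans (r₄.beside hR' b)
  refine ⟨_, Matches.beside hrun.matches ?_ hR'⟩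
  convert hX₂ using 1
  ring

theorem IsSim.beside_preStep (hX : IsSim X) (h : X (Γ + Δ) z S T) (hR : Typed Δ R)
    (hs : PreStep Γ (S.beside b R) μ k Γ' S') :
    ∃ l T', WeakHat Γ (T.beside b R) μ l Γ' T' ∧ Beside b X Γ' (z + l - k) S' T' := by
  rcases hs.beside_inv with ⟨S₁, rfl, h₁⟩ | ⟨M, R', rfl, h₁⟩ |
    ⟨rfl, rfl, rfl, c, n, d, P', R', Γ₁, Γ₁', Γ₂, Γ₂', rfl, ⟨h₁, h₂⟩ | ⟨h₁, h₂⟩⟩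
  · exact hX.beside_left h hR h₁
  · cases μ with
    | out c n d => exact hX.beside_out h hR h₁
    | inp c n d => exact hX.beside_inp h hR h₁
    | tau => exact hX.beside_tau h hR h₁
    | env =>
      -- Moves of the observer derived through `R` do not involve `R`; here and below they are
      -- attributed to `S`.
      obtain ⟨rfl, he, hs'⟩ := h₁.env_inv
      cases he
      exact hX.beside_left h hR (.str hs')
    | alloc =>
      obtain ⟨rfl, c, n, Us, hc, rfl, he⟩ := h₁.alloc_inv
      cases he
      exact hX.beside_left h hR (.allocE Us hc)
    | free c =>
      obtain ⟨rfl, hc, he, n, Us, rfl⟩ := h₁.free_inv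
      cases he
      exact hX.beside_left h hR (.freeE Us hc)
  · exact hX.beside_out_inp h hR h₁ h₂
  · exact hX.beside_inp_out h hR h₁ h₂

/-- The renamings on the left fix `Γ` but may move channels of `Δ`; so the whole situation, with
`Δ`, `R` and both systems, is transported along them before the pre-transition is analysed. -/
theorem IsSim.beside_sim (hX : IsSim X) (h : Beside b X Γ z S T) (hs : Step Γ S μ k Γ' S') :
    ∃ l T', WeakHat Γ T μ l Γ' T' ∧ Beside b X Γ' (z + l - k) S' T' := by
  obtain ⟨Δ, S₀, T₀, R, s, t, hs₀, ht, h, hR, rfl, rfl⟩ := h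
  obtain ⟨u, hu, hs⟩ := hs
  have hus : Fixes (u * s) Γ := Fixes.mul hu hs₀
  have h' := hX.rename (u * s) h
  rw [Env.mapChan_add, Env.mapChan_eq_self hus] at h'
  rw [Sys.rename_rename, Sys.rename_beside] at hs
  obtain ⟨l, T', hT, hB⟩ := hX.beside_preStep h' (hR.mapChan _) hs
  rw [← Sys.rename_beside] at hT
  -- The right system carries its own renaming `t`. It differs from the transported one by a
  -- renaming that fixes `Γ`, which a nonempty match absorbs at its start.
  have hts : Fixes (u * s * t⁻¹) Γ := hus.mul ht.inv
  have e : (T₀.beside b R).rename (u * s) =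
      ((T₀.beside b R).rename t).rename (u * s * t⁻¹) := by
    rw [Sys.rename_rename, inv_mul_cancel_right]
  rcases hT with hT | ⟨rfl, rfl, rfl, rfl⟩
  · rw [e] at hT
    exact ⟨l, T', .inl (hT.of_rename hts), hB⟩
  · obtain ⟨Δ', S₁, T₁, R', v, w, hv, hw, h₁, h₂, rfl, h₃⟩ := hB
    -- An empty match has no transition to absorb the discrepancy, so it goes into the right
    -- renaming of `Beside`.
    refine ⟨0, _, .inr ⟨rfl, rfl, rfl, rfl⟩, Δ', S₁, T₁, R', v, (u * s * t⁻¹)⁻¹ * w, hv,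
      hts.inv.mul hw, h₁, h₂, rfl, ?_⟩
    rw [← Sys.rename_rename, ← h₃, e, Sys.rename_inv]

theorem Beside.config_left (hX : IsSim X) (h : Beside b X Γ z S T) : IsConfig Γ S := by
  obtain ⟨Δ, S₀, T₀, R, s, t, hs, ht, h, hR, rfl, rfl⟩ := h
  have := ((hX.config_left h).beside hR b).rename s
  rwa [Env.mapChan_eq_self hs] at this

theorem Beside.config_right (hX : IsSim X) (h : Beside b X Γ z S T) : IsConfig Γ T := by
  obtain ⟨Δ, S₀, T₀, R, s, t, hs, ht, h, hR, rfl, rfl⟩ := h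
  have := ((hX.config_right h).beside hR b).rename t
  rwa [Env.mapChan_eq_self ht] at this

end

/-! ### Bisimilarity -/

theorem isBisimulation_bisim : IsBisimulation Bisim := by
  rintro Γ n S T ⟨𝓡, h𝓡, h⟩
  obtain ⟨h₁, h₂, h₃, h₄⟩ := h𝓡 Γ n S T h
  refine ⟨h₁, h₂, fun μ k Γ' S' hs => ?_, fun μ l Γ' T' hs => ?_⟩
  · obtain ⟨l, T', n', h₅, h₆, h₇⟩ := h₃ μ k Γ' S' hs
    exact ⟨l, T', n', h₅, h₆, 𝓡, h𝓡, h₇⟩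
  · obtain ⟨k, S', n', h₅, h₆, h₇⟩ := h₄ μ l Γ' T' hs
    exact ⟨k, S', n', h₅, h₆, 𝓡, h𝓡, h₇⟩

/-- The inverse image of bisimilarity under the renaming is a bisimulation, as transitions and
configurations are equivariant. -/
theorem Bisim.rename {Γ : Env 0 0} {n : ℕ} {S T : Sys} (h : Bisim Γ n S T)
    (s : Equiv.Perm Chan) : Bisim (Γ.mapChan s) n (S.rename s) (T.rename s) := by
  refine ⟨fun Γ n S T => Bisim (Γ.mapChan ⇑s⁻¹) n (S.rename s⁻¹) (T.rename s⁻¹), ?_, ?_⟩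
  · intro Γ n S T h
    obtain ⟨h₁, h₂, h₃, h₄⟩ := isBisimulation_bisim _ _ _ _ h
    refine ⟨?_, ?_, fun μ k Γ' S' hs => ?_, fun μ l Γ' T' hs => ?_⟩
    · simpa only [Env.mapChan_inv', Sys.rename_inv'] using h₁.rename s
    · simpa only [Env.mapChan_inv', Sys.rename_inv'] using h₂.rename s
    · obtain ⟨l, T', n', h₅, h₆, h₇⟩ := h₃ _ _ _ _ (hs.rename s⁻¹)
      refine ⟨l, T'.rename s, n', ?_, h₆, ?_⟩
      · simpa only [Env.mapChan_inv', Sys.rename_inv', Label.mapChan_inv'] using h₅.rename s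
      · simpa only [Sys.rename_inv] using h₇
    · obtain ⟨k, S', n', h₅, h₆, h₇⟩ := h₄ _ _ _ _ (hs.rename s⁻¹)
      refine ⟨k, S'.rename s, n', ?_, h₆, ?_⟩
      · simpa only [Env.mapChan_inv', Sys.rename_inv', Label.mapChan_inv'] using h₅.rename s
      · simpa only [Sys.rename_inv] using h₇
  · simpa only [Env.mapChan_inv, Sys.rename_inv] using h

/-- Bisimilarity with an integer credit. -/
def BisimPos (Γ : Env 0 0) (z : ℤ) (S T : Sys) : Prop := ∃ n : ℕ, (n : ℤ) = z ∧ Bisim Γ n S T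

/-- Converse bisimilarity, with the negated credit. -/
def BisimNeg (Γ : Env 0 0) (z : ℤ) (S T : Sys) : Prop := BisimPos Γ (-z) T S

theorem isSim_bisimPos : IsSim BisimPos where
  config_left := fun ⟨_, _, h⟩ => (isBisimulation_bisim _ _ _ _ h).1
  config_right := fun ⟨_, _, h⟩ => (isBisimulation_bisim _ _ _ _ h).2.1
  sim := by
    rintro Γ z S T μ k Γ' S' ⟨n, rfl, h⟩ hs
    obtain ⟨l, T', n', h₁, h₂, h₃⟩ := (isBisimulation_bisim _ _ _ _ h).2.2.1 _ _ _ _ hs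
    exact ⟨l, T', h₁, n', h₂, h₃⟩
  rename := fun s ⟨n, hn, h⟩ => ⟨n, hn, h.rename s⟩

theorem isSim_bisimNeg : IsSim BisimNeg where
  config_left := fun ⟨_, _, h⟩ => (isBisimulation_bisim _ _ _ _ h).2.1
  config_right := fun ⟨_, _, h⟩ => (isBisimulation_bisim _ _ _ _ h).1
  sim := by
    rintro Γ z S T μ k Γ' S' ⟨n, hn, h⟩ hs
    obtain ⟨l, T', n', h₁, h₂, h₃⟩ := (isBisimulation_bisim _ _ _ _ h).2.2.2 _ _ _ _ hs
    exact ⟨l, T', h₁, n', by omega, h₃⟩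
  rename := fun s ⟨n, hn, h⟩ => ⟨n, hn, h.rename s⟩

/-- Closure under contexts commutes with taking converses because the renamings on the two sides are
independent. -/
theorem beside_bisimNeg {b : Bool} {Γ : Env 0 0} {z : ℤ} {S T : Sys} :
    Beside b BisimNeg Γ z T S ↔ Beside b BisimPos Γ (-z) S T := by
  constructor
  · rintro ⟨Δ, S₀, T₀, R, s, t, hs, ht, h, hR, rfl, rfl⟩
    exact ⟨Δ, T₀, S₀, R, t, s, ht, hs, h, hR, rfl, rfl⟩
  · rintro ⟨Δ, S₀, T₀, R, s, t, hs, ht, h, hR, rfl, rfl⟩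
    exact ⟨Δ, T₀, S₀, R, t, s, ht, hs, h, hR, rfl, rfl⟩

theorem Beside.exists_nat {b : Bool} {Γ : Env 0 0} {z : ℤ} {S T : Sys}
    (h : Beside b BisimPos Γ z S T) : ∃ n : ℕ, (n : ℤ) = z := by
  obtain ⟨Δ, S₀, T₀, R, s, t, hs, ht, ⟨n, hn, -⟩, -⟩ := h
  exact ⟨n, hn⟩

theorem isBisimulation_beside (b : Bool) :
    IsBisimulation fun Γ n S T => Beside b BisimPos Γ n S T := by
  intro Γ n S T h
  refine ⟨h.config_left isSim_bisimPos, h.config_right isSim_bisimPos, fun μ k Γ' S' hs => ?_,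
    fun μ l Γ' T' hs => ?_⟩
  · obtain ⟨l, T', h₁, h₂⟩ := isSim_bisimPos.beside_sim h hs
    obtain ⟨n', hn'⟩ := h₂.exists_nat
    exact ⟨l, T', n', h₁, hn', by simpa only [hn'] using h₂⟩
  -- The second half is the first for the converse relation at credit `-n`; adding the cost of the
  -- match and subtracting that of the move gives the required credit with opposite sign.
  · rw [← neg_neg (n : ℤ), ← beside_bisimNeg] at h
    obtain ⟨k, S', h₁, h₂⟩ := isSim_bisimNeg.beside_sim h hs
    rw [beside_bisimNeg] at h₂
    obtain ⟨n', hn'⟩ := h₂.exists_nat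
    exact ⟨k, S', n', h₁, by omega, by simpa only [hn'] using h₂⟩

theorem Bisim.beside {Γ Δ : Env 0 0} {n : ℕ} {S T : Sys} {R : Proc 0 0}
    (h : Bisim (Γ + Δ) n S T) (hR : Typed Δ R) (b : Bool) :
    Bisim Γ n (S.beside b R) (T.beside b R) :=
  ⟨_, isBisimulation_beside b, Δ, S, T, R, 1, 1, .one _, .one _, ⟨n, rfl, h⟩, hR,
    (Sys.rename_one _).symm, (Sys.rename_one _).symm⟩

end Picr

theorem mainTheorem1 (Γ Δ : Picr.Env 0 0) (n : ℕ) (M N : Set Picr.Chan)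
    (P Q R : Picr.Proc 0 0)
    (hPQ : Picr.Bisim (Γ + Δ) n ⟨M, P⟩ ⟨N, Q⟩) (hR : Picr.Typed Δ R) :
    Picr.Bisim Γ n ⟨M, .par P R⟩ ⟨N, .par Q R⟩ ∧
      Picr.Bisim Γ n ⟨M, .par R P⟩ ⟨N, .par R Q⟩ :=
  ⟨hPQ.beside hR true, hPQ.beside hR false⟩
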